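/- **Theorem (Gray stability).** Let $n\ge 0$ and let $M$ be a closed smooth manifold (compact, Hausdorff, without boundary, not necessarily connected) of dimension $2n+1$. A *contact structure* on $M$ is a hyperplane field $\xi\subset TM$ of the form $\xi=\ker\alpha$, where $\alpha$ is a smooth $1$-form on $M$ such that $\alpha\wedge(d\alpha)^n$ vanishes nowhere. Let $\xi_t$, $t\in[0,1]$, be a smooth family of contact structures on $M$, i.e. each $\xi_t$ is a contact structure, and near every point of $[0,1]\times M$ one can write $\xi_t=\ker\alpha_t$ with nowhere vanishing local $1$-forms $\alpha_t$ that depend smoothly on $(t,p)$. Then there is an isotopy $(\psi_t)_{t\in[0,1]}$ of $M$, i.e. a family of diffeomorphisms $\psi_t\colon M\to M$ with $\psi_0=\mathrm{id}_M$ such that $(t,p)\mapsto\psi_t(p)$ is smooth on $[0,1]\times M$, with $$T\psi_t(\xi_0)=\xi_t\quad\text{for each } t\in[0,1].$$ -/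

import Mathlib

open Set Bundle
open scoped Manifold ContDiff Topology

noncomputable section

namespace ContactGeometry

/-- The model space `ℝ^m`. -/
abbrev Model (m : ℕ) : Type := EuclideanSpace ℝ (Fin m)

section Forms

variable {m : ℕ} {M : Type*} [TopologicalSpace M] [ChartedSpace (Model m) M]

/-- The expression of a 1-form `α` in the preferred chart `φ` around `p`, i.e. the pull-back of `α`
under `φ⁻¹`, as a function on `ℝ^m` with values in linear forms
(meaningful on the target of the chart). -/
def localForm (α : ∀ p : M, TangentSpace (𝓡 m) p →L[ℝ] ℝ) (p : M) (y : Model m) :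
    Model m →L[ℝ] ℝ :=
  (α ((extChartAt (𝓡 m) p).symm y)).comp
    (mfderiv 𝓘(ℝ, Model m) (𝓡 m) (extChartAt (𝓡 m) p).symm y)

/-- The exterior derivative `dα` of a 1-form on a manifold, at `p`, on a pair of tangent vectors:
the pull-back under the chart at `p` of the exterior derivative of the local expression. -/
def extDerivForm (α : ∀ p : M, TangentSpace (𝓡 m) p →L[ℝ] ℝ) (p : M)
    (v w : TangentSpace (𝓡 m) p) : ℝ :=
  extDeriv
    (fun y => ContinuousAlternatingMap.ofSubsingleton ℝ (Model m) ℝ (0 : Fin 1) (localForm α p y))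
    (extChartAt (𝓡 m) p p)
    ![mfderiv (𝓡 m) 𝓘(ℝ, Model m) (extChartAt (𝓡 m) p) p v,
      mfderiv (𝓡 m) 𝓘(ℝ, Model m) (extChartAt (𝓡 m) p) p w]

end Forms

/-- The value of the wedge product `a ∧ b ∧ ⋯ ∧ b` (with `n` factors `b`) of a linear form `a` and
a skew-symmetric bilinear form `b` on `2n+1` vectors. -/
def wedgePow {V : Type*} (n : ℕ) (a : V → ℝ) (b : V → V → ℝ) (v : Fin (2 * n + 1) → V) : ℝ :=
  (1 / 2 ^ n) * ∑ σ : Equiv.Perm (Fin (2 * n + 1)),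
    ((Equiv.Perm.sign σ : ℤ) : ℝ) *
      (a (v (σ 0)) *
        ∏ i : Fin n, b (v (σ ⟨2 * i + 1, by omega⟩)) (v (σ ⟨2 * i + 2, by omega⟩)))

section Contact

variable {n : ℕ} {M : Type*} [TopologicalSpace M] [ChartedSpace (Model (2 * n + 1)) M]
  [IsManifold (𝓡 (2 * n + 1)) ∞ M]

/-- A contact form: a smooth 1-form `α` such that `α ∧ (dα)^n` vanishes nowhere. -/
structure IsContactForm (α : ∀ p : M, TangentSpace (𝓡 (2 * n + 1)) p →L[ℝ] ℝ) : Prop where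
  smooth : ContMDiff (𝓡 (2 * n + 1))
    ((𝓡 (2 * n + 1)).prod 𝓘(ℝ, Model (2 * n + 1) →L[ℝ] ℝ)) ∞
    (fun p : M => TotalSpace.mk' (Model (2 * n + 1) →L[ℝ] ℝ)
      (E := fun p : M => TangentSpace (𝓡 (2 * n + 1)) p →L[ℝ] ℝ) p (α p))
  nondegenerate : ∀ p : M, ∃ v : Fin (2 * n + 1) → TangentSpace (𝓡 (2 * n + 1)) p,
    wedgePow n (α p) (extDerivForm α p) v ≠ 0

/-- A (coorientable) contact structure: the kernel of a globally defined contact form. -/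
def IsContactStructure (ξ : ∀ p : M, Submodule ℝ (TangentSpace (𝓡 (2 * n + 1)) p)) : Prop :=
  ∃ α : ∀ p : M, TangentSpace (𝓡 (2 * n + 1)) p →L[ℝ] ℝ,
    IsContactForm α ∧ ∀ p : M, ξ p = LinearMap.ker (α p : TangentSpace (𝓡 (2 * n + 1)) p →ₗ[ℝ] ℝ)

/-- A family of hyperplane fields `ξ t`, `t ∈ [0,1]`, is smooth if, near every point of
`[0,1] × M`, it is the kernel of a nowhere vanishing 1-form depending smoothly on `(t, p)`. Values
`ξ t` with `t ∉ [0,1]` are irrelevant. -/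
def IsSmoothHyperplaneFamily
    (ξ : ℝ → ∀ p : M, Submodule ℝ (TangentSpace (𝓡 (2 * n + 1)) p)) : Prop :=
  ∀ t₀ ∈ Icc (0 : ℝ) 1, ∀ p₀ : M, ∃ U : Set (ℝ × M), IsOpen U ∧ (t₀, p₀) ∈ U ∧
    ∃ α : ℝ → ∀ p : M, TangentSpace (𝓡 (2 * n + 1)) p →L[ℝ] ℝ,
      ContMDiffOn (𝓘(ℝ, ℝ).prod (𝓡 (2 * n + 1)))
        ((𝓡 (2 * n + 1)).prod 𝓘(ℝ, Model (2 * n + 1) →L[ℝ] ℝ)) ∞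
        (fun q : ℝ × M => TotalSpace.mk' (Model (2 * n + 1) →L[ℝ] ℝ)
          (E := fun p : M => TangentSpace (𝓡 (2 * n + 1)) p →L[ℝ] ℝ) q.2 (α q.1 q.2))
        (U ∩ Icc (0 : ℝ) 1 ×ˢ univ) ∧
      ∀ t ∈ Icc (0 : ℝ) 1, ∀ p : M, (t, p) ∈ U →
        α t p ≠ 0 ∧ ξ t p = LinearMap.ker (α t p : TangentSpace (𝓡 (2 * n + 1)) p →ₗ[ℝ] ℝ)

/-- A smooth family of contact structures, parametrised by `t ∈ [0,1]`. -/
structure IsSmoothContactFamily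
    (ξ : ℝ → ∀ p : M, Submodule ℝ (TangentSpace (𝓡 (2 * n + 1)) p)) : Prop where
  contact : ∀ t ∈ Icc (0 : ℝ) 1, IsContactStructure (ξ t)
  smooth : IsSmoothHyperplaneFamily ξ

end Contact

/-- An isotopy of `M`: a family of diffeomorphisms `ψ t`, `t ∈ [0,1]`, of `M`, jointly smooth in
`(t, p) ∈ [0,1] × M`, with `ψ 0 = id`. Values `ψ t` with `t ∉ [0,1]` are irrelevant. -/
structure IsIsotopy {m : ℕ} {M : Type*} [TopologicalSpace M] [ChartedSpace (Model m) M]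
    (ψ : ℝ → M ≃ₘ^∞⟮𝓡 m, 𝓡 m⟯ M) : Prop where
  smooth : ContMDiffOn (𝓘(ℝ, ℝ).prod (𝓡 m)) (𝓡 m) ∞ (fun q : ℝ × M => ψ q.1 q.2)
    (Icc (0 : ℝ) 1 ×ˢ univ)
  zero : ∀ p : M, ψ 0 p = p

end ContactGeometry

end

noncomputable section

namespace ContactGeometry

open Filter
open scoped NNReal

/-! This is Moser's method. Look for a time-dependent vector field `X_t` tangent to `ξ_t` whose flow
carries `ξ_0` to `ξ_t`. If `ξ_t = ker α_t` locally, it suffices that `∂ₜα_t + i_{X_t} dα_t = μ_t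
α_t` for some function `μ_t`: along a trajectory, `β(t) = α_t(Tψ_t v)` then satisfies `β' = μβ`, so
it vanishes at all times or at none (`gray_transport`).

The equation has exactly one solution with `α_t(X_t) = 0`. The condition `α ∧ (dα)^n ≠ 0` makes `dα`
nondegenerate on `ker α` (`eq_zero_of_wedgePow_ne_zero`), so `(x, μ) ↦ (i_x dα - μα, α(x))` is
invertible, and the solution depends smoothly on the data (`exists_smooth_gray`). Replacing `α_t` by
`f_t α_t` changes only `μ_t`, because `α_t(X_t) = 0`. The equation is also natural under coordinate
changes (`GrayRel.transfer`). By uniqueness the local solutions agree on overlaps and form one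
global field (`IsSmoothContactFamily.exists_field`), so local defining forms are enough.

To integrate the field, embed the compact manifold in a Euclidean space and extend the field with
compact support. There the flow exists for all times in `[0,1]` and is smooth, by Grönwall estimates
and the variational equation (`exists_flow`). It preserves the submanifold (`trajectory_mem_range`),
and flows started at other times provide the inverses (`exists_isotopy`). In charts `gray_transport`
shows that `Tψ_t v ∈ ξ_t` is a locally constant condition in `t`, hence constant on `[0,1]`. Time
`0` gives the theorem. -/

section ODE

/-! ### Ordinary differential equations on a compact interval -/

variable {E : Type*} [NormedAddCommGroup E] [NormedSpace ℝ E]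

/-- Two-sided Grönwall inequality on a compact interval, with a constant depending only on the
growth rate and the interval. -/
theorem exists_gronwall_const (K : ℝ) (hK : 0 ≤ K) {a b : ℝ} (hab : a ≤ b) :
    ∃ C : ℝ, 0 ≤ C ∧ ∀ (f f' : ℝ → E) (δ ε t₀ : ℝ), t₀ ∈ Icc a b → 0 ≤ ε →
      (∀ t ∈ Icc a b, HasDerivWithinAt f (f' t) (Icc a b) t) → ‖f t₀‖ ≤ δ →
      (∀ t ∈ Icc a b, ‖f' t‖ ≤ K * ‖f t‖ + ε) → ∀ t ∈ Icc a b, ‖f t‖ ≤ C * (δ + ε) := by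
  -- For fixed `K` the bound is linear in `(δ, ε)` with nonnegative coefficients, and it increases
  -- with `x`. Its value at `δ = ε = 1` and full length `b - a` therefore serves as the constant.
  have key : ∀ δ ε x : ℝ, 0 ≤ δ → 0 ≤ ε → x ≤ b - a →
      gronwallBound δ K ε x ≤ gronwallBound 1 K 1 (b - a) * (δ + ε) := by
    intro δ ε x hδ hε hx
    refine (gronwallBound_mono hδ hε hK hx).trans ?_
    have hT : 0 ≤ b - a := by linarith
    rcases eq_or_lt_of_le hK with h | h
    · subst h
      simp only [gronwallBound_K0]
      nlinarith [mul_nonneg hδ hT, mul_nonneg hε hT]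
    · simp only [gronwallBound_of_K_ne_0 h.ne']
      have h1 : 1 ≤ Real.exp (K * (b - a)) := Real.one_le_exp (by positivity)
      have h2 : 0 ≤ (Real.exp (K * (b - a)) - 1) / K := div_nonneg (by linarith) h.le
      have e1 : ε / K * (Real.exp (K * (b - a)) - 1)
        = ε * ((Real.exp (K * (b - a)) - 1) / K) := by ring
      have e2 : 1 / K * (Real.exp (K * (b - a)) - 1)
        = ((Real.exp (K * (b - a)) - 1) / K) := by ring
      rw [e1, e2]
      nlinarith [mul_nonneg hδ h2, mul_nonneg hε (zero_le_one.trans h1)]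
  refine ⟨gronwallBound 1 K 1 (b - a), ?_, ?_⟩
  · have := gronwallBound_mono (δ := 1) (ε := 1) zero_le_one zero_le_one hK
      (show (0 : ℝ) ≤ b - a by linarith)
    rw [gronwallBound_x0] at this
    linarith
  intro f f' δ ε t₀ ht₀ hε hf hδ hbound t ht
  have hδ0 : 0 ≤ δ := (norm_nonneg _).trans hδ
  have hcont : ContinuousOn f (Icc a b) := fun s hs => (hf s hs).continuousWithinAt
  rcases le_total t₀ t with h | h
  · refine (norm_le_gronwallBound_of_norm_deriv_right_le (a := t₀) (b := b) (f := f) (f' := f')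
      (hcont.mono (Icc_subset_Icc_left ht₀.1)) ?_ hδ
      (fun x hx => hbound x ⟨ht₀.1.trans hx.1, hx.2.le⟩) t ⟨h, ht.2⟩).trans
        (key _ _ _ hδ0 hε (by linarith [ht.2, ht₀.1]))
    intro x hx
    refine (hf x ⟨ht₀.1.trans hx.1, hx.2.le⟩).mono_of_mem_nhdsWithin ?_
    exact mem_of_superset (Icc_mem_nhdsGE hx.2) (Icc_subset_Icc_left (ht₀.1.trans hx.1))
  -- Times before `t₀` are handled by the reflection `t ↦ -t`.
  · have := norm_le_gronwallBound_of_norm_deriv_right_le (a := -t₀) (b := -a)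
      (f := fun s => f (-s)) (f' := fun s => - f' (-s)) (δ := δ) (K := K) (ε := ε) ?_ ?_
      (by simpa using hδ) ?_ (-t) ⟨by linarith, by linarith [ht.1]⟩
    · rw [neg_neg] at this
      exact this.trans (key _ _ _ hδ0 hε (by linarith [ht.1, ht₀.2]))
    · exact hcont.comp continuous_neg.continuousOn
        (fun s hs => ⟨by linarith [hs.2], by linarith [hs.1, ht₀.2]⟩)
    · intro x hx
      have hx' : -x ∈ Icc a b := ⟨by linarith [hx.2], by linarith [hx.1, ht₀.2]⟩
      have h1 : HasDerivWithinAt f (f' (-x)) (Icc a (-x)) (-x) :=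
        (hf _ hx').mono (Icc_subset_Icc_right hx'.2)
      have h2 := h1.scomp x ((hasDerivAt_neg x).hasDerivWithinAt (s := Icc x (-a)))
        (fun s hs => ⟨by linarith [hs.2], by linarith [hs.1]⟩)
      have h3 : HasDerivWithinAt _ _ (Ici x) x :=
        h2.mono_of_mem_nhdsWithin (Icc_mem_nhdsGE hx.2)
      simpa [Function.comp_def] using h3
    · intro x hx
      rw [norm_neg]
      exact hbound _ ⟨by linarith [hx.2], by linarith [hx.1, ht₀.2]⟩

/-- Uniqueness of solutions of a Lipschitz ODE on a compact interval. -/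
theorem ode_unique {v : ℝ → E → E} {K : ℝ≥0} {a b t₀ : ℝ}
    (hv : ∀ t ∈ Icc a b, LipschitzWith K (v t)) (ht₀ : t₀ ∈ Icc a b) {f g : ℝ → E}
    (hf : ∀ t ∈ Icc a b, HasDerivWithinAt f (v t (f t)) (Icc a b) t)
    (hg : ∀ t ∈ Icc a b, HasDerivWithinAt g (v t (g t)) (Icc a b) t)
    (h : f t₀ = g t₀) : EqOn f g (Icc a b) := by
  obtain ⟨C, -, hC⟩ := exists_gronwall_const (E := E) K K.2 (ht₀.1.trans ht₀.2)
  intro t ht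
  have := hC (fun t => f t - g t) (fun t => v t (f t) - v t (g t)) 0 0 t₀ ht₀ le_rfl
    (fun t ht => (hf t ht).sub (hg t ht)) (by simp [h])
    (fun t ht => by simpa using (hv t ht).norm_sub_le (f t) (g t)) t ht
  rw [add_zero, mul_zero] at this
  exact sub_eq_zero.1 (norm_le_zero_iff.1 this)

/-- Global existence for a bounded Lipschitz ODE on a compact interval. -/
theorem ode_exists [CompleteSpace E] {v : ℝ → E → E} {K L : ℝ≥0} {a b t₀ : ℝ}
    (hv : ∀ t ∈ Icc a b, LipschitzWith K (v t))
    (hc : ∀ x, ContinuousOn (fun t => v t x) (Icc a b))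
    (hL : ∀ t ∈ Icc a b, ∀ x, ‖v t x‖ ≤ L) (ht₀ : t₀ ∈ Icc a b) (x₀ : E) :
    ∃ α : ℝ → E, α t₀ = x₀ ∧ ∀ t ∈ Icc a b, HasDerivWithinAt α (v t (α t)) (Icc a b) t := by
  have hab : 0 ≤ b - a := by linarith [ht₀.1, ht₀.2]
  -- With speed at most `L`, no solution leaves the ball of radius `L (b - a)` during `[a, b]`, so
  -- one application covers the whole interval.
  have : IsPicardLindelof v (⟨t₀, ht₀⟩ : Icc a b) x₀ (L * ⟨b - a, hab⟩) 0 L K :=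
    { lipschitzOnWith := fun t ht => (hv t ht).lipschitzOnWith
      continuousOn := fun x _ => hc x
      norm_le := fun t ht x _ => hL t ht x
      mul_max_le := by
        simp only [NNReal.coe_zero, sub_zero]
        refine mul_le_mul_of_nonneg_left (max_le ?_ ?_) L.2
        · linarith [ht₀.1]
        · linarith [ht₀.2] }
  exact this.exists_eq_forall_mem_Icc_hasDerivWithinAt₀

/-- Global existence for linear ODEs with continuous coefficients. -/
theorem linear_ode_exists [FiniteDimensional ℝ E] {A : ℝ → E →L[ℝ] E} {a b t₀ : ℝ}
    (hA : ContinuousOn A (Icc a b)) (ht₀ : t₀ ∈ Icc a b) (x₀ : E) :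
    ∃ α : ℝ → E, α t₀ = x₀ ∧ ∀ t ∈ Icc a b, HasDerivWithinAt α (A t (α t)) (Icc a b) t := by
  have : CompleteSpace E := FiniteDimensional.complete ℝ E
  obtain ⟨K, hK⟩ := isCompact_Icc.exists_bound_of_continuousOn hA
  have hK0 : 0 ≤ K := (norm_nonneg _).trans (hK t₀ ht₀)
  obtain ⟨C, hC0, hC⟩ := exists_gronwall_const (E := E) K hK0 (ht₀.1.trans ht₀.2)
  have hR : 0 < C * (‖x₀‖ + 0) + 1 := by positivity
  -- Truncating makes the field bounded and Lipschitz. The inner radius exceeds the Grönwall bound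
  -- `C ‖x₀‖`, which the truncated equation also obeys, so the solution never meets the truncation.
  let χ : ContDiffBump (0 : E) := ⟨C * (‖x₀‖ + 0) + 1, C * (‖x₀‖ + 0) + 2, hR, by linarith⟩
  have hsupp : HasCompactSupport (fun x => χ x • x) := χ.hasCompactSupport.smul_right
  have hsmooth : ContDiff ℝ 1 (fun x => χ x • x) := χ.contDiff.smul contDiff_id
  obtain ⟨K₁, hK₁⟩ := hsmooth.lipschitzWith_of_hasCompactSupport hsupp one_ne_zero
  obtain ⟨L, hL⟩ := hsupp.exists_bound_of_continuous hsmooth.continuous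
  have hL0 : 0 ≤ L := (norm_nonneg _).trans (hL 0)
  obtain ⟨α, h0, hα⟩ := ode_exists (v := fun t x => A t (χ x • x)) (K := ⟨K, hK0⟩ * K₁)
    (L := ⟨K, hK0⟩ * ⟨L, hL0⟩) (a := a) (b := b) (t₀ := t₀)
    (fun t ht => by
      refine LipschitzWith.comp (g := fun x => χ x • x) ?_ hK₁
      exact (A t).lipschitz.weaken (hK t ht))
    (fun x => hA.clm_apply continuousOn_const)
    (fun t ht x => ((A t).le_opNorm _).trans
      (mul_le_mul (hK t ht) (hL x) (norm_nonneg _) hK0)) ht₀ x₀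
  refine ⟨α, h0, fun t ht => ?_⟩
  have hb := hC α (fun t => A t (χ (α t) • α t)) ‖x₀‖ 0 t₀ ht₀ le_rfl hα (by rw [h0])
    (fun t ht => by
      rw [add_zero]
      refine ((A t).le_opNorm _).trans (mul_le_mul (hK t ht) ?_ (norm_nonneg _) hK0)
      rw [norm_smul, Real.norm_of_nonneg χ.nonneg]
      exact mul_le_of_le_one_left (norm_nonneg _) χ.le_one) t ht
  have h1 : χ (α t) = 1 := χ.one_of_mem_closedBall (by
    rw [mem_closedBall_zero_iff]; exact hb.trans (by simp [χ]))
  have := hα t ht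
  rwa [h1, one_smul] at this

end ODE

section SmoothDependence

/-! ### Smooth dependence on initial values -/

/-- A function that is continuous on `[a, b] × X` is continuous in the second variable, uniformly in
the first one. -/
theorem eventually_forall_Icc_dist_lt {X Y : Type*} [TopologicalSpace X] [PseudoMetricSpace Y]
    {a b : ℝ} {h : ℝ → X → Y} (hh : ContinuousOn (fun q : ℝ × X => h q.1 q.2) (Icc a b ×ˢ univ))
    (x₀ : X) {ε : ℝ} (hε : 0 < ε) :
    ∀ᶠ x in 𝓝 x₀, ∀ t ∈ Icc a b, dist (h t x) (h t x₀) < ε := by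
  obtain ⟨v, hv, H⟩ := (isCompact_Icc (a := a) (b := b)).mem_uniformity_of_prod
    (f := fun x t => h t x) (s := univ) (q := x₀)
    (hh.comp continuous_swap.continuousOn (fun q hq => ⟨hq.2, trivial⟩)) (mem_univ _)
    (Metric.dist_mem_uniformity hε)
  rw [nhdsWithin_univ] at hv
  exact mem_of_superset hv fun x hx t ht => H x hx t ht

variable {P E : Type*} [NormedAddCommGroup P] [NormedSpace ℝ P]
  [NormedAddCommGroup E] [NormedSpace ℝ E]

/-- A function on `[a, b] × P` with continuous partial derivatives is differentiable. -/
theorem hasFDerivWithinAt_of_partial {a b : ℝ} {Φ : ℝ → P → E} {d : E} {W : ℝ → P → P →L[ℝ] E}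
    {t : ℝ} {z : P} (ht : t ∈ Icc a b)
    (h1 : HasDerivWithinAt (fun s => Φ s z) d (Icc a b) t)
    (h2 : ∀ s ∈ Icc a b, ∀ y, HasFDerivAt (Φ s) (W s y) y)
    (hW : ContinuousOn (fun q : ℝ × P => W q.1 q.2) (Icc a b ×ˢ univ)) :
    HasFDerivWithinAt (fun q : ℝ × P => Φ q.1 q.2)
      ((ContinuousLinearMap.fst ℝ ℝ P).smulRight d
        + (W t z).comp (ContinuousLinearMap.snd ℝ ℝ P)) (Icc a b ×ˢ univ) (t, z) := by
  rw [hasFDerivWithinAt_iff_isLittleO]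
  have e1 : (fun q : ℝ × P => Φ q.1 z - Φ t z - (q.1 - t) • d)
      =o[𝓝[Icc a b ×ˢ univ] (t, z)] fun q => q - (t, z) := by
    have := hasDerivWithinAt_iff_isLittleO.1 h1
    have htd : Tendsto Prod.fst (𝓝[Icc a b ×ˢ (univ : Set P)] (t, z)) (𝓝[Icc a b] t) :=
      (continuous_fst.tendsto' (t, z) t rfl).inf
        (tendsto_principal_principal.2 fun q hq => hq.1)
    refine (this.comp_tendsto htd).trans_isBigO (Asymptotics.isBigO_of_le _ fun q => ?_)
    exact norm_fst_le (q - (t, z))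
  -- The increment in the second variable is taken at the moving time `q.1`. The mean value
  -- inequality together with joint continuity of `W` makes its linearisation error uniform in that
  -- time.
  have e2 : (fun q : ℝ × P => Φ q.1 q.2 - Φ q.1 z - W t z (q.2 - z))
      =o[𝓝[Icc a b ×ˢ univ] (t, z)] fun q => q - (t, z) := by
    rw [Asymptotics.isLittleO_iff]
    intro ε hε
    have hc := (hW (t, z) ⟨ht, trivial⟩)
    have := Metric.continuousWithinAt_iff.1 hc ε hε
    obtain ⟨ρ, hρ, H⟩ := this
    filter_upwards [self_mem_nhdsWithin,
      mem_nhdsWithin_of_mem_nhds (Metric.ball_mem_nhds (t, z) hρ)] with q hq hq'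
    rw [← ball_prod_same] at hq'
    refine (Convex.norm_image_sub_le_of_norm_hasFDerivWithin_le' (f := Φ q.1) (f' := W q.1)
      (C := ε) (s := Metric.ball z ρ) (fun x hx => (h2 q.1 hq.1 x).hasFDerivWithinAt)
      (fun x hx => ?_) (convex_ball _ _) (Metric.mem_ball_self hρ) hq'.2).trans ?_
    · have := H (x := (q.1, x)) ⟨hq.1, trivial⟩ (by
        rw [← Metric.mem_ball, ← ball_prod_same]; exact ⟨hq'.1, hx⟩)
      rw [dist_eq_norm] at this
      exact this.le
    · exact mul_le_mul_of_nonneg_left (norm_snd_le (q - (t, z))) hε.le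
  refine (e1.add e2).congr_left fun q => ?_
  simp only [add_apply, ContinuousLinearMap.smulRight_apply,
    ContinuousLinearMap.coe_fst', ContinuousLinearMap.comp_apply, ContinuousLinearMap.coe_snd',
    Prod.fst_sub, Prod.snd_sub]
  abel

/-- The solutions of an ODE depend differentiably on parameters of the initial value, and the
derivative solves the linearised equation. -/
theorem exists_variational_solution [FiniteDimensional ℝ P] [FiniteDimensional ℝ E]
    {a b t₀ : ℝ} (ht₀ : t₀ ∈ Icc a b) {f : ℝ → E → E} {f' : ℝ → E → E →L[ℝ] E}
    (hf : ∀ t ∈ Icc a b, ∀ x, HasFDerivAt (f t) (f' t x) x)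
    (hf' : ContinuousOn (fun q : ℝ × E => f' q.1 q.2) (Icc a b ×ˢ univ))
    {Φ : ℝ → P → E} (hΦ : ContinuousOn (fun q : ℝ × P => Φ q.1 q.2) (Icc a b ×ˢ univ))
    (hode : ∀ t ∈ Icc a b, ∀ z, HasDerivWithinAt (fun s => Φ s z) (f t (Φ t z)) (Icc a b) t)
    {g' : P → P →L[ℝ] E} (hg : ∀ z, HasFDerivAt (Φ t₀) (g' z) z) (hg' : Continuous g') :
    ∃ W : ℝ → P → P →L[ℝ] E, ContinuousOn (fun q : ℝ × P => W q.1 q.2) (Icc a b ×ˢ univ) ∧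
      (∀ t ∈ Icc a b, ∀ z, HasFDerivAt (Φ t) (W t z) z) ∧ (∀ z, W t₀ z = g' z) ∧
      ∀ t ∈ Icc a b, ∀ z,
        HasDerivWithinAt (fun s => W s z) ((f' t (Φ t z)).comp (W t z)) (Icc a b) t := by
  have hab : a ≤ b := ht₀.1.trans ht₀.2
  have hA : ContinuousOn (fun q : ℝ × P => f' q.1 (Φ q.1 q.2)) (Icc a b ×ˢ univ) :=
    hf'.comp (continuousOn_fst.prodMk hΦ) (fun q hq => ⟨hq.1, trivial⟩)
  have hAz : ∀ z, ContinuousOn (fun t => f' t (Φ t z)) (Icc a b) := fun z =>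
    hA.comp (f := fun t => (t, z)) (continuous_id.prodMk continuous_const).continuousOn
      (fun t ht => ⟨ht, trivial⟩)
  -- The candidate for the derivative in `z` is the solution of the linearised equation along the
  -- trajectory of `z`.
  have hex : ∀ z, ∃ α : ℝ → P →L[ℝ] E, α t₀ = g' z ∧ ∀ t ∈ Icc a b,
      HasDerivWithinAt α ((f' t (Φ t z)).comp (α t)) (Icc a b) t := fun z =>
    linear_ode_exists (A := fun t => ContinuousLinearMap.compL ℝ P E E (f' t (Φ t z)))
      ((ContinuousLinearMap.compL ℝ P E E).continuous.comp_continuousOn (hAz z)) ht₀ (g' z)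
  choose W hW0 hWode using hex
  have hWz : ∀ z, ContinuousOn (W z) (Icc a b) := fun z t ht => (hWode z t ht).continuousWithinAt
  refine ⟨fun t z => W z t, ?_, ?_, hW0, fun t ht z => hWode z t ht⟩
  · rintro ⟨t₁, z₁⟩ ⟨ht₁, -⟩
    obtain ⟨K, hK⟩ := isCompact_Icc.exists_bound_of_continuousOn (hAz z₁)
    have hK0 : 0 ≤ K := (norm_nonneg _).trans (hK t₀ ht₀)
    obtain ⟨M, hM⟩ := isCompact_Icc.exists_bound_of_continuousOn (hWz z₁)
    have hM0 : 0 ≤ M := (norm_nonneg _).trans (hM t₀ ht₀)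
    -- The rate `K + 1` bounds `f'` along all trajectories that stay `η`-close in the coefficient,
    -- since `η ≤ 1`. The difference of two solutions `W` then solves a linear equation with
    -- inhomogeneity at most `η M`.
    obtain ⟨C, hC0, hC⟩ := exists_gronwall_const (E := P →L[ℝ] E) (K + 1) (by linarith) hab
    rw [ContinuousWithinAt, Metric.tendsto_nhds]
    intro ε hε
    obtain ⟨η, hη, hη1, hηε⟩ : ∃ η > 0, η ≤ 1 ∧ C * (η + η * M) < ε / 2 := by
      refine ⟨min 1 (ε / 2 / (C * (1 + M) + 1)), by positivity, min_le_left _ _, ?_⟩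
      have h1 : min 1 (ε / 2 / (C * (1 + M) + 1)) * (C * (1 + M) + 1) ≤ ε / 2 := by
        rw [← le_div_iff₀ (by positivity)]; exact min_le_right _ _
      have h2 : 0 < min 1 (ε / 2 / (C * (1 + M) + 1)) := by positivity
      nlinarith
    have n1 : ∀ᶠ z in 𝓝 z₁, ∀ t ∈ Icc a b, dist (f' t (Φ t z)) (f' t (Φ t z₁)) < η :=
      eventually_forall_Icc_dist_lt (h := fun t z => f' t (Φ t z)) hA z₁ hη
    have n2 : ∀ᶠ z in 𝓝 z₁, dist (g' z) (g' z₁) < η := Metric.tendsto_nhds.1 hg'.continuousAt η hη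
    have n3 : ∀ᶠ t in 𝓝[Icc a b] t₁, dist (W z₁ t) (W z₁ t₁) < ε / 2 :=
      Metric.tendsto_nhds.1 (hWz z₁ t₁ ht₁) _ (by positivity)
    have n4 := n3.prod_mk (n1.and n2)
    rw [← nhdsWithin_univ, ← nhdsWithin_prod_eq] at n4
    filter_upwards [n4, self_mem_nhdsWithin] with ⟨t, z⟩ ⟨h3, h1, h2⟩ ⟨ht, _⟩
    have hd := hC (fun t => W z t - W z₁ t)
      (fun t => (f' t (Φ t z)).comp (W z t) - (f' t (Φ t z₁)).comp (W z₁ t)) η (η * M) t₀ ht₀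
      (by positivity) (fun t ht => (hWode z t ht).sub (hWode z₁ t ht))
      (by rw [hW0, hW0, ← dist_eq_norm]; exact h2.le) (fun s hs => ?_) t ht
    · rw [← dist_eq_norm] at hd
      exact (dist_triangle _ (W z₁ t) _).trans_lt (by linarith)
    · have e : (f' s (Φ s z)).comp (W z s) - (f' s (Φ s z₁)).comp (W z₁ s)
          = (f' s (Φ s z)).comp (W z s - W z₁ s)
            + (f' s (Φ s z) - f' s (Φ s z₁)).comp (W z₁ s) := by
        ext v; simp
      have d1 := h1 s hs
      rw [dist_eq_norm] at d1
      have d2 : ‖f' s (Φ s z)‖ ≤ K + 1 := by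
        have := norm_le_norm_add_norm_sub' (f' s (Φ s z)) (f' s (Φ s z₁))
        linarith [hK s hs]
      rw [e]
      refine (norm_add_le _ _).trans (add_le_add ?_ ?_)
      · exact (ContinuousLinearMap.opNorm_comp_le _ _).trans
          (mul_le_mul_of_nonneg_right d2 (norm_nonneg _))
      · exact (ContinuousLinearMap.opNorm_comp_le _ _).trans
          (mul_le_mul d1.le (hM s hs) (norm_nonneg _) hη.le)
  · intro t ht z
    obtain ⟨K, hK⟩ := isCompact_Icc.exists_bound_of_continuousOn (hAz z)
    have hK0 : 0 ≤ K := (norm_nonneg _).trans (hK t₀ ht₀)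
    obtain ⟨C, hC0, hC⟩ := exists_gronwall_const (E := E) (K + 1) (by linarith) hab
    rw [hasFDerivAt_iff_isLittleO, Asymptotics.isLittleO_iff]
    intro ε hε
    -- Grönwall is applied to the remainder `Φ s y - Φ s z - W z s (y - z)`. The first `η` is its
    -- size at time `t₀`. The second term is the linearisation error `η ‖Φ s y - Φ s z‖`, with the
    -- difference bounded by `C (‖g' z‖ + 1) ‖y - z‖`.
    obtain ⟨η, hη, hη1, hηε⟩ : ∃ η > 0, η ≤ 1 ∧ C * (η + η * (C * (‖g' z‖ + 1))) ≤ ε := by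
      refine ⟨min 1 (ε / (C * (1 + C * (‖g' z‖ + 1)) + 1)), by positivity, min_le_left _ _, ?_⟩
      have h1 : min 1 (ε / (C * (1 + C * (‖g' z‖ + 1)) + 1)) *
          (C * (1 + C * (‖g' z‖ + 1)) + 1) ≤ ε := by
        rw [← le_div_iff₀ (by positivity)]; exact min_le_right _ _
      have h2 : 0 < min 1 (ε / (C * (1 + C * (‖g' z‖ + 1)) + 1)) := by positivity
      nlinarith
    have hloc : ContinuousOn (fun q : ℝ × E => f' q.1 (Φ q.1 z + q.2)) (Icc a b ×ˢ univ) := by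
      refine hf'.comp (continuousOn_fst.prodMk (ContinuousOn.add ?_ continuousOn_snd))
        (fun q hq => ⟨hq.1, trivial⟩)
      exact hΦ.comp (f := fun q : ℝ × E => (q.1, z))
        (continuous_fst.prodMk continuous_const).continuousOn (fun q hq => ⟨hq.1, trivial⟩)
    have n1 := eventually_forall_Icc_dist_lt (h := fun t u => f' t (Φ t z + u)) hloc 0 hη
    obtain ⟨ρ, hρ, hρf⟩ := Metric.eventually_nhds_iff_ball.1 n1
    have n2 := eventually_forall_Icc_dist_lt hΦ z hρ
    have n3 := (hasFDerivAt_iff_isLittleO.1 (hg z)).def hη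
    filter_upwards [n2, n3] with y h2 h3
    have herr : ∀ s ∈ Icc a b, ‖f s (Φ s y) - f s (Φ s z) - f' s (Φ s z) (Φ s y - Φ s z)‖
        ≤ η * ‖Φ s y - Φ s z‖ := by
      intro s hs
      refine Convex.norm_image_sub_le_of_norm_hasFDerivWithin_le' (f := f s) (f' := f' s)
        (s := Metric.ball (Φ s z) ρ) (fun x hx => (hf s hs x).hasFDerivWithinAt)
        (fun x hx => ?_) (convex_ball _ _) (Metric.mem_ball_self hρ) (h2 s hs)
      have := hρf (x - Φ s z) (by simpa [dist_eq_norm] using hx) s hs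
      rw [add_sub_cancel, add_zero, dist_eq_norm] at this
      exact this.le
    have hΔ := hC (fun s => Φ s y - Φ s z) (fun s => f s (Φ s y) - f s (Φ s z))
      ‖Φ t₀ y - Φ t₀ z‖ 0 t₀ ht₀ le_rfl (fun s hs => (hode s hs y).sub (hode s hs z)) le_rfl
      (fun s hs => by
        have e := norm_le_norm_add_norm_sub' (f s (Φ s y) - f s (Φ s z))
          (f' s (Φ s z) (Φ s y - Φ s z))
        have e2 := (f' s (Φ s z)).le_of_opNorm_le (hK s hs) (Φ s y - Φ s z)
        have e3 := herr s hs
        have e4 := mul_le_mul_of_nonneg_right hη1 (norm_nonneg (Φ s y - Φ s z))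
        linarith)
    have h0 : ‖Φ t₀ y - Φ t₀ z‖ ≤ (‖g' z‖ + 1) * ‖y - z‖ := by
      have e := norm_le_norm_add_norm_sub' (Φ t₀ y - Φ t₀ z) (g' z (y - z))
      have e2 := (g' z).le_opNorm (y - z)
      have e4 := mul_le_mul_of_nonneg_right hη1 (norm_nonneg (y - z))
      linarith
    have hr := hC (fun s => Φ s y - Φ s z - W z s (y - z))
      (fun s => f s (Φ s y) - f s (Φ s z) - (f' s (Φ s z)).comp (W z s) (y - z))
      (η * ‖y - z‖) (η * (C * (‖g' z‖ + 1)) * ‖y - z‖) t₀ ht₀ (by positivity)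
      (fun s hs => ((hode s hs y).sub (hode s hs z)).sub
        ((hWode z s hs).clm_apply (hasDerivWithinAt_const _ _ _) |>.congr_deriv (by simp)))
      (by rw [hW0]; exact h3)
      (fun s hs => ?_) t ht
    · refine hr.trans ?_
      have := mul_le_mul_of_nonneg_right hηε (norm_nonneg (y - z))
      linarith
    · have e1 : f s (Φ s y) - f s (Φ s z) - (f' s (Φ s z)).comp (W z s) (y - z)
          = f' s (Φ s z) (Φ s y - Φ s z - W z s (y - z))
            + (f s (Φ s y) - f s (Φ s z) - f' s (Φ s z) (Φ s y - Φ s z)) := by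
        simp only [ContinuousLinearMap.comp_apply, map_sub]; abel
      rw [e1]
      refine (norm_add_le _ _).trans (add_le_add ?_ ?_)
      · exact (f' s (Φ s z)).le_of_opNorm_le ((hK s hs).trans (by linarith)) _
      · refine (herr s hs).trans ?_
        rw [mul_assoc]
        refine mul_le_mul_of_nonneg_left ?_ hη.le
        have := hΔ s hs
        rw [add_zero] at this
        exact this.trans (by
          rw [mul_assoc]; exact mul_le_mul_of_nonneg_left h0 hC0)

theorem uniqueDiffOn_Icc_prod_univ {a b : ℝ} (hab : a < b) :
    UniqueDiffOn ℝ (Icc a b ×ˢ (univ : Set E)) :=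
  (uniqueDiffOn_Icc hab).prod uniqueDiffOn_univ

/-- Restriction of a derivative within `[a, b] × E` to the second factor. -/
theorem hasFDerivAt_slice {F : Type*} [NormedAddCommGroup F] [NormedSpace ℝ F] {f : ℝ × E → F}
    {s : Set ℝ} {t : ℝ} (ht : t ∈ s) {x : E}
    {D : ℝ × E →L[ℝ] F} (h : HasFDerivWithinAt f D (s ×ˢ univ) (t, x)) :
    HasFDerivAt (fun y => f (t, y)) (D.comp (ContinuousLinearMap.inr ℝ ℝ E)) x := by
  rw [← hasFDerivWithinAt_univ]
  exact h.comp x ((hasFDerivAt_prodMk_right t x).hasFDerivWithinAt) (fun y _ => ⟨ht, trivial⟩)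

end SmoothDependence

/-! ### Smooth flows of compactly supported time-dependent fields -/

section Flow

universe u

/-- Bootstrapping: the pair `(Φ, W)` of the solution and its derivative in `z` again solves an ODE
with smooth right-hand side, now in `E × (P →L[ℝ] E)`. By induction both are `C^k`, and the total
derivative of `Φ` is built from `f (t, Φ)` and `W`. This is why the induction quantifies over `E`
and keeps it in the universe of `P`. -/
theorem contDiffOn_nat_of_ode {P : Type u} [NormedAddCommGroup P] [NormedSpace ℝ P]
    [FiniteDimensional ℝ P] {a b t₀ : ℝ} (hab : a < b) (ht₀ : t₀ ∈ Icc a b) (k : ℕ) :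
    ∀ {E : Type u} [NormedAddCommGroup E] [NormedSpace ℝ E] [FiniteDimensional ℝ E]
      {f : ℝ × E → E}, ContDiffOn ℝ ∞ f (Icc a b ×ˢ univ) →
      ∀ {Φ : ℝ → P → E}, ContinuousOn (fun q : ℝ × P => Φ q.1 q.2) (Icc a b ×ˢ univ) →
      (∀ t ∈ Icc a b, ∀ z, HasDerivWithinAt (fun s => Φ s z) (f (t, Φ t z)) (Icc a b) t) →
      ContDiff ℝ ∞ (Φ t₀) →
      ContDiffOn ℝ k (fun q : ℝ × P => Φ q.1 q.2) (Icc a b ×ˢ univ) := by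
  induction k with
  | zero =>
    intro E _ _ _ f hf Φ hΦ hode h0
    simpa using (contDiffOn_zero (𝕜 := ℝ)).2 hΦ
  | succ k ih =>
    intro E _ _ _ f hf Φ hΦ hode h0
    have hS := uniqueDiffOn_Icc_prod_univ (E := E) hab
    have hD : ContDiffOn ℝ ∞ (fderivWithin ℝ f (Icc a b ×ˢ univ)) (Icc a b ×ˢ univ) :=
      hf.fderivWithin hS (by simp)
    have hf'c : ContDiffOn ℝ ∞ (fun q : ℝ × E => (fderivWithin ℝ f (Icc a b ×ˢ univ) q).comp
        (ContinuousLinearMap.inr ℝ ℝ E)) (Icc a b ×ˢ univ) := hD.clm_comp contDiffOn_const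
    obtain ⟨W, hWc, hWd, hW0, hWode⟩ := exists_variational_solution ht₀
      (f := fun t x => f (t, x))
      (f' := fun t x => (fderivWithin ℝ f (Icc a b ×ˢ univ) (t, x)).comp
        (ContinuousLinearMap.inr ℝ ℝ E))
      (fun t ht x => hasFDerivAt_slice ht
        ((hf.differentiableOn (by simp)) (t, x) ⟨ht, trivial⟩).hasFDerivWithinAt)
      hf'c.continuousOn hΦ hode (g' := fderiv ℝ (Φ t₀))
      (fun z => (h0.differentiable (by simp) z).hasFDerivAt) (h0.continuous_fderiv (by simp))
    have hmaps : ContDiffOn ℝ ∞ (fun q : ℝ × (E × (P →L[ℝ] E)) => (q.1, q.2.1))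
        (Icc a b ×ˢ univ) := (contDiff_fst.prodMk (contDiff_fst.comp contDiff_snd)).contDiffOn
    have step := ih (E := E × (P →L[ℝ] E))
      (f := fun q => (f (q.1, q.2.1), ((fderivWithin ℝ f (Icc a b ×ˢ univ) (q.1, q.2.1)).comp
        (ContinuousLinearMap.inr ℝ ℝ E)).comp q.2.2))
      ((hf.comp hmaps (fun q hq => ⟨hq.1, trivial⟩)).prodMk
        ((hf'c.comp hmaps (fun q hq => ⟨hq.1, trivial⟩)).clm_comp
          (contDiff_snd.comp contDiff_snd).contDiffOn))
      (Φ := fun t z => (Φ t z, W t z)) (hΦ.prodMk hWc)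
      (fun t ht z => (hode t ht z).prodMk (hWode t ht z))
      (by
        have : W t₀ = fderiv ℝ (Φ t₀) := funext hW0
        exact h0.prodMk (this ▸ h0.fderiv_right (by simp)))
    have hΦk : ContDiffOn ℝ k (fun q : ℝ × P => Φ q.1 q.2) (Icc a b ×ˢ univ) := step.fst
    have hWk : ContDiffOn ℝ k (fun q : ℝ × P => W q.1 q.2) (Icc a b ×ˢ univ) := step.snd
    have hder : ∀ q ∈ Icc a b ×ˢ (univ : Set P), HasFDerivWithinAt (fun q : ℝ × P => Φ q.1 q.2)
        ((ContinuousLinearMap.fst ℝ ℝ P).smulRight (f (q.1, Φ q.1 q.2))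
        + (W q.1 q.2).comp (ContinuousLinearMap.snd ℝ ℝ P)) (Icc a b ×ˢ univ) q :=
      fun q hq => hasFDerivWithinAt_of_partial hq.1 (hode q.1 hq.1 q.2) hWd hWc
    have hS' := uniqueDiffOn_Icc_prod_univ (E := P) hab
    push_cast
    rw [contDiffOn_succ_iff_fderivWithin hS']
    refine ⟨fun q hq => (hder q hq).differentiableWithinAt, by simp, ?_⟩
    refine ContDiffOn.congr ?_ (fun q hq => (hder q hq).fderivWithin (hS' q hq))
    refine ContDiffOn.add (contDiffOn_const.smulRight ?_) (hWk.clm_comp contDiffOn_const)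
    exact (hf.of_le (mod_cast le_top)).comp (contDiff_fst.contDiffOn.prodMk hΦk)
      (fun q hq => ⟨hq.1, trivial⟩)

/-- A time-dependent vector field of compact support on `[a, b] × E` is Lipschitz, and has a smooth
flow starting at any time. -/
theorem exists_flow {E : Type u} [NormedAddCommGroup E] [NormedSpace ℝ E] [FiniteDimensional ℝ E]
    {a b : ℝ} (hab : a < b) {f : ℝ × E → E} (hf : ContDiffOn ℝ ∞ f (Icc a b ×ˢ univ))
    {k : Set E} (hk : IsCompact k) (hfk : ∀ t ∈ Icc a b, ∀ x ∉ k, f (t, x) = 0) :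
    ∃ K : ℝ≥0, (∀ t ∈ Icc a b, LipschitzWith K (fun x => f (t, x))) ∧
      ∀ s ∈ Icc a b, ∃ Φ : ℝ → E → E, (∀ z, Φ s z = z) ∧
        (∀ t ∈ Icc a b, ∀ z, HasDerivWithinAt (fun r => Φ r z) (f (t, Φ t z)) (Icc a b) t) ∧
        ContDiffOn ℝ ∞ (fun q : ℝ × E => Φ q.1 q.2) (Icc a b ×ˢ univ) := by
  have hS := uniqueDiffOn_Icc_prod_univ (E := E) hab
  have : CompleteSpace E := FiniteDimensional.complete ℝ E
  have hsl : ∀ t ∈ Icc a b, ∀ x, HasFDerivAt (fun y => f (t, y))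
      ((fderivWithin ℝ f (Icc a b ×ˢ univ) (t, x)).comp (ContinuousLinearMap.inr ℝ ℝ E)) x :=
    fun t ht x => hasFDerivAt_slice ht
      ((hf.differentiableOn (by simp)) (t, x) ⟨ht, trivial⟩).hasFDerivWithinAt
  have hDc : ContinuousOn (fun q : ℝ × E => (fderivWithin ℝ f (Icc a b ×ˢ univ) q).comp
        (ContinuousLinearMap.inr ℝ ℝ E)) (Icc a b ×ˢ univ) :=
    ((hf.fderivWithin (m := ∞) hS (by simp)).clm_comp contDiffOn_const).continuousOn
  obtain ⟨K, hK⟩ := (isCompact_Icc.prod hk).exists_bound_of_continuousOn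
    (hDc.mono (prod_mono_right (subset_univ k)))
  obtain ⟨L, hL⟩ := (isCompact_Icc.prod hk).exists_bound_of_continuousOn
    (hf.continuousOn.mono (prod_mono_right (subset_univ k)))
  have hlip : ∀ t ∈ Icc a b, LipschitzWith K.toNNReal (fun x => f (t, x)) := by
    intro t ht
    refine lipschitzWith_of_nnnorm_fderiv_le (𝕜 := ℝ) (fun x => (hsl t ht x).differentiableAt)
      fun x => ?_
    by_cases hx : x ∈ k
    · rw [← NNReal.coe_le_coe, coe_nnnorm, (hsl t ht x).fderiv]
      exact (hK (t, x) ⟨ht, hx⟩).trans (Real.le_coe_toNNReal K)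
    · have : (fun y => f (t, y)) =ᶠ[𝓝 x] fun _ => 0 :=
        mem_of_superset (hk.isClosed.isOpen_compl.mem_nhds hx) fun y hy => hfk t ht y hy
      rw [this.fderiv_eq]
      simp
  have hbd : ∀ t ∈ Icc a b, ∀ x, ‖f (t, x)‖ ≤ L.toNNReal := by
    intro t ht x
    by_cases hx : x ∈ k
    · exact (hL (t, x) ⟨ht, hx⟩).trans (Real.le_coe_toNNReal L)
    · rw [hfk t ht x hx, norm_zero]; exact NNReal.coe_nonneg _
  refine ⟨K.toNNReal, hlip, fun s hs => ?_⟩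
  have hex := fun z => ode_exists (v := fun t x => f (t, x)) hlip
    (fun x => hf.continuousOn.comp (f := fun t => (t, x))
      (continuous_id.prodMk continuous_const).continuousOn (fun t ht => ⟨ht, trivial⟩))
    hbd hs z
  choose Φ h0 hode using hex
  obtain ⟨C, hC0, hC⟩ := exists_gronwall_const (E := E) K.toNNReal K.toNNReal.2 hab.le
  have hcont : ContinuousOn (fun q : ℝ × E => Φ q.2 q.1) (Icc a b ×ˢ univ) := by
    -- Joint continuity follows from continuity in time and a Lipschitz constant in the initial
    -- value that is uniform in time.
    refine continuousOn_prod_of_continuousOn_lipschitzOnWith' (fun q : ℝ × E => Φ q.2 q.1)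
      ⟨C, hC0⟩ ?_ ?_
    · intro t ht
      refine LipschitzOnWith.of_dist_le_mul fun x _ y _ => ?_
      have := hC (fun t => Φ x t - Φ y t) (fun t => f (t, Φ x t) - f (t, Φ y t)) (dist x y) 0 s hs
        le_rfl (fun t ht => (hode x t ht).sub (hode y t ht)) (by rw [h0, h0, dist_eq_norm])
        (fun t ht => by simpa using (hlip t ht).norm_sub_le _ _) t ht
      rw [add_zero] at this
      rw [dist_eq_norm]
      exact this
    · exact fun x _ t ht => (hode x t ht).continuousWithinAt
  refine ⟨fun t z => Φ z t, h0, fun t ht z => hode z t ht, ?_⟩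
  rw [contDiffOn_infty]
  intro k
  refine contDiffOn_nat_of_ode hab hs k hf hcont (fun t ht z => hode z t ht) ?_
  have : (fun z => Φ z s) = id := funext h0
  rw [this]
  exact contDiff_id

end Flow

section Wedge

/-! ### Nondegeneracy of `dα` on `ker α` -/

variable {V : Type*} [AddCommGroup V] [Module ℝ V]

/-- The multilinear map `a ⊗ b ⊗ ⋯ ⊗ b`. -/
def tensorTerm (n : ℕ) (a : V →ₗ[ℝ] ℝ) (b : V →ₗ[ℝ] V →ₗ[ℝ] ℝ) (v : Fin (2 * n + 1) → V) : ℝ :=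
  a (v 0) * ∏ i : Fin n, b (v ⟨2 * i + 1, by omega⟩) (v ⟨2 * i + 2, by omega⟩)

theorem fin_cases_pair {n : ℕ} (j : Fin (2 * n + 1)) :
    j = 0 ∨ (∃ i : Fin n, j = ⟨2 * i + 1, by omega⟩) ∨ ∃ i : Fin n, j = ⟨2 * i + 2, by omega⟩ := by
  obtain ⟨j, hj⟩ := j
  rcases Nat.even_or_odd' j with ⟨k, rfl | rfl⟩
  · rcases k with _ | k
    · left; rfl
    · right; right; exact ⟨⟨k, by omega⟩, by ext; simp; ring⟩
  · right; left; exact ⟨⟨k, by omega⟩, rfl⟩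

theorem tensorTerm_eq_mul_erase (n : ℕ) (a : V →ₗ[ℝ] ℝ) (b : V →ₗ[ℝ] V →ₗ[ℝ] ℝ)
    (v : Fin (2 * n + 1) → V) (i : Fin n) :
    tensorTerm n a b v = a (v 0) * (b (v ⟨2 * i + 1, by omega⟩) (v ⟨2 * i + 2, by omega⟩) *
      ∏ j ∈ Finset.univ.erase i, b (v ⟨2 * j + 1, by omega⟩) (v ⟨2 * j + 2, by omega⟩)) := by
  rw [tensorTerm, Finset.mul_prod_erase Finset.univ
    (fun j : Fin n => b (v ⟨2 * j + 1, by omega⟩) (v ⟨2 * j + 2, by omega⟩)) (Finset.mem_univ i)]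

/-- Each slot occurs in exactly one factor. Additivity and homogeneity of `tensorMultilinear` both
follow from this. -/
theorem exists_linear_tensorTerm_update (n : ℕ) (a : V →ₗ[ℝ] ℝ) (b : V →ₗ[ℝ] V →ₗ[ℝ] ℝ)
    (v : Fin (2 * n + 1) → V) (j : Fin (2 * n + 1)) :
    ∃ l : V →ₗ[ℝ] ℝ, ∀ y, tensorTerm n a b (Function.update v j y) = l y := by
  rcases fin_cases_pair j with rfl | ⟨i, rfl⟩ | ⟨i, rfl⟩
  · refine ⟨(∏ i : Fin n, b (v ⟨2 * i + 1, by omega⟩) (v ⟨2 * i + 2, by omega⟩)) • a, fun y => ?_⟩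
    simp only [tensorTerm, Function.update_self, LinearMap.smul_apply, smul_eq_mul]
    rw [mul_comm]
    congr 1
  · refine ⟨(a (v 0) * ∏ j ∈ Finset.univ.erase i,
      b (v ⟨2 * j + 1, by omega⟩) (v ⟨2 * j + 2, by omega⟩)) • b.flip (v ⟨2 * i + 2, by omega⟩),
      fun y => ?_⟩
    rw [tensorTerm_eq_mul_erase n a b _ i, Function.update_self,
      Function.update_of_ne (by simp [Fin.ext_iff]),
      Function.update_of_ne (by simp [Fin.ext_iff]), Finset.prod_congr rfl (fun k hk => by
        have : (k : ℕ) ≠ i := fun h => (Finset.mem_erase.1 hk).1 (Fin.ext h)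
        rw [Function.update_of_ne (by simp [Fin.ext_iff]; omega),
          Function.update_of_ne (by simp [Fin.ext_iff]; omega)])]
    simp only [LinearMap.smul_apply, LinearMap.flip_apply, smul_eq_mul]
    ring
  · refine ⟨(a (v 0) * ∏ j ∈ Finset.univ.erase i,
      b (v ⟨2 * j + 1, by omega⟩) (v ⟨2 * j + 2, by omega⟩)) • b (v ⟨2 * i + 1, by omega⟩),
      fun y => ?_⟩
    rw [tensorTerm_eq_mul_erase n a b _ i, Function.update_self,
      Function.update_of_ne (by simp [Fin.ext_iff]),
      Function.update_of_ne (by simp [Fin.ext_iff]), Finset.prod_congr rfl (fun k hk => by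
        have : (k : ℕ) ≠ i := fun h => (Finset.mem_erase.1 hk).1 (Fin.ext h)
        rw [Function.update_of_ne (by simp [Fin.ext_iff]; omega),
          Function.update_of_ne (by simp [Fin.ext_iff]; omega)])]
    simp only [LinearMap.smul_apply, smul_eq_mul]
    ring

/-- `tensorTerm` as a multilinear map. -/
def tensorMultilinear (n : ℕ) (a : V →ₗ[ℝ] ℝ) (b : V →ₗ[ℝ] V →ₗ[ℝ] ℝ) :
    MultilinearMap ℝ (fun _ : Fin (2 * n + 1) => V) ℝ :=
  MultilinearMap.mk' (tensorTerm n a b)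
    (fun v j x y => by
      obtain ⟨l, hl⟩ := exists_linear_tensorTerm_update n a b v j
      rw [hl, hl, hl, map_add])
    (fun v j c x => by
      obtain ⟨l, hl⟩ := exists_linear_tensorTerm_update n a b v j
      rw [hl, hl, map_smul])

theorem wedgePow_eq_alternatization (n : ℕ) (a : V →ₗ[ℝ] ℝ) (b : V →ₗ[ℝ] V →ₗ[ℝ] ℝ)
    (v : Fin (2 * n + 1) → V) :
    wedgePow n a (fun x y => b x y) v =
      (1 / 2 ^ n) * (MultilinearMap.alternatization (tensorMultilinear n a b)) v := by
  rw [wedgePow, MultilinearMap.alternatization_apply]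
  congr 1
  refine Finset.sum_congr rfl fun σ _ => ?_
  rw [Units.smul_def, zsmul_eq_mul]
  rfl

/-- If `x` lies in the kernel of `a` and `b(x, ·)` is a multiple of `a`, then a term of `a ∧ bⁿ` in
which `x` occurs does not change under a suitable transposition. -/
theorem exists_swap_tensorTerm (n : ℕ) (a : V →ₗ[ℝ] ℝ) (b : V →ₗ[ℝ] V →ₗ[ℝ] ℝ)
    (hb : ∀ v w, b v w = - b w v) {x : V} {c : ℝ} (hx : ∀ w, b x w = c * a w)
    (k : Fin (2 * n + 1)) (hk : k ≠ 0) : ∃ k' : Fin (2 * n + 1), k' ≠ 0 ∧ k' ≠ k ∧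
      ∀ w : Fin (2 * n + 1) → V, w k = x →
        tensorTerm n a b (fun j => w (Equiv.swap 0 k' j)) = tensorTerm n a b w := by
  have aux : ∀ (i : Fin n) (k' : Fin (2 * n + 1)),
      (k' = ⟨2 * i + 1, by omega⟩ ∨ k' = ⟨2 * i + 2, by omega⟩) →
      ∀ w : Fin (2 * n + 1) → V,
      ∏ j ∈ Finset.univ.erase i, b (w (Equiv.swap 0 k' ⟨2 * j + 1, by omega⟩))
        (w (Equiv.swap 0 k' ⟨2 * j + 2, by omega⟩)) =
      ∏ j ∈ Finset.univ.erase i, b (w ⟨2 * j + 1, by omega⟩) (w ⟨2 * j + 2, by omega⟩) := by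
    intro i k' hk' w
    refine Finset.prod_congr rfl fun j hj => ?_
    have : (j : ℕ) ≠ i := fun h => (Finset.mem_erase.1 hj).1 (Fin.ext h)
    have h1 : (⟨2 * j + 1, by omega⟩ : Fin (2 * n + 1)) ≠ k' := by
      rcases hk' with rfl | rfl <;> simp [Fin.ext_iff] <;> omega
    have h2 : (⟨2 * j + 2, by omega⟩ : Fin (2 * n + 1)) ≠ k' := by
      rcases hk' with rfl | rfl <;> simp [Fin.ext_iff] <;> omega
    rw [Equiv.swap_apply_of_ne_of_ne (by simp [Fin.ext_iff]) h1,
      Equiv.swap_apply_of_ne_of_ne (by simp [Fin.ext_iff]) h2]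
  rcases fin_cases_pair k with rfl | ⟨i, rfl⟩ | ⟨i, rfl⟩
  · exact absurd rfl hk
  -- The slot `k'` is the partner of `k` in its factor of `b`. That factor equals `± c * a (w k')`,
  -- so the whole term contains `a (w 0) * a (w k')` and is symmetric in the slots `0` and `k'`.
  · refine ⟨⟨2 * i + 2, by omega⟩, by simp [Fin.ext_iff], by simp [Fin.ext_iff], fun w hw => ?_⟩
    rw [tensorTerm_eq_mul_erase n a b _ i, tensorTerm_eq_mul_erase n a b _ i,
      aux i _ (Or.inr rfl) w, Equiv.swap_apply_left, Equiv.swap_apply_right,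
      Equiv.swap_apply_of_ne_of_ne (by simp [Fin.ext_iff]) (by simp [Fin.ext_iff]), hw, hx, hx]
    ring
  · refine ⟨⟨2 * i + 1, by omega⟩, by simp [Fin.ext_iff], by simp [Fin.ext_iff], fun w hw => ?_⟩
    rw [tensorTerm_eq_mul_erase n a b _ i, tensorTerm_eq_mul_erase n a b _ i,
      aux i _ (Or.inl rfl) w, Equiv.swap_apply_left, Equiv.swap_apply_right,
      Equiv.swap_apply_of_ne_of_ne (by simp [Fin.ext_iff]) (by simp [Fin.ext_iff]), hw,
      hb _ x, hb _ x, hx, hx]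
    ring

/-- The terms of the signed sum cancel in pairs. If `σ` puts `x` into slot `0`, its term has the
factor `a x = 0`. Otherwise composing with the transposition of `exists_swap_tensorTerm` keeps the
term and reverses the sign. The transposition depends only on the slot of `x`, which it does not
move, so the pairing is an involution. -/
theorem alternatization_eq_zero_of_mem (n : ℕ) (a : V →ₗ[ℝ] ℝ) (b : V →ₗ[ℝ] V →ₗ[ℝ] ℝ)
    (hb : ∀ v w, b v w = - b w v) {x : V} {c : ℝ} (hax : a x = 0) (hx : ∀ w, b x w = c * a w)
    (v : Fin (2 * n + 1) → V) (i₀ : Fin (2 * n + 1)) (hv : v i₀ = x) :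
    (MultilinearMap.alternatization (tensorMultilinear n a b)) v = 0 := by
  rw [MultilinearMap.alternatization_apply]
  have hterm : ∀ σ : Equiv.Perm (Fin (2 * n + 1)),
      ((tensorMultilinear n a b).domDomCongr σ) v = tensorTerm n a b (fun j => v (σ j)) :=
    fun _ => rfl
  simp only [hterm]
  have hsw := exists_swap_tensorTerm n a b hb hx
  choose! k' h0 hne hsw using hsw
  have hpos : ∀ σ : Equiv.Perm (Fin (2 * n + 1)), σ.symm i₀ ≠ 0 →
      (σ * Equiv.swap 0 (k' (σ.symm i₀))).symm i₀ = σ.symm i₀ := by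
    intro σ h
    rw [Equiv.symm_apply_eq, Equiv.Perm.mul_apply,
      Equiv.swap_apply_of_ne_of_ne h (hne _ h).symm, Equiv.apply_symm_apply]
  refine Finset.sum_involution
    (fun σ _ => if σ.symm i₀ = 0 then σ else σ * Equiv.swap 0 (k' (σ.symm i₀))) ?_ ?_ ?_ ?_
  · intro σ _
    have hvσ : v (σ (σ.symm i₀)) = x := by rw [Equiv.apply_symm_apply, hv]
    split_ifs with h
    · rw [h] at hvσ
      simp [tensorTerm, hvσ, hax]
    · have := hsw _ h (fun j => v (σ j)) hvσ
      simp only [Equiv.Perm.mul_apply, this, Equiv.Perm.sign_mul,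
        Equiv.Perm.sign_swap (h0 _ h).symm]
      simp
  · intro σ _ hne'
    have hvσ : v (σ (σ.symm i₀)) = x := by rw [Equiv.apply_symm_apply, hv]
    split_ifs with h
    · rw [h] at hvσ
      simp [tensorTerm, hvσ, hax] at hne'
    · intro h2
      have := congrArg (fun τ : Equiv.Perm (Fin (2 * n + 1)) => τ 0) h2
      simp only [Equiv.Perm.mul_apply, Equiv.swap_apply_left] at this
      exact h0 _ h (σ.injective this)
  · exact fun _ _ => Finset.mem_univ _
  · intro σ _
    by_cases h : σ.symm i₀ = 0
    · simp [h]
    · simp only [h, if_false]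
      rw [hpos σ h, if_neg h, mul_assoc, Equiv.swap_mul_self, mul_one]

/-- If `a ∧ bⁿ ≠ 0` on a space of dimension `2n+1`, then no nonzero vector `x` in the kernel of `a`
has `b(x, ·)` proportional to `a`. -/
theorem eq_zero_of_wedgePow_ne_zero [FiniteDimensional ℝ V] (n : ℕ)
    (hV : Module.finrank ℝ V = 2 * n + 1) (a : V →ₗ[ℝ] ℝ) (b : V →ₗ[ℝ] V →ₗ[ℝ] ℝ)
    (hb : ∀ v w, b v w = - b w v) {v : Fin (2 * n + 1) → V}
    (hne : wedgePow n a (fun x y => b x y) v ≠ 0) {x : V} {c : ℝ} (hax : a x = 0)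
    (hx : ∀ w, b x w = c * a w) : x = 0 := by
  by_contra hx0
  apply hne
  rw [wedgePow_eq_alternatization]
  have hli : LinearIndepOn ℝ id ({x} : Set V) := by
    simpa using LinearIndepOn.singleton (R := ℝ) (v := id) (i := x) hx0
  let B := Module.Basis.extend hli
  have hxB : x ∈ hli.extend (subset_univ _) := hli.subset_extend _ rfl
  have : Finite (hli.extend (subset_univ _)) := Module.Finite.finite_basis B
  have : Fintype (hli.extend (subset_univ _)) := Fintype.ofFinite _
  have hcard : Fintype.card (hli.extend (subset_univ _)) = Fintype.card (Fin (2 * n + 1)) := by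
    rw [← Module.finrank_eq_card_basis B, hV, Fintype.card_fin]
  let eqv := Fintype.equivOfCardEq hcard
  let B' := B.reindex eqv
  have hz : (MultilinearMap.alternatization (tensorMultilinear n a b)) B' = 0 := by
    refine alternatization_eq_zero_of_mem n a b hb hax hx _ (eqv ⟨x, hxB⟩) ?_
    simp [B', B]
  -- An alternating form of top degree is determined by its value on one basis, here a basis
  -- containing `x`.
  rw [AlternatingMap.eq_smul_basis_det B' (MultilinearMap.alternatization _), hz]
  simp

end Wedge

section GrayEquation

/-! ### The infinitesimal Gray equation -/

variable {E Q Q' : Type*} [NormedAddCommGroup E] [NormedSpace ℝ E]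
  [NormedAddCommGroup Q] [NormedSpace ℝ Q] [NormedAddCommGroup Q'] [NormedSpace ℝ Q']

/-- The relation `α(x) = 0`, `D(X)(w) - D(j w)(x) = μ α(w)` for all `w`. If `D` is the derivative of
a family of 1-forms at a point of `ℝ × E` with value `α`, if `j` is the inclusion of `E` and
`X = (1, x)`, this is the equation `(∂ₜα + i_x dα)|_{ker α} = 0` for a vector `x ∈ ker α`. -/
def GrayRel (D : Q →L[ℝ] E →L[ℝ] ℝ) (α : E →L[ℝ] ℝ) (j : E →L[ℝ] Q) (X : Q) (x : E) : Prop :=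
  α x = 0 ∧ ∃ μ : ℝ, ∀ w, D X w - D (j w) x = μ * α w

/-- Two nonzero linear forms with the same kernel are proportional. -/
theorem eq_smul_of_ker {a a' : E →L[ℝ] ℝ} (h : ∀ v, a v = 0 → a' v = 0) {u : E} (hu : a u ≠ 0) :
    a' = (a' u / a u) • a := by
  ext w
  have := h (w - (a w / a u) • u) (by simp [hu])
  rw [map_sub, map_smul, smul_eq_mul, sub_eq_zero] at this
  rw [this, smul_apply, smul_eq_mul]
  ring

/-- The Gray equation is natural under pull-back and rescaling of the forms. -/
theorem GrayRel.transfer {A : Q → E →L[ℝ] ℝ} {A' : Q' → E →L[ℝ] ℝ} {S : Set Q} {S' : Set Q'}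
    {q' : Q'} {G : Q' → Q} {H : Q' → E →L[ℝ] E} {L : Q' →L[ℝ] Q} {K : Q' →L[ℝ] E →L[ℝ] E}
    {D : Q →L[ℝ] E →L[ℝ] ℝ} {D' : Q' →L[ℝ] E →L[ℝ] ℝ} {j : E →L[ℝ] Q} {j' : E →L[ℝ] Q'}
    {X : Q} {X' : Q'} {x x' : E}
    (h : GrayRel D (A (G q')) j X x) (hq : q' ∈ S') (huniq : UniqueDiffWithinAt ℝ S' q')
    (hA' : HasFDerivWithinAt A' D' S' q') (hA : HasFDerivWithinAt A D S (G q'))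
    (hG : HasFDerivWithinAt G L S' q') (hmaps : MapsTo G S' S) (hH : HasFDerivWithinAt H K S' q')
    (hker : ∀ᶠ q in 𝓝[S'] q', ∀ v, A' q v = 0 ↔ A (G q) (H q v) = 0)
    (hne : ∃ u, A (G q') (H q' u) ≠ 0) (hLj : ∀ w, L (j' w) = j (H q' w)) (hX : L X' = X)
    (hx : H q' x' = x) (hK : ∀ w, K X' w = K (j' w) x') : GrayRel D' (A' q') j' X' x' := by
  obtain ⟨u, hu⟩ := hne
  have hB : HasFDerivWithinAt (fun q => (A (G q)).comp (H q)) _ S' q' :=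
    (hA.comp q' hG hmaps).clm_comp hH
  set D'' := (ContinuousLinearMap.compL ℝ E E ℝ) (A (G q')) ∘SL K +
    (ContinuousLinearMap.compL ℝ E E ℝ).flip (H q') ∘SL (D ∘SL L) with hD''
  set f : Q' → ℝ := fun q => A' q u / A (G q) (H q u) with hf
  have hfd : DifferentiableWithinAt ℝ f S' q' := by
    have h1 : DifferentiableWithinAt ℝ (fun q => A' q u) S' q' :=
      hA'.differentiableWithinAt.clm_apply (differentiableWithinAt_const u)
    have h2 : DifferentiableWithinAt ℝ (fun q => A (G q) (H q u)) S' q' :=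
      hB.differentiableWithinAt.clm_apply (differentiableWithinAt_const u)
    have h3 := DifferentiableWithinAt.inv h2 (by exact hu)
    exact h1.mul h3
  have hev : A' =ᶠ[𝓝[S'] q'] fun q => f q • (A (G q)).comp (H q) := by
    have hcont : ContinuousWithinAt (fun q => A (G q) (H q u)) S' q' :=
      (hB.differentiableWithinAt.clm_apply (differentiableWithinAt_const u)).continuousWithinAt
    filter_upwards [hker, hcont.eventually_ne hu] with q h1 h2
    exact eq_smul_of_ker (a := (A (G q)).comp (H q)) (fun v hv => (h1 v).2 hv) h2
  have heq := hev.self_of_nhdsWithin hq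
  have hfne : f q' ≠ 0 := by
    have h1 := hker.self_of_nhdsWithin hq
    exact div_ne_zero (fun h0 => hu ((h1 u).1 h0)) hu
  have hDD : D' = f q' • D'' + (fderivWithin ℝ f S' q').smulRight ((A (G q')).comp (H q')) :=
    huniq.eq (hA'.congr_of_eventuallyEq hev.symm heq.symm) (hfd.hasFDerivWithinAt.smul hB)
  obtain ⟨h0, μ, hμ⟩ := h
  have h0' : A (G q') (H q' x') = 0 := by rw [hx, h0]
  -- By the Leibniz rule for `A' = f • (A ∘ G) ∘ H`, differentiating `f` in direction `X'` adds a
  -- multiple of the form, while its derivative in direction `j' w` is multiplied by `A (G q') x =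
  -- 0`. The terms with `K` cancel by the symmetry `hK`. The new factor is `(df(X') + f μ) / f`.
  refine ⟨by rw [heq]; simp [h0'], (fderivWithin ℝ f S' q' X' + f q' * μ) / f q', fun w => ?_⟩
  have e1 : ∀ v w', D'' v w' = A (G q') (K v w') + D (L v) (H q' w') := fun v w' => by
    simp [hD'']
  have e2 : ∀ v w', D' v w' = f q' * (A (G q') (K v w') + D (L v) (H q' w'))
      + fderivWithin ℝ f S' q' v * A (G q') (H q' w') := fun v w' => by
    rw [hDD, ← e1]; simp
  rw [e2, e2, h0', heq, hX, hLj, hK w, hx]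
  have := hμ (H q' w)
  simp only [smul_apply, ContinuousLinearMap.comp_apply, smul_eq_mul]
  field_simp
  linear_combination (f q') * this

theorem contDiffOn_of_isLinearMap {V W : Type*} [NormedAddCommGroup V] [NormedSpace ℝ V]
    [FiniteDimensional ℝ V] [NormedAddCommGroup W] [NormedSpace ℝ W] [FiniteDimensional ℝ W]
    {l : V → W → E} (hl : IsLinearMap ℝ (fun p : V × W => l p.1 p.2)) {S : Set Q} {f : Q → V}
    {g : Q → W} (hf : ContDiffOn ℝ ∞ f S) (hg : ContDiffOn ℝ ∞ g S) :
    ContDiffOn ℝ ∞ (fun q => l (f q) (g q)) S :=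
  (LinearMap.toContinuousLinearMap (hl.mk' _)).contDiff.comp_contDiffOn (hf.prodMk hg)

/-- Solutions of invertible linear systems depend smoothly on the system. -/
theorem exists_contDiffOn_solution [CompleteSpace E] {S : Set Q'} {T : Q' → E →L[ℝ] Q} {r : Q' → Q}
    (hT : ContDiffOn ℝ ∞ T S) (hr : ContDiffOn ℝ ∞ r S)
    (hinv : ∀ q ∈ S, ∃ e : E ≃L[ℝ] Q, (e : E →L[ℝ] Q) = T q) :
    ∃ z : Q' → E, ContDiffOn ℝ ∞ z S ∧ ∀ q ∈ S, T q (z q) = r q := by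
  refine ⟨fun q => (T q).inverse (r q), ContDiffOn.clm_apply (fun q hq => ?_) hr, fun q hq => ?_⟩
  · obtain ⟨e, he⟩ := hinv q hq
    have := contDiffAt_map_inverse (n := ∞) e
    rw [he] at this
    exact this.comp_contDiffWithinAt q (hT q hq)
  · obtain ⟨e, he⟩ := hinv q hq
    simp only [← he, ContinuousLinearMap.inverse_equiv]
    simp

/-- The slab `[0,1] × E`. -/
def slab (E : Type*) : Set (ℝ × E) := Icc (0 : ℝ) 1 ×ˢ univ

theorem uniqueDiffOn_slab : UniqueDiffOn ℝ (slab E) := uniqueDiffOn_Icc_prod_univ one_pos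

theorem mem_slab {X : Type*} {q : ℝ × X} : q ∈ slab X ↔ q.1 ∈ Icc (0 : ℝ) 1 := by simp [slab]

/-- This is what symmetry of second derivatives within the slab requires at the boundary times `0`
and `1`. -/
theorem mem_closure_interior_slab {E : Type*} [TopologicalSpace E] {q : ℝ × E} (hq : q ∈ slab E) :
    q ∈ closure (interior (slab E)) := by
  rw [slab, interior_prod_eq, interior_Icc, interior_univ, closure_prod_eq, closure_Ioo (by simp),
    closure_univ]
  exact hq

/-- Pull-back of the time-dependent Gray equation. -/
theorem GrayRel.pullback_slab {A A' : ℝ × E → E →L[ℝ] ℝ} {g : E → E} {t : ℝ} {y' x' : E}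
    (h : GrayRel (fderivWithin ℝ A (slab E) (t, g y')) (A (t, g y'))
      (ContinuousLinearMap.inr ℝ ℝ E) (1, fderiv ℝ g y' x') (fderiv ℝ g y' x'))
    (ht : t ∈ Icc (0 : ℝ) 1) (hA' : DifferentiableWithinAt ℝ A' (slab E) (t, y'))
    (hA : DifferentiableWithinAt ℝ A (slab E) (t, g y')) (hg : ContDiffAt ℝ ∞ g y')
    (hker : ∀ᶠ q in 𝓝[slab E] (t, y'), ∀ v, A' q v = 0 ↔ A (q.1, g q.2) (fderiv ℝ g q.2 v) = 0)
    (hne : ∃ u, A (t, g y') (fderiv ℝ g y' u) ≠ 0) :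
    GrayRel (fderivWithin ℝ A' (slab E) (t, y')) (A' (t, y'))
      (ContinuousLinearMap.inr ℝ ℝ E) (1, x') x' := by
  have hg1 : HasFDerivAt g (fderiv ℝ g y') y' := (hg.differentiableAt (by simp)).hasFDerivAt
  have hg2 : HasFDerivAt (fderiv ℝ g) (fderiv ℝ (fderiv ℝ g) y') y' :=
    ((hg.fderiv_right (m := ∞) (by simp)).differentiableAt (by simp)).hasFDerivAt
  -- Symmetry of the second derivative of `g` is the reason that `d` commutes with pull-back.
  have hsymm := hg.isSymmSndFDerivAt (by simpa using ENat.LEInfty.out)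
  have hsnd : HasFDerivAt (fun q : ℝ × E => q.2) (ContinuousLinearMap.snd ℝ ℝ E) (t, y') :=
    hasFDerivAt_snd
  refine GrayRel.transfer (A := A) (G := fun q => (q.1, g q.2)) (H := fun q => fderiv ℝ g q.2)
    (L := (ContinuousLinearMap.fst ℝ ℝ E).prod ((fderiv ℝ g y').comp
      (ContinuousLinearMap.snd ℝ ℝ E))) (S := slab E)
    (K := (fderiv ℝ (fderiv ℝ g) y').comp (ContinuousLinearMap.snd ℝ ℝ E))
    h (mem_slab.2 ht) (uniqueDiffOn_slab _ (mem_slab.2 ht)) hA'.hasFDerivWithinAt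
    hA.hasFDerivWithinAt ?_ (fun q hq => mem_slab.2 (mem_slab.1 hq)) ?_ hker hne ?_ ?_ rfl ?_
  · exact (hasFDerivAt_fst.prodMk (hg1.comp (t, y') hsnd)).hasFDerivWithinAt
  · exact (hg2.comp (t, y') hsnd).hasFDerivWithinAt
  · intro w; simp
  · simp
  · intro w
    simpa using hsymm x' w

/-- Pull-back of the homogeneous Gray equation of a single 1-form. -/
theorem GrayRel.pullback {A A' : E → E →L[ℝ] ℝ} {g : E → E} {y' x' : E}
    (h : GrayRel (fderiv ℝ A (g y')) (A (g y')) (ContinuousLinearMap.id ℝ E)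
      (fderiv ℝ g y' x') (fderiv ℝ g y' x'))
    (hA' : DifferentiableAt ℝ A' y') (hA : DifferentiableAt ℝ A (g y')) (hg : ContDiffAt ℝ ∞ g y')
    (hker : ∀ᶠ q in 𝓝 y', ∀ v, A' q v = 0 ↔ A (g q) (fderiv ℝ g q v) = 0)
    (hne : ∃ u, A (g y') (fderiv ℝ g y' u) ≠ 0) :
    GrayRel (fderiv ℝ A' y') (A' y') (ContinuousLinearMap.id ℝ E) x' x' := by
  have hg1 : HasFDerivAt g (fderiv ℝ g y') y' := (hg.differentiableAt (by simp)).hasFDerivAt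
  have hg2 : HasFDerivAt (fderiv ℝ g) (fderiv ℝ (fderiv ℝ g) y') y' :=
    ((hg.fderiv_right (m := ∞) (by simp)).differentiableAt (by simp)).hasFDerivAt
  have hsymm := hg.isSymmSndFDerivAt (by simpa using ENat.LEInfty.out)
  exact GrayRel.transfer (A := A) (G := g) (H := fderiv ℝ g) (S := univ) (S' := univ)
    h (mem_univ _) uniqueDiffWithinAt_univ hA'.hasFDerivAt.hasFDerivWithinAt
    hA.hasFDerivAt.hasFDerivWithinAt hg1.hasFDerivWithinAt (mapsTo_univ _ _)
    hg2.hasFDerivWithinAt (by rwa [nhdsWithin_univ]) hne (fun w => rfl) rfl rfl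
    (fun w => hsymm x' w)

/-- A 1-form with derivative `D` and value `α` at a point is nondegenerate there if `dα` is
nondegenerate on `ker α`. -/
def Nondeg (D : E →L[ℝ] E →L[ℝ] ℝ) (α : E →L[ℝ] ℝ) : Prop :=
  ∀ x, GrayRel D α (ContinuousLinearMap.id ℝ E) x x → x = 0

/-- The time derivative of the form is common to both equations, so the difference of two solutions
solves the homogeneous equation. -/
theorem GrayRel.unique {D : ℝ × E →L[ℝ] E →L[ℝ] ℝ} {α : E →L[ℝ] ℝ} {x y : E}
    (hD : Nondeg (D.comp (ContinuousLinearMap.inr ℝ ℝ E)) α)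
    (hx : GrayRel D α (ContinuousLinearMap.inr ℝ ℝ E) (1, x) x)
    (hy : GrayRel D α (ContinuousLinearMap.inr ℝ ℝ E) (1, y) y) : x = y := by
  obtain ⟨hx0, μ, hμ⟩ := hx
  obtain ⟨hy0, ν, hν⟩ := hy
  refine sub_eq_zero.1 (hD _ ⟨by rw [map_sub, hx0, hy0, sub_zero], μ - ν, fun w => ?_⟩)
  have e : D (0, x - y) = D (1, x) - D (1, y) := by rw [← map_sub]; simp
  rw [ContinuousLinearMap.comp_apply, ContinuousLinearMap.inr_apply, e]
  have h1 := hμ w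
  have h2 := hν w
  simp only [ContinuousLinearMap.comp_apply, ContinuousLinearMap.inr_apply,
    ContinuousLinearMap.id_apply, map_sub, sub_apply] at h1 h2 ⊢
  linear_combination h1 - h2

set_option synthInstance.maxHeartbeats 200000 in
/-- The linear operator of the Gray equation: `(x, μ) ↦ (i_x dα - μ α, α(x))`. -/
def grayOp (D : ℝ × E →L[ℝ] E →L[ℝ] ℝ) (α : E →L[ℝ] ℝ) : E × ℝ →L[ℝ] (E →L[ℝ] ℝ) × ℝ :=
  (((D.comp (ContinuousLinearMap.inr ℝ ℝ E) - (D.comp (ContinuousLinearMap.inr ℝ ℝ E)).flip).comp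
        (ContinuousLinearMap.fst ℝ E ℝ)) - (ContinuousLinearMap.snd ℝ E ℝ).smulRight α).prod
    (α.comp (ContinuousLinearMap.fst ℝ E ℝ))

theorem grayOp_apply (D : ℝ × E →L[ℝ] E →L[ℝ] ℝ) (α : E →L[ℝ] ℝ) (x : E) (μ : ℝ) :
    (∀ w, (grayOp D α (x, μ)).1 w = D (0, x) w - D (0, w) x - μ * α w) ∧
      (grayOp D α (x, μ)).2 = α x :=
  ⟨fun _ => rfl, rfl⟩

theorem gray_of_grayOp_eq {D : ℝ × E →L[ℝ] E →L[ℝ] ℝ} {α : E →L[ℝ] ℝ} {z : E × ℝ}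
    (h : grayOp D α z = (-(D (1, 0)), 0)) :
    α z.1 = 0 ∧ ∀ w, D (1, z.1) w - D (0, w) z.1 = z.2 * α w := by
  obtain ⟨h2, h3⟩ := grayOp_apply D α z.1 z.2
  refine ⟨h3.symm.trans (congrArg Prod.snd h), fun w => ?_⟩
  have e1 : D (1, z.1) = D (1, 0) + D (0, z.1) := by rw [← map_add]; simp
  have e2 : -(D (1, 0) w) = D (0, z.1) w - D (0, w) z.1 - z.2 * α w :=
    (congrArg (fun p : (E →L[ℝ] ℝ) × ℝ => p.1 w) h).symm.trans (h2 w)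
  rw [e1, add_apply]
  linear_combination -e2

variable [FiniteDimensional ℝ E]

/-- Treating the factor `μ` as an unknown turns an equation on the varying hyperplane `ker α` into a
square linear system on the fixed space `E × ℝ`. A kernel element has `x = 0` by nondegeneracy and
then `μ = 0` because `α ≠ 0`; the dimensions agree. -/
theorem exists_equiv_grayOp {D : ℝ × E →L[ℝ] E →L[ℝ] ℝ} {α : E →L[ℝ] ℝ}
    (hD : Nondeg (D.comp (ContinuousLinearMap.inr ℝ ℝ E)) α) (hα : α ≠ 0) :
    ∃ e : (E × ℝ) ≃L[ℝ] ((E →L[ℝ] ℝ) × ℝ), (e : E × ℝ →L[ℝ] (E →L[ℝ] ℝ) × ℝ) = grayOp D α := by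
  have hinj : Function.Injective (grayOp D α : E × ℝ →ₗ[ℝ] (E →L[ℝ] ℝ) × ℝ) := by
    refine (injective_iff_map_eq_zero _).2 ?_
    rintro ⟨x, μ⟩ h0
    replace h0 : grayOp D α (x, μ) = 0 := h0
    obtain ⟨h1, h2⟩ := grayOp_apply D α x μ
    rw [h0] at h1 h2
    have hx : x = 0 := hD x ⟨h2.symm, μ, fun w => by
      have := h1 w
      simp only [Prod.fst_zero, zero_apply] at this
      simp only [ContinuousLinearMap.comp_apply, ContinuousLinearMap.inr_apply,
        ContinuousLinearMap.id_apply]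
      linear_combination -this⟩
    subst hx
    obtain ⟨u, hu⟩ := DFunLike.ne_iff.1 hα
    have := h1 u
    simp only [Prod.fst_zero, zero_apply, map_zero, Prod.mk_zero_zero] at this hu
    have hμ : μ * α u = 0 := by linarith
    rcases mul_eq_zero.1 hμ with h | h
    · simp [h]
    · exact absurd h hu
  have hdim : Module.finrank ℝ (E × ℝ) = Module.finrank ℝ ((E →L[ℝ] ℝ) × ℝ) := by
    rw [Module.finrank_prod, Module.finrank_prod]
    congr 1
    rw [← Subspace.dual_finrank_eq (K := ℝ) (V := E)]
    exact (LinearMap.toContinuousLinearMap (𝕜 := ℝ) (E := E) (F' := ℝ)).finrank_eq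
  refine ⟨(LinearEquiv.ofInjectiveOfFinrankEq _ hinj hdim).toContinuousLinearEquiv, ?_⟩
  exact ContinuousLinearMap.ext fun x => rfl

/-- The operator is linear in `(D, α)`, and a linear map between finite-dimensional spaces is
smooth. -/
theorem contDiffOn_grayOp {S : Set Q} {D : Q → ℝ × E →L[ℝ] E →L[ℝ] ℝ} {A : Q → E →L[ℝ] ℝ}
    (hD : ContDiffOn ℝ ∞ D S) (hA : ContDiffOn ℝ ∞ A S) :
    ContDiffOn ℝ ∞ (fun q => grayOp (D q) (A q)) S := by
  refine contDiffOn_of_isLinearMap (l := grayOp) ⟨fun p q => ?_, fun c p => ?_⟩ hD hA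
  · refine ContinuousLinearMap.ext fun z => Prod.ext (ContinuousLinearMap.ext fun w => ?_) ?_
    · have h1 := (grayOp_apply (p + q).1 (p + q).2 z.1 z.2).1 w
      have h2 := (grayOp_apply p.1 p.2 z.1 z.2).1 w
      have h3 := (grayOp_apply q.1 q.2 z.1 z.2).1 w
      refine h1.trans (Eq.trans ?_ (congrArg₂ (· + ·) h2 h3).symm)
      simp only [Prod.fst_add, Prod.snd_add, add_apply]
      ring
    · rfl
  · refine ContinuousLinearMap.ext fun z => Prod.ext (ContinuousLinearMap.ext fun w => ?_) ?_
    · have h1 := (grayOp_apply (c • p).1 (c • p).2 z.1 z.2).1 w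
      have h2 := (grayOp_apply p.1 p.2 z.1 z.2).1 w
      refine h1.trans (Eq.trans ?_ (congrArg (c * ·) h2).symm)
      simp only [Prod.smul_fst, Prod.smul_snd, smul_apply, smul_eq_mul]
      ring
    · rfl

theorem exists_contDiffOn_gray {S : Set Q} {D : Q → ℝ × E →L[ℝ] E →L[ℝ] ℝ} {A : Q → E →L[ℝ] ℝ}
    (hD : ContDiffOn ℝ ∞ D S) (hA : ContDiffOn ℝ ∞ A S) (hne : ∀ q ∈ S, A q ≠ 0)
    (hnd : ∀ q ∈ S, Nondeg ((D q).comp (ContinuousLinearMap.inr ℝ ℝ E)) (A q)) :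
    ∃ z : Q → E × ℝ, ContDiffOn ℝ ∞ z S ∧ ∀ q ∈ S, grayOp (D q) (A q) (z q) =
      (-(D q (1, 0)), 0) := by
  have : CompleteSpace E := FiniteDimensional.complete ℝ E
  have hr : ContDiffOn ℝ ∞ (fun q => -(D q (1, 0))) S := (hD.clm_apply contDiffOn_const).neg
  exact exists_contDiffOn_solution (contDiffOn_grayOp hD hA) (hr.prodMk contDiffOn_const)
    (fun q hq => exists_equiv_grayOp (hnd q hq) (hne q hq))

/-- The smooth solution of the Gray equation of a nondegenerate family of 1-forms. -/
theorem exists_smooth_gray {A : ℝ × E → E →L[ℝ] ℝ} {O : Set (ℝ × E)} (hO : IsOpen O)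
    (hA : ContDiffOn ℝ ∞ A (slab E ∩ O)) (hne : ∀ q ∈ slab E ∩ O, A q ≠ 0)
    (hnd : ∀ q ∈ slab E ∩ O, Nondeg ((fderivWithin ℝ A (slab E) q).comp
      (ContinuousLinearMap.inr ℝ ℝ E)) (A q)) :
    ∃ (x : ℝ × E → E) (μ : ℝ × E → ℝ), ContDiffOn ℝ ∞ x (slab E ∩ O) ∧
      ContDiffOn ℝ ∞ μ (slab E ∩ O) ∧ ∀ q ∈ slab E ∩ O, A q (x q) = 0 ∧
        ∀ w, fderivWithin ℝ A (slab E) q (1, x q) w - fderivWithin ℝ A (slab E) q (0, w) (x q)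
          = μ q * A q w := by
  have hD : ContDiffOn ℝ ∞ (fderivWithin ℝ A (slab E)) (slab E ∩ O) := by
    refine (hA.fderivWithin (m := ∞) (uniqueDiffOn_slab.inter hO) (by simp)).congr fun q hq => ?_
    rw [fderivWithin_inter (hO.mem_nhds hq.2)]
  obtain ⟨z, hz, hzeq⟩ := exists_contDiffOn_gray hD hA hne hnd
  exact ⟨fun q => (z q).1, fun q => (z q).2, hz.fst, hz.snd,
    fun q hq => gray_of_grayOp_eq (hzeq q hq)⟩

end GrayEquation

/-! ### Transport of kernels along the flow in a vector space -/

section Transport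

variable {E P : Type*} [NormedAddCommGroup E] [NormedSpace ℝ E]
  [NormedAddCommGroup P] [NormedSpace ℝ P]

theorem hasFDerivWithinAt_slab {F : Type*} [NormedAddCommGroup F] [NormedSpace ℝ F]
    {f : ℝ × E → F} {O : Set (ℝ × E)} (hO : IsOpen O)
    (hf : ContDiffOn ℝ ∞ f (slab E ∩ O)) {q : ℝ × E} (hq : q ∈ slab E ∩ O) :
    HasFDerivWithinAt f (fderivWithin ℝ f (slab E) q) (slab E) q := by
  have h := (hf q hq).differentiableWithinAt (by simp)
  rw [differentiableWithinAt_inter (hO.mem_nhds hq.2)] at h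
  exact h.hasFDerivWithinAt

theorem contDiffOn_fderivWithin_slab {F : Type*} [NormedAddCommGroup F] [NormedSpace ℝ F]
    {f : ℝ × E → F} {O : Set (ℝ × E)} (hO : IsOpen O)
    (hf : ContDiffOn ℝ ∞ f (slab E ∩ O)) :
    ContDiffOn ℝ ∞ (fderivWithin ℝ f (slab E)) (slab E ∩ O) := by
  refine (hf.fderivWithin (m := ∞) (uniqueDiffOn_slab.inter hO) (by simp)).congr fun q hq => ?_
  rw [fderivWithin_inter (hO.mem_nhds hq.2)]

/-- The flow of a solution of the Gray equation preserves the kernels of the family of 1-forms. -/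
theorem gray_transport {A : ℝ × E → E →L[ℝ] ℝ} {x : ℝ × E → E} {μ : ℝ × E → ℝ} {O : Set (ℝ × E)}
    (hO : IsOpen O) (hA : ContDiffOn ℝ ∞ A (slab E ∩ O)) (hx : ContDiffOn ℝ ∞ x (slab E ∩ O))
    (hμ : ContDiffOn ℝ ∞ μ (slab E ∩ O))
    (heq : ∀ q ∈ slab E ∩ O, A q (x q) = 0 ∧ ∀ w, fderivWithin ℝ A (slab E) q (1, x q) w -
      fderivWithin ℝ A (slab E) q (0, w) (x q) = μ q * A q w)
    {F : ℝ × P → E} {U : Set (ℝ × P)} (hU : IsOpen U) (hF : ContDiffOn ℝ ∞ F (slab P ∩ U))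
    (hFO : ∀ q ∈ slab P ∩ U, (q.1, F q) ∈ O)
    (hode : ∀ q ∈ slab P ∩ U, fderivWithin ℝ F (slab P) q (1, 0) = x (q.1, F q))
    {a b : ℝ} (h01 : Icc a b ⊆ Icc (0 : ℝ) 1) {y : P} (hy : ∀ t ∈ Icc a b, (t, y) ∈ U) (v : P)
    {s t : ℝ} (hs : s ∈ Icc a b) (ht : t ∈ Icc a b)
    (h0 : A (s, F (s, y)) (fderivWithin ℝ F (slab P) (s, y) (0, v)) = 0) :
    A (t, F (t, y)) (fderivWithin ℝ F (slab P) (t, y) (0, v)) = 0 := by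
  set β : ℝ → ℝ := fun t => A (t, F (t, y)) (fderivWithin ℝ F (slab P) (t, y) (0, v)) with hβ
  have hder : ∀ t ∈ Icc a b, HasDerivWithinAt β (μ (t, F (t, y)) * β t) (Icc a b) t := by
    intro t ht
    have hq : (t, y) ∈ slab P ∩ U := ⟨mem_slab.2 (h01 ht), hy t ht⟩
    have hq' : (t, F (t, y)) ∈ slab E ∩ O := ⟨mem_slab.2 (h01 ht), hFO _ hq⟩
    have hγ : HasDerivWithinAt (fun s : ℝ => (s, y)) ((1 : ℝ), (0 : P)) (Icc a b) t :=
      (hasDerivWithinAt_id t _).prodMk (hasDerivWithinAt_const t _ y)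
    have hγm : MapsTo (fun s : ℝ => (s, y)) (Icc a b) (slab P) := fun s hs => mem_slab.2 (h01 hs)
    have dF := hasFDerivWithinAt_slab hU hF hq
    have dDF := hasFDerivWithinAt_slab hU (contDiffOn_fderivWithin_slab hU hF) hq
    have dA := hasFDerivWithinAt_slab hO hA hq'
    have dx := hasFDerivWithinAt_slab hO hx hq'
    set DF := fderivWithin ℝ F (slab P) with hDF
    set D2 := fderivWithin ℝ DF (slab P) (t, y) with hD2
    set DA := fderivWithin ℝ A (slab E) (t, F (t, y))
    set Dx := fderivWithin ℝ x (slab E) (t, F (t, y))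
    have hsymm : D2 (1, 0) (0, v) = D2 (0, v) (1, 0) := by
      have hc : ContDiffWithinAt ℝ ∞ F (slab P) (t, y) := by
        have := hF _ hq
        rwa [contDiffWithinAt_inter (hU.mem_nhds hq.2)] at this
      exact (hc.isSymmSndFDerivWithinAt (by simpa using ENat.LEInfty.out) uniqueDiffOn_slab
        (mem_closure_interior_slab hq.1) hq.1) _ _
    have hG : HasFDerivWithinAt (fun q : ℝ × P => (q.1, F q))
        ((ContinuousLinearMap.fst ℝ ℝ P).prod (DF (t, y))) (slab P) (t, y) :=
      hasFDerivWithinAt_fst.prodMk dF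
    have hGm : MapsTo (fun q : ℝ × P => (q.1, F q)) (slab P) (slab E) :=
      fun q hq => mem_slab.2 (mem_slab.1 hq)
    -- Differentiating the ODE in the initial value in direction `v` gives the linearised equation
    -- for `w = DF (0, v)`.
    have hmix : D2 (0, v) (1, 0) = Dx (0, DF (t, y) (0, v)) := by
      have h1 := dDF.clm_apply (hasFDerivWithinAt_const ((1 : ℝ), (0 : P)) (t, y) (slab P))
      have h2 : HasFDerivWithinAt (fun q : ℝ × P => x (q.1, F q)) _ (slab P) (t, y) :=
        HasFDerivWithinAt.comp (t, y) (g := x) dx hG hGm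
      have hev : (fun q => DF q (1, 0)) =ᶠ[𝓝[slab P] (t, y)] fun q => x (q.1, F q) := by
        filter_upwards [inter_mem self_mem_nhdsWithin
          (mem_nhdsWithin_of_mem_nhds (hU.mem_nhds hq.2))] with q hq
        exact hode q hq
      have h3 := (uniqueDiffOn_slab _ hq.1).eq h1 (h2.congr_of_eventuallyEq hev (hode _ hq))
      have := congrArg (fun T : ℝ × P →L[ℝ] E => T (0, v)) h3
      simpa using this
    -- This is the derivative of the identity `A q (x q) = 0` in the spatial direction `w`.
    have hzero : DA (0, DF (t, y) (0, v)) (x (t, F (t, y)))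
        + A (t, F (t, y)) (Dx (0, DF (t, y) (0, v))) = 0 := by
      have h1 := dA.clm_apply dx
      have hev : (fun q => A q (x q)) =ᶠ[𝓝[slab E] (t, F (t, y))] fun _ => (0 : ℝ) := by
        filter_upwards [inter_mem self_mem_nhdsWithin
          (mem_nhdsWithin_of_mem_nhds (hO.mem_nhds hq'.2))] with q hq
        exact (heq q hq).1
      have h3 := (uniqueDiffOn_slab _ hq'.1).eq h1
        ((hasFDerivWithinAt_const (0 : ℝ) _ _).congr_of_eventuallyEq hev (heq _ hq').1)
      have := congrArg (fun T : ℝ × E →L[ℝ] ℝ => T (0, DF (t, y) (0, v))) h3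
      simp only [add_apply, ContinuousLinearMap.comp_apply, ContinuousLinearMap.flip_apply,
        zero_apply] at this
      linarith
    have hc : HasDerivWithinAt (fun s => A (s, F (s, y))) (DA (1, x (t, F (t, y))))
        (Icc a b) t := by
      have h1 : HasFDerivWithinAt (fun q : ℝ × P => A (q.1, F q)) _ (slab P) (t, y) :=
        HasFDerivWithinAt.comp (t, y) (g := A) dA hG hGm
      have h2 := h1.comp_hasDerivWithinAt t hγ hγm
      refine h2.congr_deriv ?_
      simp only [ContinuousLinearMap.comp_apply, ContinuousLinearMap.prod_apply,
        ContinuousLinearMap.coe_fst']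
      rw [hode _ hq]
    have hw : HasDerivWithinAt (fun s => DF (s, y) (0, v)) (Dx (0, DF (t, y) (0, v)))
        (Icc a b) t := by
      have h0 : HasDerivWithinAt (fun s => DF (s, y)) (D2 (1, 0)) (Icc a b) t :=
        dDF.comp_hasDerivWithinAt t hγ hγm
      have h1 := h0.clm_apply (hasDerivWithinAt_const t (Icc a b) ((0 : ℝ), v))
      refine h1.congr_deriv ?_
      rw [← hmix, ← hsymm]
      simp
    refine (hc.clm_apply hw).congr_deriv ?_
    -- By the product rule `β' = DA(1, x) w + A(Dx(0, w))`. The identity `hzero` replaces the second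
    -- term by `-DA(0, w) x`, and the Gray equation turns the result into `μ β`.
    have := (heq _ hq').2 (DF (t, y) (0, v))
    rw [hβ]
    simp only
    linear_combination this + hzero
  have hμc : ContinuousOn (fun t => μ (t, F (t, y))) (Icc a b) := by
    refine hμ.continuousOn.comp (continuousOn_id.prodMk ?_)
      (fun t ht => ⟨mem_slab.2 (h01 ht), hFO _ ⟨mem_slab.2 (h01 ht), hy t ht⟩⟩)
    exact hF.continuousOn.comp (f := fun t => (t, y))
      (continuous_id.prodMk continuous_const).continuousOn
      (fun t ht => ⟨mem_slab.2 (h01 ht), hy t ht⟩)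
  obtain ⟨K, hK⟩ := isCompact_Icc.exists_bound_of_continuousOn hμc
  have hK0 : 0 ≤ K := (norm_nonneg _).trans (hK s hs)
  obtain ⟨C, -, hC⟩ := exists_gronwall_const (E := ℝ) K hK0 (hs.1.trans hs.2)
  have := hC β _ 0 0 s hs le_rfl hder (by rw [hβ]; simp [h0]) (fun t ht => by
    rw [add_zero, norm_mul]
    exact mul_le_mul_of_nonneg_right (hK t ht) (norm_nonneg _)) t ht
  rw [add_zero, mul_zero] at this
  exact norm_le_zero_iff.1 this

end Transport

section Embedding

/-! ### Embedded compact manifolds -/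

variable {m : ℕ} {M : Type*} [TopologicalSpace M] [ChartedSpace (Model m) M]
  {F : Type*} [NormedAddCommGroup F] [NormedSpace ℝ F]

theorem contMDiffOn_prod_self_iff {F' : Type*} [NormedAddCommGroup F'] [NormedSpace ℝ F']
    {f : ℝ × F → F'} {s : Set (ℝ × F)} :
    ContMDiffOn (𝓘(ℝ, ℝ).prod 𝓘(ℝ, F)) 𝓘(ℝ, F') ∞ f s ↔ ContDiffOn ℝ ∞ f s := by
  rw [← modelWithCornersSelf_prod, chartedSpaceSelf_prod, contMDiffOn_iff_contDiffOn]

/-- The parametrisation of an embedded manifold by a chart is smooth. -/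
theorem contDiffOn_comp_extChartAt_symm [IsManifold (𝓡 m) ∞ M] {e : M → F}
    (he : ContMDiff (𝓡 m) 𝓘(ℝ, F) ∞ e) (p₀ : M) :
    ContDiffOn ℝ ∞ (e ∘ (extChartAt (𝓡 m) p₀).symm) (extChartAt (𝓡 m) p₀).target := by
  rw [← contMDiffOn_iff_contDiffOn]
  exact he.comp_contMDiffOn (contMDiffOn_extChartAt_symm p₀)

theorem mfderiv_comp_extChartAt_symm [IsManifold (𝓡 m) ∞ M] {e : M → F}
    (he : ContMDiff (𝓡 m) 𝓘(ℝ, F) ∞ e) (p₀ : M) {y : Model m}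
    (hy : y ∈ (extChartAt (𝓡 m) p₀).target) :
    fderiv ℝ (e ∘ (extChartAt (𝓡 m) p₀).symm) y =
      (mfderiv (𝓡 m) 𝓘(ℝ, F) e ((extChartAt (𝓡 m) p₀).symm y)).comp
        (mfderiv 𝓘(ℝ, Model m) (𝓡 m) (extChartAt (𝓡 m) p₀).symm y) := by
  rw [← mfderiv_eq_fderiv]
  refine mfderiv_comp y (he.mdifferentiableAt (by simp)) ?_
  have := mdifferentiableWithinAt_extChartAt_symm hy
  rwa [ModelWithCorners.range_eq_univ, mdifferentiableWithinAt_univ] at this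

theorem isInvertible_mfderiv_extChartAt_symm [IsManifold (𝓡 m) ∞ M] (p₀ : M) {y : Model m}
    (hy : y ∈ (extChartAt (𝓡 m) p₀).target) :
    (mfderiv 𝓘(ℝ, Model m) (𝓡 m) (extChartAt (𝓡 m) p₀).symm y).IsInvertible := by
  have := isInvertible_mfderivWithin_extChartAt_symm (I := 𝓡 m) hy
  rwa [ModelWithCorners.range_eq_univ, mfderivWithin_univ] at this

/-- An embedded manifold has local smooth retractions. -/
theorem exists_local_retraction [IsManifold (𝓡 m) ∞ M] [FiniteDimensional ℝ F] {e : M → F}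
    (he : ContMDiff (𝓡 m) 𝓘(ℝ, F) ∞ e) (hemb : Topology.IsEmbedding e)
    (hinj : ∀ p, Function.Injective (mfderiv (𝓡 m) 𝓘(ℝ, F) e p)) (p₀ : M) :
    ∃ (O : Set F) (r : F → M), IsOpen O ∧ e p₀ ∈ O ∧ ContMDiffOn 𝓘(ℝ, F) (𝓡 m) ∞ r O ∧
      ∀ p, e p ∈ O → r (e p) = p := by
  set φ := extChartAt (𝓡 m) p₀ with hφ
  set f : Model m → F := e ∘ φ.symm with hf
  have hy₀ : φ p₀ ∈ φ.target := mem_extChartAt_target p₀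
  have htO : IsOpen φ.target := isOpen_extChartAt_target p₀
  have hfs : ContDiffOn ℝ ∞ f φ.target := contDiffOn_comp_extChartAt_symm he p₀
  have hfinj : Function.Injective (fderiv ℝ f (φ p₀)) := by
    rw [mfderiv_comp_extChartAt_symm he p₀ hy₀]
    exact (hinj _).comp (isInvertible_mfderiv_extChartAt_symm p₀ hy₀).injective
  -- With `L` a left inverse of the derivative of `f`, the map `h = L ∘ f` has identity derivative
  -- at the base point and is a local diffeomorphism there, with inverse `θ.symm`. The retraction is
  -- `φ.symm ∘ θ.symm ∘ L`.
  obtain ⟨L₀, hL₀⟩ := LinearMap.exists_leftInverse_of_injective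
    (fderiv ℝ f (φ p₀) : Model m →ₗ[ℝ] F) (LinearMap.ker_eq_bot.2 hfinj)
  let L : F →L[ℝ] Model m := LinearMap.toContinuousLinearMap L₀
  have hL : ∀ v, L (fderiv ℝ f (φ p₀) v) = v := fun v => LinearMap.congr_fun hL₀ v
  set h : Model m → Model m := L ∘ f with hh
  have hhs : ContDiffOn ℝ ∞ h φ.target := L.contDiff.comp_contDiffOn hfs
  have hhat : ∀ y ∈ φ.target, ContDiffAt ℝ ∞ h y := fun y hy => hhs.contDiffAt (htO.mem_nhds hy)
  have hfd : HasFDerivAt f (fderiv ℝ f (φ p₀)) (φ p₀) :=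
    ((hfs.contDiffAt (htO.mem_nhds hy₀)).differentiableAt (by simp)).hasFDerivAt
  have hd : HasFDerivAt h ((ContinuousLinearEquiv.refl ℝ (Model m) :
      Model m ≃L[ℝ] Model m) : Model m →L[ℝ] Model m) (φ p₀) := by
    have := L.hasFDerivAt.comp (φ p₀) hfd
    refine this.congr_fderiv ?_
    ext1 v
    exact hL v
  let θ := (hhat _ hy₀).toOpenPartialHomeomorph h hd (by simp)
  have hθ : ∀ y, θ y = h y := fun y => rfl
  have hθ₀ : φ p₀ ∈ θ.source := (hhat _ hy₀).mem_toOpenPartialHomeomorph_source hd (by simp)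
  -- Smoothness of the local inverse at every point of a neighbourhood needs an invertible
  -- derivative at each of its points, not only at the centre.
  have hinvN : ∀ᶠ y in 𝓝 (φ p₀), ∃ T : Model m ≃L[ℝ] Model m,
      (T : Model m →L[ℝ] Model m) = fderiv ℝ h y := by
    have hc : ContinuousAt (fderiv ℝ h) (φ p₀) :=
      ((hhat _ hy₀).fderiv_right (m := ∞) (by simp)).continuousAt
    have hn := ContinuousLinearEquiv.nhds (ContinuousLinearEquiv.refl ℝ (Model m))
    rw [← hd.fderiv] at hn
    exact hc hn
  obtain ⟨V₁, hV₁, hV₁o, hV₁m⟩ := eventually_nhds_iff.1 hinvN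
  set V := V₁ ∩ φ.target ∩ θ.source with hV
  have hVo : IsOpen V := (hV₁o.inter htO).inter θ.open_source
  have hVm : φ p₀ ∈ V := ⟨⟨hV₁m, hy₀⟩, hθ₀⟩
  -- Here the embedding property enters: it keeps remote parts of the manifold out of a
  -- neighbourhood of `e p₀`.
  obtain ⟨O', hO'o, hO'⟩ : ∃ O' : Set F, IsOpen O' ∧ e ⁻¹' O' = φ.source ∩ φ ⁻¹' V :=
    hemb.isOpen_iff.1 ((continuousOn_extChartAt p₀).isOpen_inter_preimage
      (isOpen_extChartAt_source p₀) hVo)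
  have hWo : IsOpen (θ.target ∩ θ.symm ⁻¹' V) :=
    θ.symm.isOpen_inter_preimage hVo
  have hret : ∀ p, e p ∈ O' → p ∈ φ.source ∧ φ p ∈ V ∧ L (e p) = θ (φ p) := by
    intro p hp
    have : p ∈ φ.source ∩ φ ⁻¹' V := by rw [← hO']; exact hp
    refine ⟨this.1, this.2, ?_⟩
    rw [hθ, hh, hf]
    simp [φ.left_inv this.1]
  refine ⟨O' ∩ L ⁻¹' (θ.target ∩ θ.symm ⁻¹' V), fun z => φ.symm (θ.symm (L z)),
    hO'o.inter (hWo.preimage L.continuous), ?_, ?_, ?_⟩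
  · have h1 : e p₀ ∈ O' := by
      change p₀ ∈ e ⁻¹' O'
      rw [hO']; exact ⟨mem_extChartAt_source p₀, hVm⟩
    obtain ⟨-, -, h2⟩ := hret p₀ h1
    refine ⟨h1, ?_⟩
    rw [mem_preimage, h2]
    refine ⟨θ.map_source hθ₀, ?_⟩
    rw [mem_preimage, θ.left_inv hθ₀]
    exact hVm
  · have hs : ContDiffOn ℝ ∞ θ.symm (θ.target ∩ θ.symm ⁻¹' V) := by
      intro a ha
      obtain ⟨T, hT⟩ := hV₁ _ ha.2.1.1
      refine (θ.contDiffAt_symm ha.1 (f₀' := T) ?_ (hhat _ ha.2.1.2)).contDiffWithinAt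
      rw [hT]
      exact ((hhat _ ha.2.1.2).differentiableAt (by simp)).hasFDerivAt
    have h2 : ContDiffOn ℝ ∞ (fun z => θ.symm (L z))
        (O' ∩ L ⁻¹' (θ.target ∩ θ.symm ⁻¹' V)) :=
      hs.comp L.contDiff.contDiffOn (fun z hz => hz.2)
    exact (contMDiffOn_extChartAt_symm p₀).comp h2.contMDiffOn (fun z hz => hz.2.2.1.2)
  · intro p hp
    obtain ⟨h1, h2, h3⟩ := hret p hp.1
    simp only
    rw [h3, θ.left_inv h2.2, φ.left_inv h1]

end Embedding

/-! ### Extending fields off an embedded manifold, and invariance of the manifold -/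

section FlowOnManifold

variable {m : ℕ} {M : Type*} [TopologicalSpace M] [ChartedSpace (Model m) M]
  [IsManifold (𝓡 m) ∞ M] {F : Type} [NormedAddCommGroup F] [NormedSpace ℝ F]
  [FiniteDimensional ℝ F]

/-- A map into an embedded manifold is smooth if it is smooth as a map into the ambient space. -/
theorem contMDiffWithinAt_of_comp_embedding {e : M → F} (he : ContMDiff (𝓡 m) 𝓘(ℝ, F) ∞ e)
    (hemb : Topology.IsEmbedding e)
    (hinj : ∀ p, Function.Injective (mfderiv (𝓡 m) 𝓘(ℝ, F) e p))
    {E' H' X : Type*} [NormedAddCommGroup E'] [NormedSpace ℝ E'] [TopologicalSpace H']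
    {I' : ModelWithCorners ℝ E' H'} [TopologicalSpace X] [ChartedSpace H' X]
    {h : X → M} {s : Set X} {x : X}
    (hh : ContMDiffWithinAt I' 𝓘(ℝ, F) ∞ (fun y => e (h y)) s x) :
    ContMDiffWithinAt I' (𝓡 m) ∞ h s x := by
  obtain ⟨O, r, hO, hm, hr, hre⟩ := exists_local_retraction he hemb hinj (h x)
  have h1 : ContMDiffWithinAt I' (𝓡 m) ∞ (fun y => r (e (h y))) s x :=
    ((hr _ hm).contMDiffAt (hO.mem_nhds hm)).comp_contMDiffWithinAt x hh
  refine h1.congr_of_eventuallyEq ?_ (hre _ hm).symm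
  filter_upwards [hh.continuousWithinAt (hO.mem_nhds hm)] with y hy
  exact (hre _ hy).symm

/-- Extension of a time-dependent function from an embedded compact manifold to the ambient
space. -/
theorem exists_extension [CompactSpace M] {e : M → F} (he : ContMDiff (𝓡 m) 𝓘(ℝ, F) ∞ e)
    (hemb : Topology.IsClosedEmbedding e)
    (hinj : ∀ p, Function.Injective (mfderiv (𝓡 m) 𝓘(ℝ, F) e p)) {g : ℝ × M → F}
    (hg : ContMDiffOn (𝓘(ℝ, ℝ).prod (𝓡 m)) 𝓘(ℝ, F) ∞ g (Icc (0 : ℝ) 1 ×ˢ univ)) :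
    ∃ (G : ℝ × F → F) (k : Set F), ContDiffOn ℝ ∞ G (slab F) ∧ IsCompact k ∧
      (∀ t, ∀ x ∉ k, G (t, x) = 0) ∧ ∀ t p, G (t, e p) = g (t, p) := by
  have hloc := exists_local_retraction he hemb.isEmbedding hinj
  choose O r hO hm hr hre using hloc
  have hcpt : IsCompact (range e) := isCompact_range he.continuous
  obtain ⟨T, hT⟩ := hcpt.elim_finite_subcover O hO
    (by rintro _ ⟨p, rfl⟩; exact mem_iUnion.2 ⟨p, hm p⟩)
  obtain ⟨ρ, hρ⟩ := SmoothPartitionOfUnity.exists_isSubordinate 𝓘(ℝ, F) hcpt.isClosed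
    (fun i : T => O i) (fun i => hO i) (by
      refine hT.trans ?_
      intro z hz
      obtain ⟨i, hi, hz⟩ := mem_iUnion₂.1 hz
      exact mem_iUnion.2 ⟨⟨i, hi⟩, hz⟩)
  obtain ⟨R, hR⟩ := hcpt.isBounded.subset_closedBall (0 : F)
  let χ : ContDiffBump (0 : F) := ⟨max R 1, max R 1 + 1, by positivity, by linarith⟩
  -- The local extensions `g (t, r i z)` are glued by a partition of unity. The bump `χ`, equal to
  -- `1` on the manifold, makes the support compact.
  refine ⟨fun q => χ q.2 • ∑ i, ρ i q.2 • g (q.1, r i q.2), tsupport χ, ?_, χ.hasCompactSupport,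
    ?_, ?_⟩
  · refine (χ.contDiff.comp contDiff_snd).contDiffOn.smul (ContDiffOn.sum fun i _ => ?_)
    rintro ⟨t, z⟩ hq
    by_cases hz : z ∈ tsupport (ρ i)
    · have hzO : z ∈ O i := hρ i hz
      have h1 : ContDiffOn ℝ ∞ (fun q : ℝ × F => g (q.1, r i q.2)) (slab F ∩ univ ×ˢ O i) := by
        rw [← contMDiffOn_prod_self_iff]
        refine hg.comp (contMDiffOn_fst.prodMk ?_) (fun q hq => ⟨mem_slab.1 hq.1, trivial⟩)
        exact (hr i).comp contMDiffOn_snd (fun q hq => hq.2.2)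
      have h2 : ContDiffWithinAt ℝ ∞ (fun q : ℝ × F => g (q.1, r i q.2)) (slab F) (t, z) := by
        have := h1 (t, z) ⟨hq, trivial, hzO⟩
        rwa [contDiffWithinAt_inter ((isOpen_univ.prod (hO i)).mem_nhds ⟨trivial, hzO⟩)] at this
      exact (((ρ i).contMDiff.contDiff.comp contDiff_snd).contDiffWithinAt).smul h2
    · refine (contDiffWithinAt_const (c := (0 : F))).congr_of_eventuallyEq ?_ ?_
      · have : ∀ᶠ q : ℝ × F in 𝓝 (t, z), q.2 ∉ tsupport (ρ i) :=
          (continuous_snd.tendsto (t, z)).eventually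
            ((isClosed_tsupport (ρ i)).isOpen_compl.mem_nhds hz)
        filter_upwards [mem_nhdsWithin_of_mem_nhds this] with q hq
        rw [image_eq_zero_of_notMem_tsupport hq, zero_smul]
      · simp only
        rw [image_eq_zero_of_notMem_tsupport hz, zero_smul]
  · intro t x hx
    simp only
    rw [image_eq_zero_of_notMem_tsupport hx, zero_smul]
  · intro t p
    have h1 : χ (e p) = 1 := χ.one_of_mem_closedBall
      (Metric.closedBall_subset_closedBall (le_max_left _ _) (hR ⟨p, rfl⟩))
    have h2 : ∀ i : T, ρ i (e p) • g (t, r i (e p)) = ρ i (e p) • g (t, p) := by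
      intro i
      by_cases hz : e p ∈ tsupport (ρ i)
      · rw [hre i p (hρ i hz)]
      · rw [image_eq_zero_of_notMem_tsupport hz, zero_smul, zero_smul]
    have h3 := ρ.sum_eq_one (x := e p) ⟨p, rfl⟩
    rw [finsum_eq_sum_of_fintype] at h3
    simp only
    rw [h1, one_smul, Finset.sum_congr rfl (fun i _ => h2 i), ← Finset.sum_smul, h3, one_smul]

/-- Trajectories of a vector field that is tangent to an embedded compact manifold stay on it. -/
theorem trajectory_mem_range [CompactSpace M] {e : M → F} (he : ContMDiff (𝓡 m) 𝓘(ℝ, F) ∞ e)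
    (hemb : Topology.IsClosedEmbedding e)
    (hinj : ∀ p, Function.Injective (mfderiv (𝓡 m) 𝓘(ℝ, F) e p)) {G : ℝ × F → F}
    (hG : ContDiffOn ℝ ∞ G (slab F))
    (htan : ∀ t ∈ Icc (0 : ℝ) 1, ∀ p, G (t, e p) ∈ range (mfderiv (𝓡 m) 𝓘(ℝ, F) e p))
    {Z : ℝ → F} (hZ : ∀ t ∈ Icc (0 : ℝ) 1, HasDerivWithinAt Z (G (t, Z t)) (Icc (0 : ℝ) 1) t)
    {s : ℝ} (hs : s ∈ Icc (0 : ℝ) 1) (hZs : Z s ∈ range e) :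
    ∀ t ∈ Icc (0 : ℝ) 1, Z t ∈ range e := by
  have hZc : ContinuousOn Z (Icc 0 1) := fun t ht => (hZ t ht).continuousWithinAt
  have hlocal : ∀ t₁ ∈ Icc (0 : ℝ) 1, Z t₁ ∈ range e →
      ∀ᶠ t in 𝓝[Icc 0 1] t₁, Z t ∈ range e := by
    rintro t₁ ht₁ ⟨q, hq⟩
    obtain ⟨O, r, hO, hm, hr, hre⟩ := exists_local_retraction he hemb.isEmbedding hinj q
    have hers : ContDiffOn ℝ ∞ (fun z => e (r z)) O := by
      rw [← contMDiffOn_iff_contDiffOn]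
      exact he.comp_contMDiffOn hr
    -- The defect `N` vanishes on the manifold near `e q`, and a zero of `N` lies on the manifold.
    -- The derivative of `N` along a trajectory `Z` is `H (t, Z t)`.
    set N : F → F := fun z => z - e (r z) with hN
    have hNs : ContDiffOn ℝ ∞ N O := contDiffOn_id.sub hers
    have hNd : ∀ z ∈ O, HasFDerivAt N (fderiv ℝ N z) z := fun z hz =>
      ((hNs.contDiffAt (hO.mem_nhds hz)).differentiableAt (by simp)).hasFDerivAt
    set H : ℝ × F → F := fun q => fderiv ℝ N q.2 (G q) with hH
    have hHs : ContDiffWithinAt ℝ ∞ H (slab F) (t₁, e q) := by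
      have h1 : ContDiffAt ℝ ∞ (fun p : ℝ × F => fderiv ℝ N p.2) (t₁, e q) :=
        ((hNs.contDiffAt (hO.mem_nhds hm)).fderiv_right (m := ∞) (by simp)).comp (t₁, e q)
          contDiffAt_snd
      exact h1.contDiffWithinAt.clm_apply (hG _ (mem_slab.2 ht₁))
    -- `N ∘ e` vanishes near `p`, so the derivative of `N` kills tangent vectors, and the field is
    -- tangent.
    have hHzero : ∀ t ∈ Icc (0 : ℝ) 1, ∀ p, e p ∈ O → H (t, e p) = 0 := by
      intro t ht p hp
      obtain ⟨ζ, hζ⟩ := htan t ht p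
      have hmd : MDifferentiableAt (𝓡 m) 𝓘(ℝ, F) e p := he.mdifferentiableAt (by simp)
      have h1 : HasMFDerivAt (𝓡 m) 𝓘(ℝ, F) (N ∘ e) p
          ((fderiv ℝ N (e p)).comp (mfderiv (𝓡 m) 𝓘(ℝ, F) e p)) :=
        HasMFDerivAt.comp p (hNd _ hp).hasMFDerivAt hmd.hasMFDerivAt
      have h2 : HasMFDerivAt (𝓡 m) 𝓘(ℝ, F) (N ∘ e) p
          (0 : TangentSpace (𝓡 m) p →L[ℝ] TangentSpace 𝓘(ℝ, F) ((N ∘ e) p)) := by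
        refine (hasMFDerivAt_const (0 : F) p).congr_of_eventuallyEq ?_
        filter_upwards [he.continuous.continuousAt (hO.mem_nhds hp)] with p' hp'
        have : r (e p') = p' := hre p' hp'
        simp [hN, this]
      have h3 := hasMFDerivAt_unique h1 h2
      have h4 := congrArg (fun T : TangentSpace (𝓡 m) p →L[ℝ] F => T ζ) h3
      simp only [hH]
      rw [← hζ]
      exact h4
    have hconv : Convex ℝ (slab F) := (convex_Icc 0 1).prod convex_univ
    obtain ⟨K, T, hT, hK⟩ := (hHs.of_le (m := 1) ENat.LEInfty.out).exists_lipschitzOnWith hconv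
    have hre0 : r (e q) = q := hre q hm
    have hZt : Tendsto (fun t => (t, Z t)) (𝓝[Icc 0 1] t₁) (𝓝[slab F] (t₁, e q)) := by
      refine tendsto_nhdsWithin_iff.2 ⟨?_, ?_⟩
      · rw [hq]
        exact (continuousWithinAt_id.prodMk (hZc t₁ ht₁))
      · filter_upwards [self_mem_nhdsWithin] with t ht using mem_slab.2 ht
    have hZ2 : Tendsto Z (𝓝[Icc 0 1] t₁) (𝓝 (e q)) := by rw [hq]; exact hZc t₁ ht₁
    have herc : ContinuousAt (fun z => e (r z)) (e q) :=
      (hers.contDiffAt (hO.mem_nhds hm)).continuousAt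
    have herZ : Tendsto (fun t => e (r (Z t))) (𝓝[Icc 0 1] t₁) (𝓝 (e q)) := by
      have := herc.tendsto.comp hZ2
      rwa [hre0] at this
    have hert : Tendsto (fun t => (t, e (r (Z t)))) (𝓝[Icc 0 1] t₁) (𝓝[slab F] (t₁, e q)) := by
      refine tendsto_nhdsWithin_iff.2 ⟨?_, ?_⟩
      · exact Tendsto.prodMk_nhds (tendsto_nhdsWithin_of_tendsto_nhds tendsto_id) herZ
      · filter_upwards [self_mem_nhdsWithin] with t ht using mem_slab.2 ht
    have hgood : ∀ᶠ t in 𝓝[Icc 0 1] t₁, (t, Z t) ∈ T ∧ (t, e (r (Z t))) ∈ T ∧ Z t ∈ O ∧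
        e (r (Z t)) ∈ O := by
      filter_upwards [hZt hT, hert hT, hZ2 (hO.mem_nhds hm), herZ (hO.mem_nhds hm)]
        with t h1 h2 h3 h4 using ⟨h1, h2, h3, h4⟩
    obtain ⟨δ, hδ, hball⟩ := Metric.mem_nhdsWithin_iff.1 hgood
    set a := max 0 (t₁ - δ / 2) with ha
    set b := min 1 (t₁ + δ / 2) with hb
    have hab : Icc a b ⊆ Icc (0 : ℝ) 1 := Icc_subset_Icc (le_max_left _ _) (min_le_left _ _)
    have habg : ∀ t ∈ Icc a b, (t, Z t) ∈ T ∧ (t, e (r (Z t))) ∈ T ∧ Z t ∈ O ∧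
        e (r (Z t)) ∈ O := by
      intro t ht
      refine hball ⟨?_, hab ht⟩
      rw [Metric.mem_ball, Real.dist_eq, abs_lt]
      have h1 := (le_max_right 0 (t₁ - δ / 2)).trans ht.1
      have h2 := ht.2.trans (min_le_right 1 (t₁ + δ / 2))
      constructor <;> linarith
    have ht₁ab : t₁ ∈ Icc a b :=
      ⟨max_le ht₁.1 (by linarith), le_min ht₁.2 (by linarith)⟩
    obtain ⟨C, -, hC⟩ := exists_gronwall_const (E := F) K K.2 (ht₁ab.1.trans ht₁ab.2)
    -- Comparing `H` at `Z t` with its value `0` at `e (r (Z t))`, at distance `‖N (Z t)‖`, gives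
    -- `‖(N ∘ Z)'‖ ≤ K ‖N ∘ Z‖`. Grönwall with zero initial value applies.
    have hu : ∀ t ∈ Icc a b, N (Z t) = 0 := by
      intro t ht
      have := hC (fun t => N (Z t)) (fun t => H (t, Z t)) 0 0 t₁ ht₁ab le_rfl
        (fun t ht => (hNd _ (habg t ht).2.2.1).comp_hasDerivWithinAt t
          ((hZ t (hab ht)).mono hab))
        (by rw [← hq]; simp [hN, hre0]) (fun t ht => by
          have h1 := hK.dist_le_mul _ (habg t ht).1 _ (habg t ht).2.1
          rw [hHzero t (hab ht) _ (habg t ht).2.2.2, dist_zero_right] at h1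
          rw [add_zero]
          refine h1.trans (le_of_eq ?_)
          congr 1
          rw [Prod.dist_eq, dist_self, max_eq_right dist_nonneg, dist_eq_norm]) t ht
      rw [add_zero, mul_zero] at this
      exact norm_le_zero_iff.1 this
    have hnb : Icc a b ∈ 𝓝[Icc 0 1] t₁ := by
      have : Icc (t₁ - δ / 2) (t₁ + δ / 2) ∈ 𝓝 t₁ := Icc_mem_nhds (by linarith) (by linarith)
      filter_upwards [mem_nhdsWithin_of_mem_nhds this, self_mem_nhdsWithin] with t h1 h2
      exact ⟨max_le h2.1 h1.1, le_min h2.2 h1.2⟩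
    filter_upwards [hnb] with t ht
    exact ⟨r (Z t), (sub_eq_zero.1 (hu t ht)).symm⟩
  have hpre : PreconnectedSpace (Icc (0 : ℝ) 1) :=
    isPreconnected_iff_preconnectedSpace.1 isPreconnected_Icc
  -- The set of good times is closed because the manifold is compact, and open by `hlocal`.
  have hclopen : IsClopen {t : Icc (0 : ℝ) 1 | Z t ∈ range e} := by
    refine ⟨(isCompact_range he.continuous).isClosed.preimage
      (continuousOn_iff_continuous_domRestrict.1 hZc), ?_⟩
    rw [isOpen_iff_mem_nhds]
    rintro ⟨t, ht⟩ h
    have := hlocal t ht h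
    exact (preimage_coe_mem_nhds_subtype (s := Icc (0 : ℝ) 1) (a := ⟨t, ht⟩)
      (t := {t | Z t ∈ range e})).2 this
  have huniv := hclopen.eq_univ ⟨⟨s, hs⟩, hZs⟩
  intro t ht
  have : (⟨t, ht⟩ : Icc (0 : ℝ) 1) ∈ {t : Icc (0 : ℝ) 1 | Z t ∈ range e} := by
    rw [huniv]; trivial
  exact this

end FlowOnManifold

/-! ### From vector fields to isotopies -/

section Isotopy

variable {m : ℕ} {M : Type*} [TopologicalSpace M] [ChartedSpace (Model m) M]
  [IsManifold (𝓡 m) ∞ M] {F : Type} [NormedAddCommGroup F] [NormedSpace ℝ F]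
  [FiniteDimensional ℝ F]

/-- A smooth time-dependent vector field on an embedded compact manifold, given by its components in
the ambient space, generates an isotopy. -/
theorem exists_isotopy [CompactSpace M] {e : M → F} (he : ContMDiff (𝓡 m) 𝓘(ℝ, F) ∞ e)
    (hemb : Topology.IsClosedEmbedding e)
    (hinj : ∀ p, Function.Injective (mfderiv (𝓡 m) 𝓘(ℝ, F) e p)) {V : ℝ × M → F}
    (hV : ContMDiffOn (𝓘(ℝ, ℝ).prod (𝓡 m)) 𝓘(ℝ, F) ∞ V (Icc (0 : ℝ) 1 ×ˢ univ))
    (htan : ∀ t ∈ Icc (0 : ℝ) 1, ∀ p, V (t, p) ∈ range (mfderiv (𝓡 m) 𝓘(ℝ, F) e p)) :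
    ∃ ψ : ℝ → M ≃ₘ^∞⟮𝓡 m, 𝓡 m⟯ M, IsIsotopy ψ ∧ ∀ t ∈ Icc (0 : ℝ) 1, ∀ p,
      HasDerivWithinAt (fun s => e (ψ s p)) (V (t, ψ t p)) (Icc (0 : ℝ) 1) t := by
  obtain ⟨G, k, hG, hk, hGk, hGV⟩ := exists_extension he hemb hinj hV
  obtain ⟨K, hlip, hflow⟩ := exists_flow one_pos hG hk (fun t _ x hx => hGk t x hx)
  choose! Φ hΦ0 hΦode hΦs using hflow
  have htan' : ∀ t ∈ Icc (0 : ℝ) 1, ∀ p, G (t, e p) ∈ range (mfderiv (𝓡 m) 𝓘(ℝ, F) e p) :=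
    fun t ht p => by rw [hGV]; exact htan t ht p
  have hmem : ∀ s ∈ Icc (0 : ℝ) 1, ∀ t ∈ Icc (0 : ℝ) 1, ∀ p, ∃ q, e q = Φ s t (e p) :=
    fun s hs t ht p => trajectory_mem_range he hemb hinj hG htan'
      (Z := fun t => Φ s t (e p)) (fun t ht => hΦode s hs t ht (e p)) hs
      ⟨p, (hΦ0 s hs _).symm⟩ t ht
  choose! χ hχ using hmem
  -- Flowing back from time `t` to time `s` inverts the flow from `s` to `t`. Since both are smooth,
  -- this yields diffeomorphisms without an inverse function argument.
  have hback : ∀ s ∈ Icc (0 : ℝ) 1, ∀ t ∈ Icc (0 : ℝ) 1, ∀ z, Φ t s (Φ s t z) = z := by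
    intro s hs t ht z
    have := ode_unique (v := fun r x => G (r, x)) hlip ht
      (fun r hr => hΦode t ht r hr (Φ s t z)) (fun r hr => hΦode s hs r hr z)
      (hΦ0 t ht _) hs
    exact this.trans (hΦ0 s hs z)
  have hleft : ∀ s ∈ Icc (0 : ℝ) 1, ∀ t ∈ Icc (0 : ℝ) 1, ∀ p, χ t s (χ s t p) = p := by
    intro s hs t ht p
    apply hemb.injective
    rw [hχ t ht s hs, hχ s hs t ht, hback s hs t ht]
  have hsm : ∀ s ∈ Icc (0 : ℝ) 1, ContMDiffOn (𝓘(ℝ, ℝ).prod (𝓡 m)) (𝓡 m) ∞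
      (fun q : ℝ × M => χ s q.1 q.2) (Icc (0 : ℝ) 1 ×ˢ univ) := by
    intro s hs q hq
    refine contMDiffWithinAt_of_comp_embedding he hemb.isEmbedding hinj ?_
    have h1 : ContMDiffOn (𝓘(ℝ, ℝ).prod (𝓡 m)) 𝓘(ℝ, F) ∞
        (fun q : ℝ × M => Φ s q.1 (e q.2)) (Icc (0 : ℝ) 1 ×ˢ univ) :=
      (contMDiffOn_prod_self_iff.2 (hΦs s hs)).comp
        (contMDiffOn_fst.prodMk (he.comp_contMDiffOn contMDiffOn_snd)) (fun q hq => ⟨hq.1, trivial⟩)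
    exact (h1 q hq).congr (fun q' hq' => hχ s hs q'.1 hq'.1 q'.2) (hχ s hs q.1 hq.1 q.2)
  have hsmt : ∀ s ∈ Icc (0 : ℝ) 1, ∀ t ∈ Icc (0 : ℝ) 1,
      ContMDiff (𝓡 m) (𝓡 m) ∞ (χ s t) := by
    intro s hs t ht
    rw [← contMDiffOn_univ]
    exact (hsm s hs).comp (f := fun p => (t, p)) (contMDiffOn_const.prodMk contMDiffOn_id)
      (fun p _ => ⟨ht, trivial⟩)
  have h0 : (0 : ℝ) ∈ Icc (0 : ℝ) 1 := ⟨le_rfl, zero_le_one⟩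
  let D : ∀ t ∈ Icc (0 : ℝ) 1, M ≃ₘ^∞⟮𝓡 m, 𝓡 m⟯ M := fun t ht =>
    { toFun := χ 0 t
      invFun := χ t 0
      left_inv := hleft 0 h0 t ht
      right_inv := hleft t ht 0 h0
      contMDiff_toFun := hsmt 0 h0 t ht
      contMDiff_invFun := hsmt t ht 0 h0 }
  classical
  -- Outside `[0,1]` the value is the identity, which plays no role.
  let ψ : ℝ → M ≃ₘ^∞⟮𝓡 m, 𝓡 m⟯ M := fun t =>
    if ht : t ∈ Icc (0 : ℝ) 1 then D t ht else Diffeomorph.refl (𝓡 m) M ∞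
  have hψ : ∀ t ∈ Icc (0 : ℝ) 1, ∀ p, ψ t p = χ 0 t p := by
    intro t ht p
    simp only [ψ, dif_pos ht]
    rfl
  have heψ : ∀ t ∈ Icc (0 : ℝ) 1, ∀ p, e (ψ t p) = Φ 0 t (e p) := by
    intro t ht p
    rw [hψ t ht, hχ 0 h0 t ht]
  refine ⟨ψ, ⟨(hsm 0 h0).congr fun q hq => hψ q.1 hq.1 q.2, fun p => ?_⟩, fun t ht p => ?_⟩
  · apply hemb.injective
    rw [heψ 0 h0, hΦ0 0 h0]
  · have h1 := hΦode 0 h0 t ht (e p)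
    rw [← heψ t ht p, hGV] at h1
    exact h1.congr (fun s hs => heψ s hs p) (heψ t ht p)

end Isotopy

/-! ### Smoothness of 1-forms in coordinates -/

section LocalForm

variable {m : ℕ} {M : Type*} [TopologicalSpace M] [ChartedSpace (Model m) M]
  [IsManifold (𝓡 m) ∞ M]

/-- A section of the cotangent bundle is smooth when its expression in the trivialisation at `p₀`
is, and that expression is `localForm`, since the tangent trivialisation is inverted by the
derivative of the inverse chart. -/
theorem contDiffOn_localForm {α : ℝ → ∀ p : M, TangentSpace (𝓡 m) p →L[ℝ] ℝ} {S : Set (ℝ × M)}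
    (hα : ContMDiffOn (𝓘(ℝ, ℝ).prod (𝓡 m)) ((𝓡 m).prod 𝓘(ℝ, Model m →L[ℝ] ℝ)) ∞
      (fun q : ℝ × M => TotalSpace.mk' (Model m →L[ℝ] ℝ)
        (E := fun p : M => TangentSpace (𝓡 m) p →L[ℝ] ℝ) q.2 (α q.1 q.2)) S) (p₀ : M) :
    ContDiffOn ℝ ∞ (fun q : ℝ × Model m => localForm (α q.1) p₀ q.2)
      {q | q.2 ∈ (extChartAt (𝓡 m) p₀).target ∧ (q.1, (extChartAt (𝓡 m) p₀).symm q.2) ∈ S} := by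
  set φ := extChartAt (𝓡 m) p₀ with hφ
  set S' := {q : ℝ × Model m | q.2 ∈ φ.target ∧ (q.1, φ.symm q.2) ∈ S} with hS'
  have hsymm : ContMDiffOn (𝓘(ℝ, ℝ).prod 𝓘(ℝ, Model m)) (𝓡 m) ∞
      (fun q : ℝ × Model m => φ.symm q.2) S' :=
    (contMDiffOn_extChartAt_symm p₀).comp contMDiffOn_snd (fun q hq => hq.1)
  have h1 : ContMDiffOn (𝓘(ℝ, ℝ).prod 𝓘(ℝ, Model m)) ((𝓡 m).prod 𝓘(ℝ, Model m →L[ℝ] ℝ)) ∞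
      (fun q : ℝ × Model m => TotalSpace.mk' (Model m →L[ℝ] ℝ)
        (E := fun p : M => TangentSpace (𝓡 m) p →L[ℝ] ℝ) (φ.symm q.2) (α q.1 (φ.symm q.2))) S' :=
    hα.comp (f := fun q : ℝ × Model m => (q.1, φ.symm q.2)) (contMDiffOn_fst.prodMk hsymm)
      (fun q hq => hq.2)
  have hsrc : ∀ q ∈ S', φ.symm q.2 ∈ (chartAt (Model m) p₀).source := by
    intro q hq
    have := φ.map_target hq.1
    rwa [hφ, extChartAt_source] at this
  have h2 := ((trivializationAt (Model m →L[ℝ] ℝ)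
    (fun p : M => TangentSpace (𝓡 m) p →L[ℝ] ℝ) p₀).contMDiffOn_iff (fun q hq => by
      rw [Trivialization.mem_source]
      erw [hom_trivializationAt_baseSet]
      exact ⟨hsrc q hq, trivial⟩)).1 h1
  rw [← contMDiffOn_prod_self_iff]
  refine h2.2.congr fun q hq => ?_
  ext1 v
  have h3 := TangentBundle.symmL_trivializationAt (I := 𝓡 m) (hsrc q hq)
  rw [ModelWithCorners.range_eq_univ, mfderivWithin_univ, ← hφ, φ.right_inv hq.1] at h3
  simp only [localForm]
  erw [hom_trivializationAt_apply]
  simp only [ContinuousLinearMap.inCoordinates]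
  have h4 : Trivialization.continuousLinearMapAt ℝ
      (trivializationAt ℝ (Bundle.Trivial M ℝ) p₀) (φ.symm q.2) =
      ContinuousLinearMap.id ℝ ℝ := Bundle.Trivial.continuousLinearMapAt_trivialization ℝ M ℝ _
  rw [h3]
  exact (congrArg (fun T : ℝ →L[ℝ] ℝ => T (localForm (α q.1) p₀ q.2 v)) h4).symm

theorem differentiableAt_localForm {α : ∀ p : M, TangentSpace (𝓡 m) p →L[ℝ] ℝ}
    (hα : ContMDiff (𝓡 m) ((𝓡 m).prod 𝓘(ℝ, Model m →L[ℝ] ℝ)) ∞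
      (fun p : M => TotalSpace.mk' (Model m →L[ℝ] ℝ)
        (E := fun p : M => TangentSpace (𝓡 m) p →L[ℝ] ℝ) p (α p))) (p₀ : M) {y : Model m}
    (hy : y ∈ (extChartAt (𝓡 m) p₀).target) : DifferentiableAt ℝ (localForm α p₀) y := by
  have h1 := contDiffOn_localForm (α := fun _ => α) (S := univ)
    (hα.comp_contMDiffOn contMDiffOn_snd) p₀
  have h2 : ContDiffOn ℝ ∞ (localForm α p₀) (extChartAt (𝓡 m) p₀).target :=
    h1.comp (f := fun z : Model m => ((0 : ℝ), z)) (by fun_prop) (fun z hz => ⟨hz, trivial⟩)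
  exact (h2.contDiffAt ((isOpen_extChartAt_target p₀).mem_nhds hy)).differentiableAt (by simp)

end LocalForm

/-! ### Coordinate changes -/

section Transition

variable {m : ℕ} {M : Type*} [TopologicalSpace M] [ChartedSpace (Model m) M]

/-- The coordinate change from the preferred chart at `p₁` to the one at `p₀`. -/
def transition (m : ℕ) {M : Type*} [TopologicalSpace M] [ChartedSpace (Model m) M] (p₀ p₁ : M) :
    Model m → Model m :=
  extChartAt (𝓡 m) p₀ ∘ (extChartAt (𝓡 m) p₁).symm

variable {p₀ p₁ : M} {y : Model m}

theorem eventually_mem_transition_source (hy : y ∈ (extChartAt (𝓡 m) p₁).target)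
    (hy' : (extChartAt (𝓡 m) p₁).symm y ∈ (extChartAt (𝓡 m) p₀).source) :
    ∀ᶠ z in 𝓝 y, z ∈ (extChartAt (𝓡 m) p₁).target ∧
      (extChartAt (𝓡 m) p₁).symm z ∈ (extChartAt (𝓡 m) p₀).source :=
  Filter.inter_mem ((isOpen_extChartAt_target p₁).mem_nhds hy)
    (continuousAt_extChartAt_symm'' hy ((isOpen_extChartAt_source p₀).mem_nhds hy'))

theorem extChartAt_symm_transition
    (hy' : (extChartAt (𝓡 m) p₁).symm y ∈ (extChartAt (𝓡 m) p₀).source) :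
    (extChartAt (𝓡 m) p₀).symm (transition m p₀ p₁ y) = (extChartAt (𝓡 m) p₁).symm y :=
  (extChartAt (𝓡 m) p₀).left_inv hy'

variable [IsManifold (𝓡 m) ∞ M]

theorem contDiffAt_transition (hy : y ∈ (extChartAt (𝓡 m) p₁).target)
    (hy' : (extChartAt (𝓡 m) p₁).symm y ∈ (extChartAt (𝓡 m) p₀).source) :
    ContDiffAt ℝ ∞ (transition m p₀ p₁) y := by
  rw [← contMDiffAt_iff_contDiffAt]
  refine (contMDiffAt_extChartAt' ?_).comp y
    ((contMDiffOn_extChartAt_symm p₁ y hy).contMDiffAt ((isOpen_extChartAt_target p₁).mem_nhds hy))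
  rwa [extChartAt_source] at hy'

theorem mdifferentiableAt_extChartAt_symm' (hy : y ∈ (extChartAt (𝓡 m) p₁).target) :
    MDifferentiableAt 𝓘(ℝ, Model m) (𝓡 m) (extChartAt (𝓡 m) p₁).symm y :=
  ((contMDiffOn_extChartAt_symm p₁ y hy).contMDiffAt
    ((isOpen_extChartAt_target p₁).mem_nhds hy) : ContMDiffAt _ _ ∞ _ _).mdifferentiableAt (by simp)

theorem mfderiv_extChartAt_symm_transition (hy : y ∈ (extChartAt (𝓡 m) p₁).target)
    (hy' : (extChartAt (𝓡 m) p₁).symm y ∈ (extChartAt (𝓡 m) p₀).source) (v : Model m) :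
    (mfderiv 𝓘(ℝ, Model m) (𝓡 m) (extChartAt (𝓡 m) p₁).symm y v : Model m) =
      mfderiv 𝓘(ℝ, Model m) (𝓡 m) (extChartAt (𝓡 m) p₀).symm (transition m p₀ p₁ y)
        (fderiv ℝ (transition m p₀ p₁) y v) := by
  have hg : MDifferentiableAt 𝓘(ℝ, Model m) 𝓘(ℝ, Model m) (transition m p₀ p₁) y :=
    ((contDiffAt_transition hy hy').differentiableAt (by simp)).mdifferentiableAt
  have hs := mdifferentiableAt_extChartAt_symm' (p₁ := p₀) (y := transition m p₀ p₁ y)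
    ((extChartAt (𝓡 m) p₀).map_source hy')
  have h1 := hs.hasMFDerivAt.comp y hg.hasMFDerivAt
  have h2 : HasMFDerivAt 𝓘(ℝ, Model m) (𝓡 m) (extChartAt (𝓡 m) p₁).symm y
      ((mfderiv 𝓘(ℝ, Model m) (𝓡 m) (extChartAt (𝓡 m) p₀).symm (transition m p₀ p₁ y)).comp
        (mfderiv 𝓘(ℝ, Model m) 𝓘(ℝ, Model m) (transition m p₀ p₁) y)) := by
    refine h1.congr_of_eventuallyEq ?_
    filter_upwards [eventually_mem_transition_source hy hy'] with z hz
    exact (extChartAt_symm_transition hz.2).symm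
  rw [h2.mfderiv, mfderiv_eq_fderiv]
  rfl

theorem surjective_fderiv_transition (hy : y ∈ (extChartAt (𝓡 m) p₁).target)
    (hy' : (extChartAt (𝓡 m) p₁).symm y ∈ (extChartAt (𝓡 m) p₀).source) :
    Function.Surjective (fderiv ℝ (transition m p₀ p₁) y) := by
  intro w
  obtain ⟨v, hv⟩ := (isInvertible_mfderiv_extChartAt_symm p₁ hy).surjective
    (mfderiv 𝓘(ℝ, Model m) (𝓡 m) (extChartAt (𝓡 m) p₀).symm (transition m p₀ p₁ y) w : Model m)
  refine ⟨v, (isInvertible_mfderiv_extChartAt_symm p₀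
    ((extChartAt (𝓡 m) p₀).map_source hy')).injective ?_⟩
  exact (mfderiv_extChartAt_symm_transition hy hy' v).symm.trans hv

theorem mfderiv_extChartAt_symm_mem_iff (hy : y ∈ (extChartAt (𝓡 m) p₁).target)
    (hy' : (extChartAt (𝓡 m) p₁).symm y ∈ (extChartAt (𝓡 m) p₀).source) (v : Model m)
    (ξ : ∀ p : M, Submodule ℝ (TangentSpace (𝓡 m) p)) :
    mfderiv 𝓘(ℝ, Model m) (𝓡 m) (extChartAt (𝓡 m) p₁).symm y v ∈
        ξ ((extChartAt (𝓡 m) p₁).symm y) ↔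
      mfderiv 𝓘(ℝ, Model m) (𝓡 m) (extChartAt (𝓡 m) p₀).symm (transition m p₀ p₁ y)
        (fderiv ℝ (transition m p₀ p₁) y v) ∈
        ξ ((extChartAt (𝓡 m) p₀).symm (transition m p₀ p₁ y)) := by
  -- All tangent spaces have the same underlying space `Model m`, so vectors over equal base points
  -- can be compared there. The same device recurs below.
  have hcast : ∀ p q : M, p = q → ∀ u w : Model m, u = w →
      ((u : TangentSpace (𝓡 m) p) ∈ ξ p ↔ (w : TangentSpace (𝓡 m) q) ∈ ξ q) := by
    rintro p _ rfl u _ rfl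
    exact Iff.rfl
  exact hcast _ _ (extChartAt_symm_transition hy').symm _ _
    (mfderiv_extChartAt_symm_transition hy hy' v)

end Transition

/-! ### From the wedge condition to nondegeneracy in coordinates -/

section Nondegeneracy

variable {n : ℕ} {M : Type*} [TopologicalSpace M] [ChartedSpace (Model (2 * n + 1)) M]
  [IsManifold (𝓡 (2 * n + 1)) ∞ M]

/-- This fixes the sign and normalisation of `dα`: no factor `1/2` appears. -/
theorem extDeriv_ofSubsingleton {E : Type*} [NormedAddCommGroup E] [NormedSpace ℝ E]
    {a : E → E →L[ℝ] ℝ} {x : E} (ha : DifferentiableAt ℝ a x) (v w : E) :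
    extDeriv (fun y => ContinuousAlternatingMap.ofSubsingleton ℝ E ℝ (0 : Fin 1) (a y)) x ![v, w] =
      fderiv ℝ a x v w - fderiv ℝ a x w v := by
  have hd : DifferentiableAt ℝ
      (fun y => ContinuousAlternatingMap.ofSubsingleton ℝ E ℝ (0 : Fin 1) (a y)) x :=
    (ContinuousAlternatingMap.ofSubsingletonLIE (0 : Fin 1) :
      (E →L[ℝ] ℝ) ≃ₗᵢ[ℝ] (E [⋀^Fin 1]→L[ℝ] ℝ)).differentiableAt.comp x ha
  have h1 : ∀ u₁ u₂ : E, fderiv ℝ (fun y => a y u₁) x u₂ = fderiv ℝ a x u₂ u₁ := fun u₁ u₂ => by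
    rw [fderiv_clm_apply ha (differentiableAt_const u₁)]
    simp
  rw [extDeriv_apply hd, Fin.sum_univ_two]
  simp [Fin.removeNth, h1, sub_eq_add_neg]

/-- The tangent space at `p` is identified with `Model m` through the preferred chart at `p`, so the
derivative of that chart at `p` is the identity. -/
theorem extDerivForm_apply {m : ℕ} {M : Type*} [TopologicalSpace M] [ChartedSpace (Model m) M]
    [IsManifold (𝓡 m) ∞ M] {α : ∀ p : M, TangentSpace (𝓡 m) p →L[ℝ] ℝ} {p : M}
    (hα : DifferentiableAt ℝ (localForm α p) (extChartAt (𝓡 m) p p)) (v w : Model m) :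
    extDerivForm α p v w = fderiv ℝ (localForm α p) (extChartAt (𝓡 m) p p) v w -
      fderiv ℝ (localForm α p) (extChartAt (𝓡 m) p p) w v := by
  have h1 : ∀ v : Model m, (mfderiv (𝓡 m) 𝓘(ℝ, Model m) (extChartAt (𝓡 m) p) p v : Model m) = v :=
    fun v => by rw [mfderiv_extChartAt_self]; rfl
  have h2 := extDeriv_ofSubsingleton hα v w
  have h3 : (![mfderiv (𝓡 m) 𝓘(ℝ, Model m) (extChartAt (𝓡 m) p) p v,
      mfderiv (𝓡 m) 𝓘(ℝ, Model m) (extChartAt (𝓡 m) p) p w] : Fin 2 → Model m) = ![v, w] :=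
    congrArg₂ (fun a b : Model m => ![a, b]) (h1 v) (h1 w)
  rw [← h3] at h2
  exact h2

theorem localForm_self {m : ℕ} {M : Type*} [TopologicalSpace M] [ChartedSpace (Model m) M]
    [IsManifold (𝓡 m) ∞ M] (α : ∀ p : M, TangentSpace (𝓡 m) p →L[ℝ] ℝ) (p : M) (v : Model m) :
    localForm α p (extChartAt (𝓡 m) p p) v = α p v := by
  have h1 : (mfderiv 𝓘(ℝ, Model m) (𝓡 m) (extChartAt (𝓡 m) p).symm
      (extChartAt (𝓡 m) p p) v : Model m) = v := by
    have := mfderivWithin_range_extChartAt_symm (I := 𝓡 m) (x := p)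
    rw [ModelWithCorners.range_eq_univ, mfderivWithin_univ] at this
    rw [this]; rfl
  have hcast : ∀ q : M, q = p → ∀ u : Model m, u = v → α q u = α p v := by
    rintro _ rfl _ rfl; rfl
  exact hcast _ (extChartAt_to_inv p) _ h1

/-- Only the centre of the preferred chart is treated, where all identifications are the identity.
Other points follow by pull-back. -/
theorem IsContactForm.nondeg {α : ∀ p : M, TangentSpace (𝓡 (2 * n + 1)) p →L[ℝ] ℝ}
    (hα : IsContactForm α) (p : M) :
    Nondeg (fderiv ℝ (localForm α p) (extChartAt (𝓡 (2 * n + 1)) p p))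
      (localForm α p (extChartAt (𝓡 (2 * n + 1)) p p)) := by
  rintro x ⟨hx, μ, hμ⟩
  obtain ⟨v, hv⟩ := hα.nondegenerate p
  have hd := differentiableAt_localForm hα.smooth p (mem_extChartAt_target p)
  set D := fderiv ℝ (localForm α p) (extChartAt (𝓡 (2 * n + 1)) p p) with hD
  refine eq_zero_of_wedgePow_ne_zero n (V := Model (2 * n + 1)) (by simp)
    (localForm α p (extChartAt (𝓡 (2 * n + 1)) p p) : Model (2 * n + 1) →ₗ[ℝ] ℝ)
    (LinearMap.mk₂ ℝ (fun v w => D v w - D w v)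
      (by intros; simp only [map_add, add_apply]; ring)
      (by intros; simp only [map_smul, smul_apply, smul_eq_mul]; ring)
      (by intros; simp only [map_add, add_apply]; ring)
      (by intros; simp only [map_smul, smul_apply, smul_eq_mul]; ring))
    (fun v w => by simp) (v := v) (x := x) (c := μ) ?_ hx (fun w => by simpa using hμ w)
  have h1 : ∀ w : Model (2 * n + 1), localForm α p (extChartAt (𝓡 (2 * n + 1)) p p) w = α p w :=
    localForm_self α p
  have h2 : ∀ w₁ w₂ : Model (2 * n + 1), D w₁ w₂ - D w₂ w₁ = extDerivForm α p w₁ w₂ :=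
    fun w₁ w₂ => (extDerivForm_apply hd w₁ w₂).symm
  have h3 := congrArg₂ (fun a b => wedgePow (V := Model (2 * n + 1)) n a b v)
    (funext h1) (funext₂ h2)
  exact fun h => hv (h3.symm.trans h)

end Nondegeneracy

/-! ### Local solutions of the Gray equation in charts -/

section GrayChart

variable {n : ℕ} {M : Type*} [TopologicalSpace M] [ChartedSpace (Model (2 * n + 1)) M]

/-- Local data for the construction of the isotopy in the preferred chart at `p₀`: a smooth family
`A` of forms defining `ξ`, and the solution `x`, `μ` of the equations
`A x = 0`, `ι_x dA + ∂A/∂t = μ A`. -/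
structure GrayChart (ξ : ℝ → ∀ p : M, Submodule ℝ (TangentSpace (𝓡 (2 * n + 1)) p)) (p₀ : M)
    (O : Set (ℝ × Model (2 * n + 1)))
    (A : ℝ × Model (2 * n + 1) → Model (2 * n + 1) →L[ℝ] ℝ)
    (x : ℝ × Model (2 * n + 1) → Model (2 * n + 1)) (μ : ℝ × Model (2 * n + 1) → ℝ) : Prop where
  isOpen : IsOpen O
  mem_target : ∀ q ∈ O, q.2 ∈ (extChartAt (𝓡 (2 * n + 1)) p₀).target
  contDiffOn_form : ContDiffOn ℝ ∞ A (slab (Model (2 * n + 1)) ∩ O)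
  contDiffOn_field : ContDiffOn ℝ ∞ x (slab (Model (2 * n + 1)) ∩ O)
  contDiffOn_factor : ContDiffOn ℝ ∞ μ (slab (Model (2 * n + 1)) ∩ O)
  form_ne_zero : ∀ q ∈ slab (Model (2 * n + 1)) ∩ O, A q ≠ 0
  form_apply_eq_zero_iff : ∀ q ∈ slab (Model (2 * n + 1)) ∩ O, ∀ v, A q v = 0 ↔
    mfderiv 𝓘(ℝ, Model (2 * n + 1)) (𝓡 (2 * n + 1)) (extChartAt (𝓡 (2 * n + 1)) p₀).symm q.2 v ∈
      ξ q.1 ((extChartAt (𝓡 (2 * n + 1)) p₀).symm q.2)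
  nondeg : ∀ q ∈ slab (Model (2 * n + 1)) ∩ O,
    Nondeg ((fderivWithin ℝ A (slab (Model (2 * n + 1))) q).comp
      (ContinuousLinearMap.inr ℝ ℝ (Model (2 * n + 1)))) (A q)
  equation : ∀ q ∈ slab (Model (2 * n + 1)) ∩ O, A q (x q) = 0 ∧ ∀ w,
    fderivWithin ℝ A (slab (Model (2 * n + 1))) q (1, x q) w -
      fderivWithin ℝ A (slab (Model (2 * n + 1))) q (0, w) (x q) = μ q * A q w

variable [IsManifold (𝓡 (2 * n + 1)) ∞ M]
  {ξ : ℝ → ∀ p : M, Submodule ℝ (TangentSpace (𝓡 (2 * n + 1)) p)}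

theorem IsSmoothHyperplaneFamily.exists_local_form (hξ : IsSmoothHyperplaneFamily ξ) {t₀ : ℝ}
    (ht₀ : t₀ ∈ Icc (0 : ℝ) 1) (p₀ : M) :
    ∃ (O : Set (ℝ × Model (2 * n + 1))) (A : ℝ × Model (2 * n + 1) → Model (2 * n + 1) →L[ℝ] ℝ),
      IsOpen O ∧ (t₀, extChartAt (𝓡 (2 * n + 1)) p₀ p₀) ∈ O ∧
      (∀ q ∈ O, q.2 ∈ (extChartAt (𝓡 (2 * n + 1)) p₀).target) ∧
      ContDiffOn ℝ ∞ A (slab (Model (2 * n + 1)) ∩ O) ∧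
      (∀ q ∈ slab (Model (2 * n + 1)) ∩ O, A q ≠ 0) ∧
      ∀ q ∈ slab (Model (2 * n + 1)) ∩ O, ∀ v, A q v = 0 ↔
        mfderiv 𝓘(ℝ, Model (2 * n + 1)) (𝓡 (2 * n + 1)) (extChartAt (𝓡 (2 * n + 1)) p₀).symm
          q.2 v ∈ ξ q.1 ((extChartAt (𝓡 (2 * n + 1)) p₀).symm q.2) := by
  obtain ⟨U, hU, hm, α, hα, hker⟩ := hξ t₀ ht₀ p₀
  set φ := extChartAt (𝓡 (2 * n + 1)) p₀ with hφ
  have hcont : ContinuousOn (fun q : ℝ × Model (2 * n + 1) => (q.1, φ.symm q.2))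
      (univ ×ˢ φ.target) :=
    continuousOn_fst.prodMk ((continuousOn_extChartAt_symm p₀).comp continuousOn_snd
      (fun q hq => hq.2))
  refine ⟨(univ ×ˢ φ.target) ∩ (fun q : ℝ × Model (2 * n + 1) => (q.1, φ.symm q.2)) ⁻¹' U,
    fun q => localForm (α q.1) p₀ q.2,
    hcont.isOpen_inter_preimage (isOpen_univ.prod (isOpen_extChartAt_target p₀)) hU,
    ⟨⟨trivial, mem_extChartAt_target p₀⟩, ?_⟩, fun q hq => hq.1.2,
    (contDiffOn_localForm hα p₀).mono ?_, ?_, ?_⟩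
  · simpa [hφ] using hm
  · exact fun q hq => ⟨hq.2.1.2, hq.2.2, hq.1.1, trivial⟩
  · intro q hq h0
    refine (hker q.1 hq.1.1 _ hq.2.2).1 ?_
    ext1 w
    obtain ⟨v, rfl⟩ := (isInvertible_mfderiv_extChartAt_symm p₀ hq.2.1.2).surjective w
    exact congrArg (fun T : Model (2 * n + 1) →L[ℝ] ℝ => T v) h0
  · intro q hq v
    rw [(hker q.1 hq.1.1 _ hq.2.2).2, LinearMap.mem_ker]
    rfl

/-- Nondegeneracy depends only on the kernel and not on the chart. It is pulled back from the local
form `A (t, ·)` at `y` to a global contact form of `ξ t` in the chart centred at the corresponding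
point `p`, where `IsContactForm.nondeg` applies. -/
theorem IsContactStructure.nondeg {t : ℝ} (hc : IsContactStructure (ξ t)) {p₀ : M}
    {O : Set (ℝ × Model (2 * n + 1))} {A : ℝ × Model (2 * n + 1) → Model (2 * n + 1) →L[ℝ] ℝ}
    (hO : IsOpen O) (hOt : ∀ q ∈ O, q.2 ∈ (extChartAt (𝓡 (2 * n + 1)) p₀).target)
    (hA : ContDiffOn ℝ ∞ A (slab (Model (2 * n + 1)) ∩ O))
    (hne : ∀ q ∈ slab (Model (2 * n + 1)) ∩ O, A q ≠ 0)
    (hker : ∀ q ∈ slab (Model (2 * n + 1)) ∩ O, ∀ v, A q v = 0 ↔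
        mfderiv 𝓘(ℝ, Model (2 * n + 1)) (𝓡 (2 * n + 1)) (extChartAt (𝓡 (2 * n + 1)) p₀).symm
          q.2 v ∈ ξ q.1 ((extChartAt (𝓡 (2 * n + 1)) p₀).symm q.2))
    {y : Model (2 * n + 1)} (hq : (t, y) ∈ slab (Model (2 * n + 1)) ∩ O) :
    Nondeg ((fderivWithin ℝ A (slab (Model (2 * n + 1))) (t, y)).comp
      (ContinuousLinearMap.inr ℝ ℝ (Model (2 * n + 1)))) (A (t, y)) := by
  obtain ⟨α, hα, hξα⟩ := hc
  have hy := hOt _ hq.2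
  simp only at hy
  set p := (extChartAt (𝓡 (2 * n + 1)) p₀).symm y with hp
  have hps : p ∈ (extChartAt (𝓡 (2 * n + 1)) p₀).source :=
    (extChartAt (𝓡 (2 * n + 1)) p₀).map_target hy
  set y' := extChartAt (𝓡 (2 * n + 1)) p p with hy'
  have hy't : y' ∈ (extChartAt (𝓡 (2 * n + 1)) p).target := mem_extChartAt_target p
  have hy'p : (extChartAt (𝓡 (2 * n + 1)) p).symm y' = p := extChartAt_to_inv p
  have hy's : (extChartAt (𝓡 (2 * n + 1)) p).symm y' ∈
      (extChartAt (𝓡 (2 * n + 1)) p₀).source := by rwa [hy'p]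
  have hgy : transition (2 * n + 1) p₀ p y' = y := by
    change extChartAt (𝓡 (2 * n + 1)) p₀ ((extChartAt (𝓡 (2 * n + 1)) p).symm y') = y
    rw [hy'p, hp, (extChartAt (𝓡 (2 * n + 1)) p₀).right_inv hy]
  have hgs := contDiffAt_transition hy't hy's
  have hslice := hasFDerivAt_slice (mem_slab.1 hq.1) (hasFDerivWithinAt_slab hO hA hq)
  intro x hx
  obtain ⟨x', rfl⟩ := surjective_fderiv_transition hy't hy's x
  have key : GrayRel (fderiv ℝ (localForm α p) y') (localForm α p y')
      (ContinuousLinearMap.id ℝ (Model (2 * n + 1))) x' x' := by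
    refine GrayRel.pullback (A := fun z => A (t, z)) (g := transition (2 * n + 1) p₀ p) ?_
      (differentiableAt_localForm hα.smooth p hy't) ?_ hgs ?_ ?_
    · rw [hgy, hslice.fderiv]
      exact hx
    · rw [hgy]
      exact hslice.differentiableAt
    · have hc : ContinuousAt (fun z => (t, transition (2 * n + 1) p₀ p z)) y' :=
        continuousAt_const.prodMk hgs.continuousAt
      have hmem : ∀ᶠ z in 𝓝 y', (t, transition (2 * n + 1) p₀ p z) ∈ O :=
        hc (hO.mem_nhds (by beta_reduce; rw [hgy]; exact hq.2))
      filter_upwards [hmem, eventually_mem_transition_source hy't hy's] with z hz hzs v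
      rw [hker (t, transition (2 * n + 1) p₀ p z) ⟨mem_slab.2 hq.1.1, hz⟩,
        ← mfderiv_extChartAt_symm_mem_iff hzs.1 hzs.2 v (ξ t), hξα, LinearMap.mem_ker]
      rfl
    · by_contra! h
      refine hne _ hq ?_
      ext1 w
      obtain ⟨u, rfl⟩ := surjective_fderiv_transition hy't hy's w
      have := h u
      rwa [hgy] at this
  rw [hα.nondeg p x' key, map_zero]

theorem IsSmoothContactFamily.exists_grayChart (hξ : IsSmoothContactFamily ξ) {t₀ : ℝ}
    (ht₀ : t₀ ∈ Icc (0 : ℝ) 1) (p₀ : M) :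
    ∃ O A x μ, GrayChart ξ p₀ O A x μ ∧ (t₀, extChartAt (𝓡 (2 * n + 1)) p₀ p₀) ∈ O := by
  obtain ⟨O, A, hO, hm, hOt, hA, hne, hker⟩ := hξ.smooth.exists_local_form ht₀ p₀
  have hnd : ∀ q ∈ slab (Model (2 * n + 1)) ∩ O,
      Nondeg ((fderivWithin ℝ A (slab (Model (2 * n + 1))) q).comp
        (ContinuousLinearMap.inr ℝ ℝ (Model (2 * n + 1)))) (A q) :=
    fun q hq => (hξ.contact q.1 (mem_slab.1 hq.1)).nondeg hO hOt hA hne hker hq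
  obtain ⟨x, μ, hx, hμ, heq⟩ := exists_smooth_gray hO hA hne hnd
  exact ⟨O, A, x, μ, ⟨hO, hOt, hA, hx, hμ, hne, hker, hnd, heq⟩, hm⟩

/-- The local solutions in two charts define the same tangent vector. -/
theorem GrayChart.fderiv_transition_field {p₀ p₁ : M} {O₀ O₁ : Set (ℝ × Model (2 * n + 1))}
    {A₀ A₁ : ℝ × Model (2 * n + 1) → Model (2 * n + 1) →L[ℝ] ℝ}
    {x₀ x₁ : ℝ × Model (2 * n + 1) → Model (2 * n + 1)} {μ₀ μ₁ : ℝ × Model (2 * n + 1) → ℝ}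
    (h₀ : GrayChart ξ p₀ O₀ A₀ x₀ μ₀) (h₁ : GrayChart ξ p₁ O₁ A₁ x₁ μ₁) {t : ℝ}
    (ht : t ∈ Icc (0 : ℝ) 1) {y : Model (2 * n + 1)} (hy₁ : (t, y) ∈ O₁)
    (hy : (extChartAt (𝓡 (2 * n + 1)) p₁).symm y ∈ (extChartAt (𝓡 (2 * n + 1)) p₀).source)
    (hy₀ : (t, transition (2 * n + 1) p₀ p₁ y) ∈ O₀) :
    fderiv ℝ (transition (2 * n + 1) p₀ p₁) y (x₁ (t, y)) =
      x₀ (t, transition (2 * n + 1) p₀ p₁ y) := by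
  have hyt := h₁.mem_target _ hy₁
  simp only at hyt
  have hq₁ : (t, y) ∈ slab (Model (2 * n + 1)) ∩ O₁ := ⟨mem_slab.2 ht, hy₁⟩
  have hq₀ : (t, transition (2 * n + 1) p₀ p₁ y) ∈ slab (Model (2 * n + 1)) ∩ O₀ :=
    ⟨mem_slab.2 ht, hy₀⟩
  have hgs := contDiffAt_transition hyt hy
  -- The vector `x'` is `x₀` expressed in the chart at `p₁`. By naturality it solves the same
  -- equation there as `x₁`, so uniqueness identifies the two.
  obtain ⟨x', hx'⟩ := surjective_fderiv_transition hyt hy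
    (x₀ (t, transition (2 * n + 1) p₀ p₁ y))
  rw [← hx']
  congr 1
  refine GrayRel.unique (h₁.nondeg _ hq₁)
    ⟨(h₁.equation _ hq₁).1, μ₁ (t, y), (h₁.equation _ hq₁).2⟩ ?_
  refine GrayRel.pullback_slab (A := A₀) (g := transition (2 * n + 1) p₀ p₁) ?_ ht
    (hasFDerivWithinAt_slab h₁.isOpen h₁.contDiffOn_form hq₁).differentiableWithinAt
    (hasFDerivWithinAt_slab h₀.isOpen h₀.contDiffOn_form hq₀).differentiableWithinAt hgs ?_ ?_
  · rw [hx']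
    exact ⟨(h₀.equation _ hq₀).1, _, (h₀.equation _ hq₀).2⟩
  · have hc : ContinuousAt (fun q : ℝ × Model (2 * n + 1) =>
        (q.1, transition (2 * n + 1) p₀ p₁ q.2)) (t, y) :=
      continuousAt_fst.prodMk (ContinuousAt.comp (g := transition (2 * n + 1) p₀ p₁) (f := Prod.snd)
        hgs.continuousAt continuousAt_snd)
    have hs : ∀ᶠ q : ℝ × Model (2 * n + 1) in 𝓝 (t, y), _ :=
      continuousAt_snd.eventually (eventually_mem_transition_source hyt hy)
    filter_upwards [self_mem_nhdsWithin, mem_nhdsWithin_of_mem_nhds (h₁.isOpen.mem_nhds hy₁),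
      mem_nhdsWithin_of_mem_nhds (hc (h₀.isOpen.mem_nhds hy₀)),
      mem_nhdsWithin_of_mem_nhds hs] with q hqs hq₁ hq₀ hq v
    rw [h₁.form_apply_eq_zero_iff _ ⟨hqs, hq₁⟩,
      h₀.form_apply_eq_zero_iff (q.1, transition (2 * n + 1) p₀ p₁ q.2) ⟨mem_slab.2 hqs.1, hq₀⟩]
    exact mfderiv_extChartAt_symm_mem_iff hq.1 hq.2 v (ξ q.1)
  · by_contra! h
    refine h₀.form_ne_zero _ hq₀ ?_
    ext1 w
    obtain ⟨u, rfl⟩ := surjective_fderiv_transition hyt hy w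
    exact h u

end GrayChart

/-! ### The global vector field -/

section GrayField

variable {n : ℕ} {M : Type*} [TopologicalSpace M] [ChartedSpace (Model (2 * n + 1)) M]
  [IsManifold (𝓡 (2 * n + 1)) ∞ M]
  {ξ : ℝ → ∀ p : M, Submodule ℝ (TangentSpace (𝓡 (2 * n + 1)) p)}
  {F : Type} [NormedAddCommGroup F] [NormedSpace ℝ F]

/-- Agreement of the ambient components makes the global field independent of the chosen local data.
-/
theorem GrayChart.fderiv_embedding_field {p₀ p₁ : M} {O₀ O₁ : Set (ℝ × Model (2 * n + 1))}
    {A₀ A₁ : ℝ × Model (2 * n + 1) → Model (2 * n + 1) →L[ℝ] ℝ}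
    {x₀ x₁ : ℝ × Model (2 * n + 1) → Model (2 * n + 1)} {μ₀ μ₁ : ℝ × Model (2 * n + 1) → ℝ}
    (h₀ : GrayChart ξ p₀ O₀ A₀ x₀ μ₀) (h₁ : GrayChart ξ p₁ O₁ A₁ x₁ μ₁) {e : M → F}
    (he : ContMDiff (𝓡 (2 * n + 1)) 𝓘(ℝ, F) ∞ e) {t : ℝ} (ht : t ∈ Icc (0 : ℝ) 1) {p : M}
    (hp₀ : p ∈ (extChartAt (𝓡 (2 * n + 1)) p₀).source)
    (hO₀ : (t, extChartAt (𝓡 (2 * n + 1)) p₀ p) ∈ O₀)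
    (hp₁ : p ∈ (extChartAt (𝓡 (2 * n + 1)) p₁).source)
    (hO₁ : (t, extChartAt (𝓡 (2 * n + 1)) p₁ p) ∈ O₁) :
    fderiv ℝ (e ∘ (extChartAt (𝓡 (2 * n + 1)) p₁).symm) (extChartAt (𝓡 (2 * n + 1)) p₁ p)
        (x₁ (t, extChartAt (𝓡 (2 * n + 1)) p₁ p)) =
      fderiv ℝ (e ∘ (extChartAt (𝓡 (2 * n + 1)) p₀).symm) (extChartAt (𝓡 (2 * n + 1)) p₀ p)
        (x₀ (t, extChartAt (𝓡 (2 * n + 1)) p₀ p)) := by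
  set y := extChartAt (𝓡 (2 * n + 1)) p₁ p with hy
  have hyt : y ∈ (extChartAt (𝓡 (2 * n + 1)) p₁).target :=
    (extChartAt (𝓡 (2 * n + 1)) p₁).map_source hp₁
  have hyp : (extChartAt (𝓡 (2 * n + 1)) p₁).symm y = p :=
    (extChartAt (𝓡 (2 * n + 1)) p₁).left_inv hp₁
  have hys : (extChartAt (𝓡 (2 * n + 1)) p₁).symm y ∈
      (extChartAt (𝓡 (2 * n + 1)) p₀).source := by rwa [hyp]
  have hg : transition (2 * n + 1) p₀ p₁ y = extChartAt (𝓡 (2 * n + 1)) p₀ p :=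
    congrArg (extChartAt (𝓡 (2 * n + 1)) p₀) hyp
  have h := h₀.fderiv_transition_field h₁ ht hO₁ hys (by rw [hg]; exact hO₀)
  rw [hg] at h
  rw [← h]
  have hev : e ∘ (extChartAt (𝓡 (2 * n + 1)) p₁).symm =ᶠ[𝓝 y]
      (e ∘ (extChartAt (𝓡 (2 * n + 1)) p₀).symm) ∘ transition (2 * n + 1) p₀ p₁ := by
    filter_upwards [eventually_mem_transition_source hyt hys] with z hz
    exact congrArg e (extChartAt_symm_transition hz.2).symm
  have hd : DifferentiableAt ℝ (e ∘ (extChartAt (𝓡 (2 * n + 1)) p₀).symm)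
      (transition (2 * n + 1) p₀ p₁ y) :=
    ((contDiffOn_comp_extChartAt_symm he p₀).contDiffAt ((isOpen_extChartAt_target p₀).mem_nhds
      ((extChartAt (𝓡 (2 * n + 1)) p₀).map_source hys))).differentiableAt (by simp)
  rw [hev.fderiv_eq, fderiv_comp y hd
    ((contDiffAt_transition hyt hys).differentiableAt (by simp)), hg]
  rfl

/-- The vector field generating the isotopy, in terms of a map `e` into a vector space. -/
theorem IsSmoothContactFamily.exists_field (hξ : IsSmoothContactFamily ξ) {e : M → F}
    (he : ContMDiff (𝓡 (2 * n + 1)) 𝓘(ℝ, F) ∞ e) :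
    ∃ V : ℝ × M → F,
      ContMDiffOn (𝓘(ℝ, ℝ).prod (𝓡 (2 * n + 1))) 𝓘(ℝ, F) ∞ V (Icc (0 : ℝ) 1 ×ˢ univ) ∧
      (∀ t ∈ Icc (0 : ℝ) 1, ∀ p, V (t, p) ∈ range (mfderiv (𝓡 (2 * n + 1)) 𝓘(ℝ, F) e p)) ∧
      ∀ p₀ O A x μ, GrayChart ξ p₀ O A x μ → ∀ t ∈ Icc (0 : ℝ) 1,
        ∀ p ∈ (extChartAt (𝓡 (2 * n + 1)) p₀).source,
        (t, extChartAt (𝓡 (2 * n + 1)) p₀ p) ∈ O →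
        V (t, p) = fderiv ℝ (e ∘ (extChartAt (𝓡 (2 * n + 1)) p₀).symm)
          (extChartAt (𝓡 (2 * n + 1)) p₀ p) (x (t, extChartAt (𝓡 (2 * n + 1)) p₀ p)) := by
  have hex : ∀ t ∈ Icc (0 : ℝ) 1, ∀ p : M, ∃ O A x μ, GrayChart ξ p O A x μ ∧
      (t, extChartAt (𝓡 (2 * n + 1)) p p) ∈ O := fun t ht p => hξ.exists_grayChart ht p
  choose! O A x μ hc hm using hex
  -- The definition chooses local data separately at each `(t, p)`, with no continuity in the
  -- choice. Smoothness comes from `hloc`, which lets one Gray chart compute `V` on a whole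
  -- neighbourhood.
  set V : ℝ × M → F := fun q => fderiv ℝ (e ∘ (extChartAt (𝓡 (2 * n + 1)) q.2).symm)
    (extChartAt (𝓡 (2 * n + 1)) q.2 q.2)
    (x q.1 q.2 (q.1, extChartAt (𝓡 (2 * n + 1)) q.2 q.2)) with hV
  have hloc : ∀ p₀ O A x μ, GrayChart ξ p₀ O A x μ → ∀ t ∈ Icc (0 : ℝ) 1,
      ∀ p ∈ (extChartAt (𝓡 (2 * n + 1)) p₀).source, (t, extChartAt (𝓡 (2 * n + 1)) p₀ p) ∈ O →
      V (t, p) = fderiv ℝ (e ∘ (extChartAt (𝓡 (2 * n + 1)) p₀).symm)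
        (extChartAt (𝓡 (2 * n + 1)) p₀ p) (x (t, extChartAt (𝓡 (2 * n + 1)) p₀ p)) :=
    fun p₀ O A x μ h t ht p hp hO =>
      h.fderiv_embedding_field (hc t ht p) he ht hp hO (mem_extChartAt_source p) (hm t ht p)
  refine ⟨V, ?_, ?_, hloc⟩
  · rintro ⟨t₀, p₀⟩ ⟨ht₀, -⟩
    have h := hc t₀ ht₀ p₀
    have hW : ContDiffOn ℝ ∞ (fun q : ℝ × Model (2 * n + 1) =>
        fderiv ℝ (e ∘ (extChartAt (𝓡 (2 * n + 1)) p₀).symm) q.2 (x t₀ p₀ q))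
        (slab (Model (2 * n + 1)) ∩ O t₀ p₀) := by
      refine ContDiffOn.clm_apply ?_ h.contDiffOn_field
      exact ((contDiffOn_comp_extChartAt_symm he p₀).fderiv_of_isOpen
        (isOpen_extChartAt_target p₀) (m := ∞) (by simp)).comp contDiff_snd.contDiffOn
        (fun q hq => h.mem_target q hq.2)
    have hN : ContinuousOn (fun q : ℝ × M => (q.1, extChartAt (𝓡 (2 * n + 1)) p₀ q.2))
        (univ ×ˢ (extChartAt (𝓡 (2 * n + 1)) p₀).source) :=
      continuousOn_fst.prodMk ((continuousOn_extChartAt p₀).comp continuousOn_snd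
        (fun q hq => hq.2))
    have hNo := hN.isOpen_inter_preimage
      (isOpen_univ.prod (isOpen_extChartAt_source p₀)) h.isOpen
    set N := (univ ×ˢ (extChartAt (𝓡 (2 * n + 1)) p₀).source) ∩
      (fun q : ℝ × M => (q.1, extChartAt (𝓡 (2 * n + 1)) p₀ q.2)) ⁻¹' O t₀ p₀ with hNdef
    have hNm : (t₀, p₀) ∈ N := ⟨⟨trivial, mem_extChartAt_source p₀⟩, hm t₀ ht₀ p₀⟩
    have hVN : ContMDiffOn (𝓘(ℝ, ℝ).prod (𝓡 (2 * n + 1))) 𝓘(ℝ, F) ∞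
        (fun q : ℝ × M => fderiv ℝ (e ∘ (extChartAt (𝓡 (2 * n + 1)) p₀).symm)
          (extChartAt (𝓡 (2 * n + 1)) p₀ q.2)
          (x t₀ p₀ (q.1, extChartAt (𝓡 (2 * n + 1)) p₀ q.2)))
        ((Icc (0 : ℝ) 1 ×ˢ univ) ∩ N) := by
      refine (contMDiffOn_prod_self_iff.2 hW).comp
        (f := fun q : ℝ × M => (q.1, extChartAt (𝓡 (2 * n + 1)) p₀ q.2))
        (contMDiffOn_fst.prodMk ?_) (fun q hq => ⟨mem_slab.2 hq.1.1, hq.2.2⟩)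
      refine (contMDiffOn_extChartAt (x := p₀)).comp contMDiffOn_snd (fun q hq => ?_)
      have := hq.2.1.2
      rwa [extChartAt_source] at this
    have h1 := (hVN.congr fun q hq => hloc p₀ _ _ _ _ h q.1 hq.1.1 q.2 hq.2.1.2 hq.2.2)
      (t₀, p₀) ⟨⟨ht₀, trivial⟩, hNm⟩
    exact (contMDiffWithinAt_inter (hNo.mem_nhds hNm)).1 h1
  · intro t ht p
    simp only [hV]
    rw [mfderiv_comp_extChartAt_symm he p (mem_extChartAt_target p)]
    have hcast : ∀ q : M, q = p → ∀ u : Model (2 * n + 1),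
        (mfderiv (𝓡 (2 * n + 1)) 𝓘(ℝ, F) e q u : F) ∈
          range (mfderiv (𝓡 (2 * n + 1)) 𝓘(ℝ, F) e p) := by
      rintro _ rfl u
      exact ⟨u, rfl⟩
    exact hcast _ (extChartAt_to_inv p) _

end GrayField

/-! ### Transport of the contact structures by the isotopy -/

section Transport

variable {n : ℕ} {M : Type*} [TopologicalSpace M] [ChartedSpace (Model (2 * n + 1)) M]
  [IsManifold (𝓡 (2 * n + 1)) ∞ M]
  {ξ : ℝ → ∀ p : M, Submodule ℝ (TangentSpace (𝓡 (2 * n + 1)) p)}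
  {F : Type} [NormedAddCommGroup F] [NormedSpace ℝ F]

/-- The coordinate expression of an isotopy in the charts at `p₀` and `p`. -/
def localIsotopy {m : ℕ} {M : Type*} [TopologicalSpace M] [ChartedSpace (Model m) M]
    (ψ : ℝ → M ≃ₘ^∞⟮𝓡 m, 𝓡 m⟯ M) (p₀ p : M) (q : ℝ × Model m) : Model m :=
  extChartAt (𝓡 m) p₀ (ψ q.1 ((extChartAt (𝓡 m) p).symm q.2))

/-- An isotopy maps a neighbourhood of a point into a given open set of a chart domain. -/
theorem IsIsotopy.exists_domain {m : ℕ} {M : Type*} [TopologicalSpace M] [ChartedSpace (Model m) M]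
    [IsManifold (𝓡 m) ∞ M] {ψ : ℝ → M ≃ₘ^∞⟮𝓡 m, 𝓡 m⟯ M} (hψ : IsIsotopy ψ) (p₀ p : M)
    {O : Set (ℝ × Model m)} (hO : IsOpen O) {t₁ : ℝ} (ht₁ : t₁ ∈ Icc (0 : ℝ) 1)
    (hs : ψ t₁ p ∈ (extChartAt (𝓡 m) p₀).source)
    (hm : (t₁, extChartAt (𝓡 m) p₀ (ψ t₁ p)) ∈ O) :
    ∃ U : Set (ℝ × Model m), IsOpen U ∧ (t₁, extChartAt (𝓡 m) p p) ∈ U ∧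
      (∀ q ∈ slab (Model m) ∩ U, q.2 ∈ (extChartAt (𝓡 m) p).target ∧
        ψ q.1 ((extChartAt (𝓡 m) p).symm q.2) ∈ (extChartAt (𝓡 m) p₀).source ∧
        (q.1, localIsotopy ψ p₀ p q) ∈ O) ∧
      ContDiffOn ℝ ∞ (localIsotopy ψ p₀ p) (slab (Model m) ∩ U) := by
  have hΨ : ContMDiffOn (𝓘(ℝ, ℝ).prod 𝓘(ℝ, Model m)) (𝓡 m) ∞
      (fun q : ℝ × Model m => ψ q.1 ((extChartAt (𝓡 m) p).symm q.2))
      (slab (Model m) ∩ univ ×ˢ (extChartAt (𝓡 m) p).target) := by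
    refine hψ.smooth.comp (f := fun q : ℝ × Model m => (q.1, (extChartAt (𝓡 m) p).symm q.2))
      (contMDiffOn_fst.prodMk ?_) (fun q hq => ⟨hq.1.1, trivial⟩)
    exact (contMDiffOn_extChartAt_symm p).comp contMDiffOn_snd (fun q hq => hq.2.2)
  have hN : ContinuousOn (fun q : ℝ × M => (q.1, extChartAt (𝓡 m) p₀ q.2))
      (univ ×ˢ (extChartAt (𝓡 m) p₀).source) :=
    continuousOn_fst.prodMk ((continuousOn_extChartAt p₀).comp continuousOn_snd
      (fun q hq => hq.2))
  have hNo := hN.isOpen_inter_preimage (isOpen_univ.prod (isOpen_extChartAt_source p₀)) hO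
  obtain ⟨U, hU, hUeq⟩ := continuousOn_iff'.1 (continuousOn_fst.prodMk hΨ.continuousOn) _ hNo
  have hTo : IsOpen (univ ×ˢ (extChartAt (𝓡 m) p).target : Set (ℝ × Model m)) :=
    isOpen_univ.prod (isOpen_extChartAt_target p)
  have hgood : ∀ q ∈ slab (Model m) ∩ (U ∩ univ ×ˢ (extChartAt (𝓡 m) p).target),
      q.2 ∈ (extChartAt (𝓡 m) p).target ∧
        ψ q.1 ((extChartAt (𝓡 m) p).symm q.2) ∈ (extChartAt (𝓡 m) p₀).source ∧
        (q.1, localIsotopy ψ p₀ p q) ∈ O := by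
    rintro q ⟨hqs, hqU, hqT⟩
    have : q ∈ U ∩ (slab (Model m) ∩ univ ×ˢ (extChartAt (𝓡 m) p).target) := ⟨hqU, hqs, hqT⟩
    rw [← hUeq] at this
    exact ⟨hqT.2, this.1.1.2, this.1.2⟩
  refine ⟨U ∩ univ ×ˢ (extChartAt (𝓡 m) p).target, hU.inter hTo, ⟨?_, trivial,
    mem_extChartAt_target p⟩, hgood, ?_⟩
  · have h1 : (t₁, extChartAt (𝓡 m) p p) ∈
        U ∩ (slab (Model m) ∩ univ ×ˢ (extChartAt (𝓡 m) p).target) := by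
      rw [← hUeq]
      refine ⟨⟨⟨trivial, ?_⟩, ?_⟩, mem_slab.2 ht₁, trivial, mem_extChartAt_target p⟩
      · simpa using hs
      · simpa using hm
    exact h1.1
  · rw [← contMDiffOn_prod_self_iff]
    refine (contMDiffOn_extChartAt (x := p₀)).comp
      (hΨ.mono (inter_subset_inter_right _ inter_subset_right)) (fun q hq => ?_)
    have := (hgood q hq).2.1
    rwa [extChartAt_source] at this

/-- The derivative of a diffeomorphism in terms of its coordinate expression. -/
theorem mfderiv_eq_of_localIsotopy {m : ℕ} {M : Type*} [TopologicalSpace M]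
    [ChartedSpace (Model m) M] [IsManifold (𝓡 m) ∞ M] {ψ : ℝ → M ≃ₘ^∞⟮𝓡 m, 𝓡 m⟯ M} {p₀ p : M}
    {t : ℝ} {D : Model m →L[ℝ] Model m}
    (hD : HasFDerivAt (fun z => localIsotopy ψ p₀ p (t, z)) D (extChartAt (𝓡 m) p p))
    (hs : ψ t p ∈ (extChartAt (𝓡 m) p₀).source) (v : Model m) :
    (mfderiv (𝓡 m) (𝓡 m) (ψ t) p v : Model m) =
      mfderiv 𝓘(ℝ, Model m) (𝓡 m) (extChartAt (𝓡 m) p₀).symm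
        (localIsotopy ψ p₀ p (t, extChartAt (𝓡 m) p p)) (D v) := by
  set y := extChartAt (𝓡 m) p p with hy
  have hyt : y ∈ (extChartAt (𝓡 m) p).target := mem_extChartAt_target p
  have hyp : (extChartAt (𝓡 m) p).symm y = p := extChartAt_to_inv p
  have hys : ψ t ((extChartAt (𝓡 m) p).symm y) ∈ (extChartAt (𝓡 m) p₀).source := by rwa [hyp]
  have h1 := (mdifferentiableAt_extChartAt_symm' (p₁ := p₀)
    (y := localIsotopy ψ p₀ p (t, y))
    ((extChartAt (𝓡 m) p₀).map_source hys)).hasMFDerivAt.comp y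
      (f := fun z => localIsotopy ψ p₀ p (t, z)) hD.hasMFDerivAt
  have hψd : MDifferentiableAt (𝓡 m) (𝓡 m) (ψ t) ((extChartAt (𝓡 m) p).symm y) :=
    (ψ t).contMDiff.mdifferentiableAt (by simp)
  have h2 := hψd.hasMFDerivAt.comp y (mdifferentiableAt_extChartAt_symm' hyt).hasMFDerivAt
  have hc : ContinuousAt (fun z => ψ t ((extChartAt (𝓡 m) p).symm z)) y :=
    (ψ t).continuous.continuousAt.comp (continuousAt_extChartAt_symm'' hyt)
  have h3 := h2.congr_of_eventuallyEq
    (f₁ := (extChartAt (𝓡 m) p₀).symm ∘ fun z => localIsotopy ψ p₀ p (t, z)) (by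
      filter_upwards [hc ((isOpen_extChartAt_source p₀).mem_nhds hys)] with z hz
      exact (extChartAt (𝓡 m) p₀).left_inv hz)
  have h4 := hasMFDerivAt_unique h1 h3
  have h5 := congrArg (fun T : Model m →L[ℝ] Model m => T v) h4
  have h6 : (mfderiv 𝓘(ℝ, Model m) (𝓡 m) (extChartAt (𝓡 m) p).symm y v : Model m) = v := by
    have := mfderivWithin_range_extChartAt_symm (I := 𝓡 m) (x := p)
    rw [ModelWithCorners.range_eq_univ, mfderivWithin_univ] at this
    rw [hy, this]; rfl
  have hcast : ∀ q : M, q = p → ∀ u : Model m, u = v →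
      (mfderiv (𝓡 m) (𝓡 m) (ψ t) q u : Model m) = mfderiv (𝓡 m) (𝓡 m) (ψ t) p v := by
    rintro _ rfl _ rfl; rfl
  exact (hcast _ hyp _ h6).symm.trans h5.symm

/-- In a chart, an isotopy that integrates the vector field `V` satisfies the corresponding
differential equation. -/
theorem fderivWithin_localIsotopy {m : ℕ} {M : Type*} [TopologicalSpace M]
    [ChartedSpace (Model m) M] [IsManifold (𝓡 m) ∞ M] {ψ : ℝ → M ≃ₘ^∞⟮𝓡 m, 𝓡 m⟯ M} {p₀ p : M}
    {e : M → F} (he : ContMDiff (𝓡 m) 𝓘(ℝ, F) ∞ e)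
    (hinj : ∀ p, Function.Injective (mfderiv (𝓡 m) 𝓘(ℝ, F) e p)) {U : Set (ℝ × Model m)}
    (hU : IsOpen U) (hUs : ∀ q ∈ slab (Model m) ∩ U,
      ψ q.1 ((extChartAt (𝓡 m) p).symm q.2) ∈ (extChartAt (𝓡 m) p₀).source)
    (hF : ContDiffOn ℝ ∞ (localIsotopy ψ p₀ p) (slab (Model m) ∩ U)) {q : ℝ × Model m}
    (hq : q ∈ slab (Model m) ∩ U) {x : Model m}
    (hx : HasDerivWithinAt (fun s => e (ψ s ((extChartAt (𝓡 m) p).symm q.2)))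
      (fderiv ℝ (e ∘ (extChartAt (𝓡 m) p₀).symm) (localIsotopy ψ p₀ p q) x) (Icc 0 1) q.1) :
    fderivWithin ℝ (localIsotopy ψ p₀ p) (slab (Model m)) q (1, 0) = x := by
  obtain ⟨t, z⟩ := q
  have ht : t ∈ Icc (0 : ℝ) 1 := hq.1.1
  have hyt : localIsotopy ψ p₀ p (t, z) ∈ (extChartAt (𝓡 m) p₀).target :=
    (extChartAt (𝓡 m) p₀).map_source (hUs _ hq)
  have hγ : HasDerivWithinAt (fun s : ℝ => (s, z)) ((1 : ℝ), (0 : Model m)) (Icc 0 1) t :=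
    (hasDerivWithinAt_id t _).prodMk (hasDerivWithinAt_const t _ z)
  have hl : HasFDerivWithinAt (localIsotopy ψ p₀ p)
      (fderivWithin ℝ (localIsotopy ψ p₀ p) (slab (Model m)) (t, z)) (slab (Model m)) (t, z) :=
    hasFDerivWithinAt_slab hU hF hq
  have hcomp := hl.comp_hasDerivWithinAt t hγ (fun s hs => mem_slab.2 hs)
  have h1 : HasDerivWithinAt (fun s => localIsotopy ψ p₀ p (s, z))
      (fderivWithin ℝ (localIsotopy ψ p₀ p) (slab (Model m)) (t, z) (1, 0)) (Icc 0 1) t :=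
    hcomp
  have hed : HasFDerivAt (e ∘ (extChartAt (𝓡 m) p₀).symm)
      (fderiv ℝ (e ∘ (extChartAt (𝓡 m) p₀).symm) (localIsotopy ψ p₀ p (t, z)))
      (localIsotopy ψ p₀ p (t, z)) :=
    (((contDiffOn_comp_extChartAt_symm he p₀).contDiffAt
      ((isOpen_extChartAt_target p₀).mem_nhds hyt)).differentiableAt (by simp)).hasFDerivAt
  have h2 := hed.comp_hasDerivWithinAt t h1
  have hev : (fun s => e (ψ s ((extChartAt (𝓡 m) p).symm z))) =ᶠ[𝓝[Icc 0 1] t]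
      (e ∘ (extChartAt (𝓡 m) p₀).symm) ∘ fun s => localIsotopy ψ p₀ p (s, z) := by
    have hc : ContinuousAt (fun s : ℝ => (s, z)) t := by fun_prop
    filter_upwards [self_mem_nhdsWithin,
      mem_nhdsWithin_of_mem_nhds (hc (hU.mem_nhds hq.2))] with s hs hsU
    exact congrArg e ((extChartAt (𝓡 m) p₀).left_inv (hUs (s, z) ⟨mem_slab.2 hs, hsU⟩)).symm
  have h3 := h2.congr_of_eventuallyEq hev (hev.eq_of_nhdsWithin ht)
  have hu : UniqueDiffWithinAt ℝ (Icc (0 : ℝ) 1) t := uniqueDiffOn_Icc one_pos t ht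
  -- The ambient curve has the velocity computed from coordinates and the prescribed one.
  -- Injectivity of the derivative of the parametrisation then recovers the coordinate equation.
  have h4 := hu.eq_deriv _ h3 hx
  have hi : Function.Injective
      (fderiv ℝ (e ∘ (extChartAt (𝓡 m) p₀).symm) (localIsotopy ψ p₀ p (t, z))) := by
    rw [mfderiv_comp_extChartAt_symm he p₀ hyt]
    exact (hinj _).comp (isInvertible_mfderiv_extChartAt_symm p₀ hyt).injective
  exact hi h4

/-- In coordinates the membership says that the local form vanishes on the transported vector.
`gray_transport` runs between any two times of a short interval, forwards or backwards, which gives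
both implications. -/
theorem GrayChart.eventually_mem_iff {ψ : ℝ → M ≃ₘ^∞⟮𝓡 (2 * n + 1), 𝓡 (2 * n + 1)⟯ M}
    (hψ : IsIsotopy ψ) {e : M → F} (he : ContMDiff (𝓡 (2 * n + 1)) 𝓘(ℝ, F) ∞ e)
    (hinj : ∀ p, Function.Injective (mfderiv (𝓡 (2 * n + 1)) 𝓘(ℝ, F) e p)) {V : ℝ × M → F}
    {p₀ p : M} {O : Set (ℝ × Model (2 * n + 1))}
    {A : ℝ × Model (2 * n + 1) → Model (2 * n + 1) →L[ℝ] ℝ}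
    {x : ℝ × Model (2 * n + 1) → Model (2 * n + 1)} {μ : ℝ × Model (2 * n + 1) → ℝ}
    (h : GrayChart ξ p₀ O A x μ)
    (hV : ∀ t ∈ Icc (0 : ℝ) 1, ∀ p ∈ (extChartAt (𝓡 (2 * n + 1)) p₀).source,
      (t, extChartAt (𝓡 (2 * n + 1)) p₀ p) ∈ O →
      V (t, p) = fderiv ℝ (e ∘ (extChartAt (𝓡 (2 * n + 1)) p₀).symm)
        (extChartAt (𝓡 (2 * n + 1)) p₀ p) (x (t, extChartAt (𝓡 (2 * n + 1)) p₀ p)))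
    (hψV : ∀ t ∈ Icc (0 : ℝ) 1, ∀ p,
      HasDerivWithinAt (fun s => e (ψ s p)) (V (t, ψ t p)) (Icc (0 : ℝ) 1) t)
    {t₁ : ℝ} (ht₁ : t₁ ∈ Icc (0 : ℝ) 1)
    (hs : ψ t₁ p ∈ (extChartAt (𝓡 (2 * n + 1)) p₀).source)
    (hm : (t₁, extChartAt (𝓡 (2 * n + 1)) p₀ (ψ t₁ p)) ∈ O)
    (v : TangentSpace (𝓡 (2 * n + 1)) p) :
    ∀ᶠ t in 𝓝[Icc 0 1] t₁,
      (mfderiv (𝓡 (2 * n + 1)) (𝓡 (2 * n + 1)) (ψ t) p v ∈ ξ t (ψ t p) ↔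
        mfderiv (𝓡 (2 * n + 1)) (𝓡 (2 * n + 1)) (ψ t₁) p v ∈ ξ t₁ (ψ t₁ p)) := by
  obtain ⟨U, hU, hUm, hUg, hF⟩ := hψ.exists_domain p₀ p h.isOpen ht₁ hs hm
  set y := extChartAt (𝓡 (2 * n + 1)) p p with hy
  have hyp : (extChartAt (𝓡 (2 * n + 1)) p).symm y = p := extChartAt_to_inv p
  have hode : ∀ q ∈ slab (Model (2 * n + 1)) ∩ U,
      fderivWithin ℝ (localIsotopy ψ p₀ p) (slab (Model (2 * n + 1))) q (1, 0) =
        x (q.1, localIsotopy ψ p₀ p q) := by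
    intro q hq
    refine fderivWithin_localIsotopy he hinj hU (fun q hq => (hUg q hq).2.1) hF hq ?_
    have h1 := hψV q.1 hq.1.1 ((extChartAt (𝓡 (2 * n + 1)) p).symm q.2)
    rw [hV q.1 hq.1.1 _ (hUg q hq).2.1 (hUg q hq).2.2] at h1
    exact h1
  have hiff : ∀ t ∈ Icc (0 : ℝ) 1, (t, y) ∈ U →
      (mfderiv (𝓡 (2 * n + 1)) (𝓡 (2 * n + 1)) (ψ t) p v ∈ ξ t (ψ t p) ↔
        A (t, localIsotopy ψ p₀ p (t, y)) (fderivWithin ℝ (localIsotopy ψ p₀ p)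
          (slab (Model (2 * n + 1))) (t, y) (0, v)) = 0) := by
    intro t ht htU
    have hq : (t, y) ∈ slab (Model (2 * n + 1)) ∩ U := ⟨mem_slab.2 ht, htU⟩
    have hsrc := (hUg _ hq).2.1
    have hD := hasFDerivAt_slice ht (hasFDerivWithinAt_slab hU hF hq)
    rw [h.form_apply_eq_zero_iff (t, localIsotopy ψ p₀ p (t, y)) ⟨mem_slab.2 ht, (hUg _ hq).2.2⟩]
    have hcast : ∀ p q : M, p = q → ∀ u w : Model (2 * n + 1), u = w →
        ((u : TangentSpace (𝓡 (2 * n + 1)) p) ∈ ξ t p ↔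
          (w : TangentSpace (𝓡 (2 * n + 1)) q) ∈ ξ t q) := by
      rintro p _ rfl u _ rfl
      exact Iff.rfl
    refine hcast _ _ ?_ _ _ (mfderiv_eq_of_localIsotopy hD ?_ v)
    · have := (extChartAt (𝓡 (2 * n + 1)) p₀).left_inv hsrc
      simp only [hyp] at this
      refine this.symm.trans ?_
      simp only [localIsotopy, hyp]
    · simpa only [hyp] using hsrc
  have hc : ContinuousAt (fun s : ℝ => (s, y)) t₁ := by fun_prop
  obtain ⟨δ, hδ, hball⟩ := Metric.mem_nhds_iff.1 (hc (hU.mem_nhds hUm))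
  set a := max 0 (t₁ - δ / 2) with ha
  set b := min 1 (t₁ + δ / 2) with hb
  have hab : Icc a b ⊆ Icc (0 : ℝ) 1 := Icc_subset_Icc (le_max_left _ _) (min_le_left _ _)
  have habU : ∀ t ∈ Icc a b, (t, y) ∈ U := by
    intro t ht
    refine hball ?_
    rw [Metric.mem_ball, Real.dist_eq, abs_lt]
    have h1 := (le_max_right 0 (t₁ - δ / 2)).trans ht.1
    have h2 := ht.2.trans (min_le_right 1 (t₁ + δ / 2))
    constructor <;> linarith
  have ht₁ab : t₁ ∈ Icc a b := ⟨max_le ht₁.1 (by linarith), le_min ht₁.2 (by linarith)⟩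
  have hnb : Icc a b ∈ 𝓝[Icc 0 1] t₁ := by
    have : Icc (t₁ - δ / 2) (t₁ + δ / 2) ∈ 𝓝 t₁ := Icc_mem_nhds (by linarith) (by linarith)
    filter_upwards [mem_nhdsWithin_of_mem_nhds this, self_mem_nhdsWithin] with t h1 h2
    exact ⟨max_le h2.1 h1.1, le_min h2.2 h1.2⟩
  have htr : ∀ s ∈ Icc a b, ∀ t ∈ Icc a b,
      A (s, localIsotopy ψ p₀ p (s, y)) (fderivWithin ℝ (localIsotopy ψ p₀ p)
          (slab (Model (2 * n + 1))) (s, y) (0, v)) = 0 →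
      A (t, localIsotopy ψ p₀ p (t, y)) (fderivWithin ℝ (localIsotopy ψ p₀ p)
          (slab (Model (2 * n + 1))) (t, y) (0, v)) = 0 := fun s hs t ht =>
    gray_transport h.isOpen h.contDiffOn_form h.contDiffOn_field h.contDiffOn_factor h.equation
      hU hF (fun q hq => (hUg q hq).2.2) hode hab habU v hs ht
  filter_upwards [hnb] with t ht
  rw [hiff t (hab ht) (habU t ht), hiff t₁ ht₁ (habU t₁ ht₁ab)]
  exact ⟨htr t ht t₁ ht₁ab, htr t₁ ht₁ab t ht⟩

/-- A locally constant truth value is constant, because `[0,1]` is connected. -/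
theorem forall_Icc_iff_of_eventually {P : ℝ → Prop}
    (h : ∀ t₁ ∈ Icc (0 : ℝ) 1, ∀ᶠ t in 𝓝[Icc 0 1] t₁, (P t ↔ P t₁)) {s t : ℝ}
    (hs : s ∈ Icc (0 : ℝ) 1) (ht : t ∈ Icc (0 : ℝ) 1) : P s ↔ P t := by
  have hpre : PreconnectedSpace (Icc (0 : ℝ) 1) :=
    isPreconnected_iff_preconnectedSpace.1 isPreconnected_Icc
  have hloc : IsLocallyConstant (fun t : Icc (0 : ℝ) 1 => P t) := by
    rw [IsLocallyConstant.iff_eventually_eq]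
    rintro ⟨t, ht⟩
    have := (preimage_coe_mem_nhds_subtype (s := Icc (0 : ℝ) 1) (a := ⟨t, ht⟩)
      (t := {r | P r ↔ P t})).2 (h t ht)
    filter_upwards [this] with r hr
    exact propext hr
  exact iff_of_eq (hloc.apply_eq_of_preconnectedSpace ⟨s, hs⟩ ⟨t, ht⟩)

end Transport

end ContactGeometry

end

/-- Gray stability. -/
theorem mainTheorem3 (n : ℕ) (M : Type*) [TopologicalSpace M]
    [ChartedSpace (ContactGeometry.Model (2 * n + 1)) M] [IsManifold (𝓡 (2 * n + 1)) ∞ M]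
    [CompactSpace M] [T2Space M]
    (ξ : ℝ → ∀ p : M, Submodule ℝ (TangentSpace (𝓡 (2 * n + 1)) p))
    (hξ : ContactGeometry.IsSmoothContactFamily ξ) :
    ∃ ψ : ℝ → M ≃ₘ^∞⟮𝓡 (2 * n + 1), 𝓡 (2 * n + 1)⟯ M, ContactGeometry.IsIsotopy ψ ∧
      ∀ t ∈ Icc (0 : ℝ) 1, ∀ p : M,
        (ξ 0 p).map (mfderiv (𝓡 (2 * n + 1)) (𝓡 (2 * n + 1)) (ψ t) p :
          TangentSpace (𝓡 (2 * n + 1)) p →ₗ[ℝ] TangentSpace (𝓡 (2 * n + 1)) (ψ t p)) =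
        ξ t (ψ t p) := by
  obtain ⟨N, e, he, hemb, hinj⟩ :=
    exists_embedding_euclidean_of_compact (I := 𝓡 (2 * n + 1)) (M := M)
  obtain ⟨V, hV, htan, hloc⟩ := hξ.exists_field he
  obtain ⟨ψ, hψ, hψV⟩ := ContactGeometry.exists_isotopy he hemb hinj hV htan
  refine ⟨ψ, hψ, fun t ht p => ?_⟩
  have h0 : (0 : ℝ) ∈ Icc (0 : ℝ) 1 := ⟨le_rfl, zero_le_one⟩
  have hiff : ∀ v : TangentSpace (𝓡 (2 * n + 1)) p,
      mfderiv (𝓡 (2 * n + 1)) (𝓡 (2 * n + 1)) (ψ t) p v ∈ ξ t (ψ t p) ↔ v ∈ ξ 0 p := by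
    intro v
    have h1 := ContactGeometry.forall_Icc_iff_of_eventually
      (P := fun t => mfderiv (𝓡 (2 * n + 1)) (𝓡 (2 * n + 1)) (ψ t) p v ∈ ξ t (ψ t p))
      (fun t₁ ht₁ => by
        obtain ⟨O, A, x, μ, hc, hm⟩ := hξ.exists_grayChart ht₁ (ψ t₁ p)
        exact hc.eventually_mem_iff hψ he hinj (hloc _ _ _ _ _ hc) hψV ht₁
          (mem_extChartAt_source _) hm v) ht h0
    have hid : (ψ 0 : M → M) = id := funext hψ.zero
    have h2 : mfderiv (𝓡 (2 * n + 1)) (𝓡 (2 * n + 1)) (ψ 0) p v ∈ ξ 0 (ψ 0 p) ↔ v ∈ ξ 0 p := by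
      rw [hid, mfderiv_id]
      rfl
    exact h1.trans h2
  ext w
  rw [Submodule.mem_map]
  constructor
  · rintro ⟨v, hv, rfl⟩
    exact (hiff v).2 hv
  · intro hw
    -- Surjectivity of the derivative of the diffeomorphism turns the equivalence on vectors into
    -- equality of subspaces.
    obtain ⟨v, rfl⟩ := ((ψ t).mfderivToContinuousLinearEquiv (by simp) p).surjective w
    exact ⟨v, (hiff v).1 hw, rfl⟩
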